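/- **Ground-structures.** Types are generated by $A ::= 1 \mid \bot \mid A\otimes A \mid A\wp A \mid {!}A \mid {?}A$ and labels ($\wp$ denotes par) are $1,\bot,\otimes,\wp,!,?,\circ$. A *differential ground-structure* $G$ consists of: a finite set $\mathcal P(G)$ of ports, each with a label and a type; a set $\mathcal W(G)\subseteq\mathcal P(G)$ of wires (none labelled $\circ$), each with a target $t_G(w)\in\mathcal P(G)$ not labelled $1$ or $\bot$; and a set of left wires. The wires with target $p$ are the premises of $p$. Every port labelled $\otimes$ or $\wp$ has exactly two premises, exactly one of which is left; left wires occur only there. Ports labelled $1,\bot$ have types $1,\bot$; a $\otimes$-port (resp. $\wp$-port) with left premise of type $A$ and other premise of type $B$ has type $A\otimes B$ (resp. $A\wp B$); a $!$-port (resp. a port labelled $?$ or $\circ$) has some type $!C$ (resp. $?C$) and all its premises have type $C$. Conclusions are the ports that are not wires; $\circ$-conclusions are the ports labelled $\circ$; exponential ports are those labelled $!$, $?$ or $\circ$. **$\circ$-PS's.** By mutual induction on the depth, a *differential $\circ$-PS* $S=(G,\mathcal B_0,B,b)$ is a differential ground-structure $G$ with a set $\mathcal B_0$ of $!$-ports without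 premises (the boxes at depth $0$), for every $o\in\mathcal B_0$ a $\circ$-PS $B(o)$ (its content), and a map $b(o)$ (the door map) from the conclusions of $B(o)$ to $\{o\}\cup\{q: q \text{ labelled } ? \text{ or } \circ\}$, such that: $o$ is in the image of $b(o)$; $b(o)$ is injective on $\circ$-conclusions, sends none of them to a $!$-port and preserves their types; it sends a conclusion of type $A$ not labelled $\circ$ to a port of type $?A$ or $!A$. A *$\circ$-PS* is a differential $\circ$-PS in which no $!$-port and no $\circ$-port has a premise, every $!$-port is in $\mathcal B_0$, every $\circ$-port is in the image of some $b(o)$, and $b(o)(p)=p$ for every box $o$ at depth $0$ and every $\circ$-conclusion $p$ of $B(o)$. The depth of $S$ is $0$ if $\mathcal B_0=\emptyset$, and otherwise the maximum of $\mathrm{depth}(B(o))+1$ for $o\in\mathcal B_0$. The boxes of $S$ (at any depth) are the $o\in\mathcal B_0$ and the sequences $o:o'$ with $o\in\mathcal B_0$ and $o'$ a box of $B(o)$. We write $G_S,\mathcal B_0(S),B_S,b_S,t_S=t_{G_S},\mathcal P_0(S)=\mathcal P(G_S)$. An isomorphism $\rho:S\simeq S'$ is a bijection $\mathcal P_0(S)\to\mathcal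 P_0(S')$ preserving labels, types, wires, targets and left wires in both directions and mapping $\mathcal B_0(S)$ onto $\mathcal B_0(S')$, together with, for every $o\in\mathcal B_0(S)$, an isomorphism $\psi_o:B_S(o)\simeq B_{S'}(\rho(o))$ with $b_{S'}(\rho(o))\circ\psi_o=\rho\circ b_S(o)$. We write $S\equiv S'$ if there is an isomorphism that is the identity on the conclusions of $S$. The *arity* $a_S(q)$ of a port $q$ is the number of premises of $q$, plus the number of pairs $(o,p)$ with $o\in\mathcal B_0(S)$, $p$ a conclusion of $B_S(o)$ not labelled $\circ$ and $b_S(o)(p)=q$, plus the sum of $a_{B_S(o)}(p)$ over the pairs $(o,p)$ with $p$ a $\circ$-conclusion of $B_S(o)$ and $b_S(o)(p)=q$. The *cosize* of $S$ is the maximum of $0$, of the $a_S(q)$, $q\in\mathcal P_0(S)$, and of the cosizes of the $B_S(o)$, $o\in\mathcal B_0(S)$. **Pseudo-experiments.** A *pseudo-experiment* $e$ of a $\circ$-PS $R$ consists of a natural number and, for every $o\in\mathcal B_0(R)$, a finite set $e(o)$ of pseudo-experiments of $B_R(o)$. For a box of $R$ put $e^\#(o)=\{|e(o)|\}$ and $e^\#(o:o')=\bigcup_{e'\in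 e(o)}e'^\#(o')$. For $k>1$, $e$ is *$k$-injective* if (i) every element of every $e^\#(o)$ is $k^j$ for some $j>0$; (ii) $e_1^\#(o')\cap e_2^\#(o')=\emptyset$ for every $o\in\mathcal B_0(R)$, every box $o'$ of $B_R(o)$ and distinct $e_1,e_2\in e(o)$; (iii) $e^\#(o_1)\cap e^\#(o_2)=\emptyset$ for distinct boxes $o_1,o_2$ of $R$; (iv) every $e'\in e(o)$, $o\in\mathcal B_0(R)$, is $k$-injective. The *partial expansion* $T(e)[i]$ is defined by induction on the depth of $R$. Its ports at depth $0$ are those of $R$, and the $(o,e_1):x$ where $o\in\mathcal B_0(R)$, $\mathrm{depth}(B_R(o))\ge i$, $e_1\in e(o)$ and $x\in\mathcal P_0(T(e_1)[i])$ is not a $\circ$-conclusion of $B_R(o)$. For such $o,e_1$ and a port $x$ of $T(e_1)[i]$ let $\lambda_{o,e_1}(x)=b_R(o)(x)$ if $x$ is a $\circ$-conclusion of $B_R(o)$, and $\lambda_{o,e_1}(x)=(o,e_1):x$ otherwise. Ports of $R$ keep label, type, target and left status. The label, type and left status of $(o,e_1):x$ are those of $x$. All the $(o,e_1):x$ are wires: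 the target of $(o,e_1):x$ is $\lambda_{o,e_1}(t_{T(e_1)[i]}(x))$ if $x$ is a wire of $T(e_1)[i]$, and $b_R(o)(x)$ if $x$ is a conclusion. The boxes at depth $0$ are the $o\in\mathcal B_0(R)$ with $\mathrm{depth}(B_R(o))<i$, with their content and door map in $R$, and the $(o,e_1):x$ as above with $x\in\mathcal B_0(T(e_1)[i])$, with content $B_{T(e_1)[i]}(x)$ and door map $\lambda_{o,e_1}\circ b_{T(e_1)[i]}(x)$. **Digits.** Write $\mathrm{dig}_j(n)$ for the $j$-th digit of $n$ in base $k$, i.e. $n=\sum_{j\ge0}\mathrm{dig}_j(n)k^j$ with $0\le \mathrm{dig}_j(n)<k$. Put $\mathcal M_0(e)=\{j: k^j\in e^\#(o)\text{ for some box }o\text{ of }R\}$, $\mathcal M_{i+1}(e)=\{j>0:\mathrm{dig}_j(|\mathcal M_i(e)|)\ne0\}$ and $\mathcal N_i(e)=\mathcal M_i(e)\setminus\mathcal M_{i+1}(e)$. The critical ports are $\mathcal K_{k,j}(S)=\{p\in\mathcal P_0(S): p\text{ exponential},\ \mathrm{dig}_j(a_S(p))\ne0\}$. **Components.** For differential $\circ$-PS's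 $T,S$ and a set $Q$ of exponential ports of $S$ at depth $0$, $T\sqsubseteq_Q S$ means: $\mathcal P_0(T)\subseteq\mathcal P_0(S)$; the wires of $T$ are the wires $w\in\mathcal P_0(T)\setminus Q$ of $S$ with $t_S(w)\in\mathcal P_0(T)$; labels, types and targets of $T$ are restrictions of those of $S$; the left wires of $T$ are the left wires of $S$ whose target is a $\otimes$- or $\wp$-port of $T$; $\mathcal B_0(T)=\mathcal B_0(S)\cap\mathcal P_0(T)$, and $B_T,b_T$ are restrictions of $B_S,b_S$. For $p,p'\in\mathcal P_0(S)$ put $p\frown_S p'$ if $t_S(p)=p'$ or $t_S(p')=p$ or both $p$ and $p'$ are in the image of $b_S(o)$ for one $o\in\mathcal B_0(S)$. Let $\mathcal S_k^{Q}(S)$ be the set of the $T\sqsubseteq_Q S$ such that: any $p,p'\in\mathcal P_0(T)$ are joined by a finite sequence $p=p_0,\dots,p_n=p'$ in $\mathcal P_0(T)$ with $p_j\frown_S p_{j+1}$ and ($p_j\in Q\Rightarrow j=0$) for all $j<n$; the cosize of $T$ is $<k$; all conclusions of $T$ are in $Q$; $\mathcal P_0(T)\not\subseteq Q$; and if $p\in\mathcal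 P_0(T)$, $q\in\mathcal P_0(S)\setminus\mathcal P_0(T)$ and $p\frown_S q$, then $p\in Q$. **Boxing and glueing.** $S$ is *boxable* if all its conclusions are exponential ports, none of them is in $\mathcal B_0(S)$, and every $!$-port outside $\mathcal B_0(S)$ is a conclusion. Then $\overline S$ is obtained by removing the conclusions of $S$ that are in the image of no $b_S(o)$ and relabelling the other conclusions by $\circ$: its ports are the wires of $S$ (with their labels) and those conclusions (labelled $\circ$), its wires are the wires of $S$ whose target is a wire of $S$, targets, left wires and types are restricted, and the boxes at depth $0$, their contents and their door maps are those of $S$. A set $\mathcal V$ of such structures is *gluable* if every port common to two distinct elements is labelled $\circ$ in both; $\sum\mathcal V$ is then the componentwise union of the elements of $\mathcal V$. We write $\overline{\mathcal U}=\{\overline T: T\in\mathcal U\}$. **Theorem.** Let $R$ be a $\circ$-PS, let $k>1$ be greater than the number of boxes of $R$ (at any depth) and than the cosize of $R$, let $e$ be a $k$-injective pseudo-experiment of $R$, let $i\in\mathbb N$ and $j_0\in\mathcal N_i(e)$. Put $\mathcal T=\mathcal S_k^{Q}(T(e)[i])$ with $Q=\mathcal K_{k,j_0}(T(e)[i])$.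 Let $\mathcal U\subseteq\mathcal T$ be such that for every $T\in\mathcal T$ $$|\{T'\in\mathcal U: T'\equiv T\}|=\mathrm{dig}_{j_0}\big(|\{T'\in\mathcal T: T'\equiv T\}|\big).$$ Then every element of $\mathcal U$ is boxable and $\overline{\mathcal U}$ is gluable. There is a unique port ${!}_{e,i}(j_0)$ of $T(e)[i]$ at depth $0$ that is labelled $!$, is not in $\mathcal B_0(T(e)[i])$ and has arity $c\,k^{j_0}$ in $T(e)[i]$ for some $0<c<k$. This port $o={!}_{e,i}(j_0)$ is in $\mathcal B_0(T(e)[i+1])$; moreover $c$ is the number of conclusions $q$ of its content with $b_{T(e)[i+1]}(o)(q)=o$ (so $c=1$, and the arity is $k^{j_0}$, if there is one such conclusion). Finally there is an isomorphism $$\rho: B_{T(e)[i+1]}(o)\simeq\sum\overline{\mathcal U}$$ such that $b_{T(e)[i+1]}(o)(q)=\rho(q)$ for every $\circ$-conclusion $q$ of $B_{T(e)[i+1]}(o)$, while for every other conclusion $q$ of it, $\rho(q)$ is a wire of $T(e)[i]$ and $b_{T(e)[i+1]}(o)(q)=t_{T(e)[i]}(\rho(q))$. -/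

import Mathlib

universe u

namespace MELL

/-- The `j`-th digit of `n` in base `k`. -/
def digit (k n j : ℕ) : ℕ := (Nat.digits k n).getD j 0

/-- Labels of ports; `circ` is the label of pre-contractions. -/
inductive Label
  | one | bot | tensor | par | bang | whynot | circ

/-- Propositional types (formulas). -/
inductive Ty
  | one | bot
  | tensor (A B : Ty) | par (A B : Ty)
  | bang (A : Ty) | whynot (A : Ty)

/-- The data `(W, P, l, t, L, T)` of a ground-structure. A partial function is a function into an
`Option` type; its domain is the set of points where it is not `none`. -/
structure Ground (β : Type u) where
  wires : Set β
  ports : Set β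
  label : β → Option Label
  target : β → Option β
  left : Set β
  ty : β → Option Ty

namespace Ground

variable {β : Type u}

def conclusions (G : Ground β) : Set β := G.ports \ G.wires

def portsOf (G : Ground β) (l : Label) : Set β := {p | p ∈ G.ports ∧ G.label p = some l}

def multPorts (G : Ground β) : Set β := G.portsOf .tensor ∪ G.portsOf .par

def expPorts (G : Ground β) : Set β := G.portsOf .bang ∪ G.portsOf .whynot ∪ G.portsOf .circ

def premises (G : Ground β) (p : β) : Set β := {w | w ∈ G.wires ∧ G.target w = some p}

/-- `G` is a differential ground-structure. -/
structure IsDifferential (G : Ground β) : Prop where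
  finite_ports : G.ports.Finite
  label_dom : ∀ p, p ∈ G.ports ↔ G.label p ≠ none
  ty_dom : ∀ p, p ∈ G.ports ↔ G.ty p ≠ none
  wires_sub : ∀ w ∈ G.wires, w ∈ G.ports ∧ G.label w ≠ some .circ
  target_dom : ∀ w, w ∈ G.wires ↔ G.target w ≠ none
  target_mem : ∀ w q, G.target w = some q →
    q ∈ G.ports ∧ G.label q ≠ some .one ∧ G.label q ≠ some .bot
  binary : ∀ p ∈ G.multPorts, (G.premises p).ncard = 2
  left_sub : ∀ w ∈ G.left, w ∈ G.wires ∧ ∃ q ∈ G.multPorts, G.target w = some q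
  left_unique : ∀ p ∈ G.multPorts, (G.left ∩ G.premises p).ncard = 1
  ty_one : ∀ p ∈ G.portsOf .one, G.ty p = some .one
  ty_bot : ∀ p ∈ G.portsOf .bot, G.ty p = some .bot
  ty_tensor : ∀ p ∈ G.portsOf .tensor, ∀ w₁ ∈ G.premises p, ∀ w₂ ∈ G.premises p,
    w₁ ∈ G.left → w₂ ∉ G.left →
      ∀ A B, G.ty w₁ = some A → G.ty w₂ = some B → G.ty p = some (.tensor A B)
  ty_par : ∀ p ∈ G.portsOf .par, ∀ w₁ ∈ G.premises p, ∀ w₂ ∈ G.premises p,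
    w₁ ∈ G.left → w₂ ∉ G.left →
      ∀ A B, G.ty w₁ = some A → G.ty w₂ = some B → G.ty p = some (.par A B)
  ty_bang : ∀ p ∈ G.portsOf .bang,
    ∃ C, G.ty p = some (.bang C) ∧ ∀ w ∈ G.premises p, G.ty w = some C
  ty_whynot : ∀ p ∈ G.portsOf .whynot ∪ G.portsOf .circ,
    ∃ C, G.ty p = some (.whynot C) ∧ ∀ w ∈ G.premises p, G.ty w = some C

/-- `φ` (only its values on ports matter) is an isomorphism of ground-structures. -/
structure IsIso {β' : Type u} (G : Ground β) (G' : Ground β') (φ : β → β') : Prop where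
  bij : Set.BijOn φ G.ports G'.ports
  wires : ∀ p ∈ G.ports, (p ∈ G.wires ↔ φ p ∈ G'.wires)
  label : ∀ p ∈ G.ports, G'.label (φ p) = G.label p
  target : ∀ w ∈ G.wires, G'.target (φ w) = (G.target w).map φ
  left : ∀ p ∈ G.ports, (p ∈ G.left ↔ φ p ∈ G'.left)
  ty : ∀ p ∈ G.ports, G'.ty (φ p) = G.ty p

end Ground

/-- Raw 4-tuples `(G, B₀, B, b)`: a ground-structure with ports named in `β`, the set of boxes at
depth `0`, their contents (nets whose ports are named in `α`) and their door maps, `door o` being a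
partial function from the ports of the content of `o` to the ports at depth `0`. -/
inductive Net (α : Type u) : Type u → Type (u + 1)
  | mk {β : Type u} (ground : Ground β) (boxes : Set β) (content : boxes → Net α α)
      (door : boxes → α → Option β) : Net α β

namespace Net

variable {α β β' : Type u}

def ground : Net α β → Ground β
  | .mk G _ _ _ => G

def boxes : Net α β → Set β
  | .mk _ bx _ _ => bx

def content : (S : Net α β) → S.boxes → Net α α
  | .mk _ _ ct _ => ct

def door : (S : Net α β) → S.boxes → α → Option β
  | .mk _ _ _ dr => dr

def ports (S : Net α β) : Set β := S.ground.ports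
def conclusions (S : Net α β) : Set β := S.ground.conclusions
/-- The `∘`-conclusions, i.e. the ports labelled by `∘`. -/
def circs (S : Net α β) : Set β := S.ground.portsOf .circ
def notCircs (S : Net α β) : Set β := S.conclusions \ S.circs

/-- All the requirements on a differential `∘`-PS, except that the contents of the boxes have to be
`∘`-PS's. -/
structure IsPreDifferential (S : Net α β) : Prop where
  ground : S.ground.IsDifferential
  boxes_sub : ∀ o ∈ S.boxes, o ∈ S.ground.portsOf .bang ∧ S.ground.premises o = ∅
  door_dom : ∀ (o : S.boxes) (p : α), p ∈ (S.content o).conclusions ↔ S.door o p ≠ none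
  door_mem : ∀ (o : S.boxes) (p : α) (q : β), S.door o p = some q →
    q = o ∨ q ∈ S.ground.portsOf .whynot ∨ q ∈ S.ground.portsOf .circ
  door_injOn : ∀ (o : S.boxes), ∀ p ∈ (S.content o).circs, ∀ p' ∈ (S.content o).circs,
    S.door o p = S.door o p' → p = p'
  door_main : ∀ o : S.boxes, ∃ p : α, S.door o p = some (o : β)
  door_circ : ∀ (o : S.boxes), ∀ p ∈ (S.content o).circs, ∀ q, S.door o p = some q →
    q ∉ S.ground.portsOf .bang
  ty_circ : ∀ (o : S.boxes), ∀ p ∈ (S.content o).circs, ∀ q, S.door o p = some q →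
    S.ground.ty q = (S.content o).ground.ty p
  ty_notCirc : ∀ (o : S.boxes), ∀ p ∈ (S.content o).notCircs, ∀ q, S.door o p = some q →
    ∃ A, (S.content o).ground.ty p = some A ∧
      (S.ground.ty q = some (.whynot A) ∨ S.ground.ty q = some (.bang A))

/-- `R` is a `∘`-PS. -/
inductive IsCircPS : Net α α → Prop
  | intro (R : Net α α)
      (pre : R.IsPreDifferential)
      (no_premise : ∀ w q, R.ground.target w = some q →
        q ∉ R.ground.portsOf .bang ∧ q ∉ R.ground.portsOf .circ)
      (boxes_eq : R.boxes = R.ground.portsOf .bang)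
      (circ_covered : ∀ q ∈ R.circs, ∃ (o : R.boxes) (p : α), R.door o p = some q)
      (door_circ_id : ∀ (o : R.boxes), ∀ p ∈ (R.content o).circs, R.door o p = some p)
      (contents : ∀ o : R.boxes, IsCircPS (R.content o)) : IsCircPS R

/-- `S` is a differential `∘`-PS. -/
def IsDiffPS (S : Net α β) : Prop :=
  S.IsPreDifferential ∧ ∀ o : S.boxes, (S.content o).IsCircPS

noncomputable def depth : {β : Type u} → Net α β → ℕ
  | _, .mk _ bx ct _ => ⨆ o : bx, (depth (ct o) + 1)

/-- The set of boxes of a net, at any depth: `⟨o, none⟩` is the box `o` at depth `0`, and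
`⟨o, some o'⟩` is the box `o : o'`, where `o'` is a box of the content of `o`. -/
def Box : {β : Type u} → Net α β → Type u
  | _, .mk _ bx ct _ => (o : bx) × Option (Box (ct o))

/-- The arity of a port, ignoring the `∘`-conclusions of the boxes. -/
noncomputable def arity : {β : Type u} → Net α β → β → ℕ
  | _, .mk G bx ct dr, q =>
    (G.premises q).ncard
    + ∑ᶠ o : bx, {p | p ∈ (ct o).notCircs ∧ dr o p = some q}.ncard
    + ∑ᶠ o : bx, ∑ᶠ p ∈ {p | p ∈ (ct o).circs ∧ dr o p = some q}, arity (ct o) p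

noncomputable def cosize : {β : Type u} → Net α β → ℕ
  | _, .mk G bx ct dr =>
    max (⨆ p : G.ports, (Net.mk G bx ct dr).arity p) (⨆ o : bx, cosize (ct o))

/-- `φ` is the ground part of an isomorphism `R ≃ R'`. -/
def IsIso : {β β' : Type u} → Net α β → Net α β' → (β → β') → Prop
  | _, _, .mk G bx ct dr, .mk G' bx' ct' dr', φ =>
    G.IsIso G' φ ∧ bx' = φ '' bx ∧
    ∀ (o : bx) (o' : bx'), (↑o' : _) = φ ↑o →
      ∃ ψ : α → α, IsIso (ct o) (ct' o') ψ ∧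
        ∀ q ∈ (ct o).conclusions, dr' o' (ψ q) = (dr o q).map φ

/-- `R ≡ R'`: isomorphic through an isomorphism that is the identity on the conclusions. -/
def Same (R R' : Net α β) : Prop :=
  ∃ φ : β → β, R.IsIso R' φ ∧ ∀ p ∈ R.conclusions, φ p = p

/-- Pseudo-experiments of `R`: a natural number together with, for every box `o` at depth `0`, a
finite set of pseudo-experiments of the content of `o`. -/
def PseudoExp : {β : Type u} → Net α β → Type u
  | _, .mk _ bx ct _ => ℕ × ((o : bx) → Finset (PseudoExp (ct o)))

/-- The function `e^#`. -/
def copies : {β : Type u} → (R : Net α β) → PseudoExp R → Box R → Set ℕ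
  | _, .mk _ bx ct _, e, b =>
    match (b : (o : bx) × Option (Box (ct o))) with
    | ⟨o, none⟩ => {(e.2 o).card}
    | ⟨o, some o'⟩ => {n | ∃ e' ∈ e.2 o, n ∈ copies (ct o) e' o'}

/-- `k`-injective pseudo-experiments: the numbers of copies taken of two different occurrences of
boxes are different powers of `k`, with positive exponents. -/
def KInjective (k : ℕ) : {β : Type u} → (R : Net α β) → PseudoExp R → Prop
  | _, .mk G bx ct dr, e =>
    (∀ o, ∀ m ∈ copies (.mk G bx ct dr) e o, ∃ j > 0, m = k ^ j) ∧
    (∀ (o : bx) (o' : Box (ct o)), ∀ e₁ ∈ e.2 o, ∀ e₂ ∈ e.2 o,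
      (copies (ct o) e₁ o' ∩ copies (ct o) e₂ o').Nonempty → e₁ = e₂) ∧
    (∀ o₁ o₂, (copies (.mk G bx ct dr) e o₁ ∩ copies (.mk G bx ct dr) e o₂).Nonempty → o₁ = o₂) ∧
    (∀ (o : bx), ∀ e' ∈ e.2 o, KInjective k (ct o) e')

/-- The sets `M_i(e)`. -/
noncomputable def expM (k : ℕ) (R : Net α β) (e : PseudoExp R) : ℕ → Set ℕ
  | 0 => {j | ∃ o : Box R, k ^ j ∈ copies R e o}
  | i + 1 => {j | 0 < j ∧ digit k (expM k R e i).ncard j ≠ 0}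

/-- The sets `N_i(e)`. -/
def expN (k : ℕ) (R : Net α β) (e : PseudoExp R) (i : ℕ) : Set ℕ :=
  expM k R e i \ expM k R e (i + 1)

/-- Names for the ports of the partial expansions of `R`: `Sum.inl p` is the port `p` of `R`, and
`Sum.inr ⟨o, e, x⟩` is `(o, e) : x`. -/
def Name : {β : Type u} → Net α β → Type u
  | β, .mk _ bx ct _ => β ⊕ ((o : bx) × PseudoExp (ct o) × Name (ct o))

/-- `some p` on the port `p` of `R` itself, and `none` on the names `(o, e) : x`. -/
def Name.toBase : {β : Type u} → (R : Net α β) → Name R → Option β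
  | β, .mk _ bx ct _, x =>
    match (x : β ⊕ ((o : bx) × PseudoExp (ct o) × Name (ct o))) with
    | .inl p => some p
    | .inr _ => none

/-- The port at depth `0` of the expansion of `R = (G, bx, ct, dr)` that corresponds to the port `x`
of the copy `e` of the box `o`: if `x` is a `∘`-conclusion `p` of the content of `o` then `p` is
identified with its image by the door map, otherwise it is `(o, e) : x`. -/
noncomputable def Name.lift {bx : Set β} (ct : bx → Net α α) (dr : bx → α → Option β) (o : bx)
    (e : PseudoExp (ct o)) (x : Name (ct o)) :
    Option (β ⊕ ((o : bx) × PseudoExp (ct o) × Name (ct o))) :=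
  open Classical in
  match Name.toBase (ct o) x with
  | some p => if p ∈ (ct o).circs then (dr o p).map .inl else some (.inr ⟨o, e, x⟩)
  | none => some (.inr ⟨o, e, x⟩)

section Expansion

variable (i : ℕ) (G : Ground β) {bx : Set β} (ct : bx → Net α α) (dr : bx → α → Option β)
  (cp : (o : bx) → Finset (PseudoExp (ct o)))
  (T : (o : bx) → PseudoExp (ct o) → Net α (Name (ct o)))

/-- The copy `e` of the box `o` has to be expanded. -/
def Expanded (o : bx) (e : PseudoExp (ct o)) : Prop := i ≤ (ct o).depth ∧ e ∈ cp o

/-- `(o, e) : x` is a port of the expansion. -/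
def IsCopyPort (o : bx) (e : PseudoExp (ct o)) (x : Name (ct o)) : Prop :=
  Expanded i ct cp o e ∧ x ∈ (T o e).ports ∧ ¬ ∃ p ∈ (ct o).circs, Name.toBase (ct o) x = some p

/-- The boxes at depth `0` of the expansion. -/
def expansionBoxes : Set (β ⊕ ((o : bx) × PseudoExp (ct o) × Name (ct o))) :=
  {x | match x with
    | .inl o => ∃ h : o ∈ bx, (ct ⟨o, h⟩).depth < i
    | .inr ⟨o, e, x⟩ => Expanded i ct cp o e ∧ x ∈ (T o e).boxes}

/-- The expansion of the net `(G, bx, ct, dr)`, where `cp o` is the set of copies of the box `o`, and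
where `T o e` is the expansion of the content of the box `o` according to its copy `e`: the boxes of
depth `≥ i` are replaced by their copies, and the boxes of depth `< i` are kept. -/
noncomputable def expansion : Net α (β ⊕ ((o : bx) × PseudoExp (ct o) × Name (ct o))) :=
  open Classical in
  .mk
    { wires := {x | match x with
        | .inl p => p ∈ G.wires
        | .inr ⟨o, e, x⟩ => IsCopyPort i ct cp T o e x}
      ports := {x | match x with
        | .inl p => p ∈ G.ports
        | .inr ⟨o, e, x⟩ => IsCopyPort i ct cp T o e x}
      label := fun x => match x with
        | .inl p => G.label p
        | .inr ⟨o, e, x⟩ => if IsCopyPort i ct cp T o e x then (T o e).ground.label x else none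
      target := fun x => match x with
        | .inl p => (G.target p).map .inl
        | .inr ⟨o, e, x⟩ =>
          if IsCopyPort i ct cp T o e x then
            match (T o e).ground.target x with
            | some y => Name.lift ct dr o e y
            | none => (Name.toBase (ct o) x).bind fun p => (dr o p).map .inl
          else none
      left := {x | match x with
        | .inl p => p ∈ G.left
        | .inr ⟨o, e, x⟩ => Expanded i ct cp o e ∧ x ∈ (T o e).ground.left}
      ty := fun x => match x with
        | .inl p => G.ty p
        | .inr ⟨o, e, x⟩ => if IsCopyPort i ct cp T o e x then (T o e).ground.ty x else none }
    (expansionBoxes i ct cp T)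
    (fun x => match x with
      | ⟨.inl o, h⟩ => ct ⟨o, h.1⟩
      | ⟨.inr ⟨o, e, x⟩, h⟩ => (T o e).content ⟨x, h.2⟩)
    (fun x => match x with
      | ⟨.inl o, h⟩ => fun p => (dr ⟨o, h.1⟩ p).map .inl
      | ⟨.inr ⟨o, e, x⟩, h⟩ => fun p => ((T o e).door ⟨x, h.2⟩ p).bind (Name.lift ct dr o e))

end Expansion

/-- The partial expansion `T(e)[i]` of a pseudo-experiment `e` of `R`. -/
noncomputable def taylor (i : ℕ) : {β : Type u} → (R : Net α β) → PseudoExp R → Net α (Name R)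
  | _, .mk G _ ct dr, e => expansion i G ct dr e.2 fun o e₁ => taylor i (ct o) e₁

/-- The set `K_k,j(S)` of critical ports. -/
def critical (S : Net α β) (k j : ℕ) : Set β :=
  {p | p ∈ S.ground.expPorts ∧ digit k (S.arity p) j ≠ 0}

/-- `T ⊑_Q S`. -/
structure IsSub (Q : Set β) (T S : Net α β) : Prop where
  diff : T.IsDiffPS
  exp : Q ⊆ S.ground.expPorts
  ports : T.ports ⊆ S.ports
  wires : T.ground.wires =
    {w | w ∈ S.ground.wires ∧ w ∈ T.ports ∧ w ∉ Q ∧ ∃ q ∈ T.ports, S.ground.target w = some q}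
  label : ∀ p ∈ T.ports, T.ground.label p = S.ground.label p
  target : ∀ w ∈ T.ground.wires, T.ground.target w = S.ground.target w
  left : T.ground.left = S.ground.left ∩
    {w | w ∈ S.ground.wires ∧ ∃ q ∈ T.ground.multPorts, S.ground.target w = some q}
  ty : ∀ p ∈ T.ports, T.ground.ty p = S.ground.ty p
  boxes : T.boxes = S.boxes ∩ T.ports
  content : ∀ (o : T.boxes) (o' : S.boxes), (o : β) = o' → T.content o = S.content o'
  door : ∀ (o : T.boxes) (o' : S.boxes), (o : β) = o' → T.door o = S.door o'

/-- The relation `p ⌣ p'` on the ports of `S` at depth `0`. -/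
def Coh (S : Net α β) (p p' : β) : Prop :=
  (p ∈ S.ground.wires ∧ S.ground.target p = some p') ∨
  (p' ∈ S.ground.wires ∧ S.ground.target p' = some p) ∨
  ∃ o : S.boxes, (∃ q, S.door o q = some p) ∧ ∃ q', S.door o q' = some p'

/-- `T ⊴_Q S`. -/
def IsConnectedSub (Q : Set β) (T S : Net α β) : Prop :=
  IsSub Q T S ∧ ∀ p ∈ T.ports, ∀ p' ∈ T.ports, ∃ (n : ℕ) (s : ℕ → β),
    s 0 = p ∧ s n = p' ∧ (∀ j ≤ n, s j ∈ T.ports) ∧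
    ∀ j < n, S.Coh (s j) (s (j + 1)) ∧ (s j ∈ Q → j = 0)

/-- The set of the components of `S` of cosize `< k` above `Q` and `Q₀`, connected via other ports
than `Q`. -/
def components (S : Net α β) (Q Q₀ : Set β) (k : ℕ) : Set (Net α β) :=
  {T | IsConnectedSub Q T S ∧ T.cosize < k ∧ T.conclusions ⊆ Q ∪ Q₀ ∧ (T.ports \ Q).Nonempty ∧
    ∀ p ∈ T.ports, ∀ q ∈ S.ports, S.Coh p q → q ∉ T.ports → p ∈ Q}

def Boxable (S : Net α β) : Prop :=
  S.conclusions ⊆ S.ground.expPorts ∧ S.conclusions ∩ S.boxes = ∅ ∧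
    S.ground.portsOf .bang \ S.boxes ⊆ S.conclusions

/-- The boxed version of a boxable net `S`: remove the conclusions, except those that are doors of
boxes of `S`, which are relabelled by `∘`. -/
noncomputable def boxed (S : Net α β) : Net α β :=
  let doors : Set β := {q | q ∈ S.conclusions ∧ ∃ (o : S.boxes) (p : α), S.door o p = some q}
  let wires : Set β := {w | w ∈ S.ground.wires ∧ ∃ q ∈ S.ground.wires, S.ground.target w = some q}
  open Classical in
  .mk
    { wires := wires
      ports := S.ground.wires ∪ doors
      label := fun p =>
        if p ∈ S.ground.wires then S.ground.label p else if p ∈ doors then some .circ else none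
      target := fun w => if w ∈ wires then S.ground.target w else none
      left := S.ground.left ∩ wires
      ty := fun p => if p ∈ S.ground.wires ∪ doors then S.ground.ty p else none }
    S.boxes S.content S.door

/-- The nets of `U` share only `∘`-conclusions. -/
def Gluable (U : Set (Net α β)) : Prop :=
  ∀ S ∈ U, ∀ S' ∈ U, S ≠ S' → S.ports ∩ S'.ports ⊆ S.circs ∩ S'.circs

/-- The union of the partial functions `f S`, for `S` in `U`. -/
noncomputable def unionMap {ι γ : Type*} (U : Set ι) (f : ι → Option γ) : Option γ :=
  open Classical in
  if h : ∃ c, ∃ S ∈ U, f S = some c then some h.choose else none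

/-- The net `∑ U` obtained by glueing the elements of a gluable set `U`. -/
noncomputable def glue (U : Set (Net α β)) : Net α β :=
  let owner : (o : {o | ∃ S ∈ U, o ∈ S.boxes}) → Net α β := fun o => o.2.choose
  have owns : ∀ o, o.1 ∈ (owner o).boxes := fun o => o.2.choose_spec.2
  .mk
    { wires := {w | ∃ S ∈ U, w ∈ S.ground.wires}
      ports := {p | ∃ S ∈ U, p ∈ S.ports}
      label := fun p => unionMap U fun S => S.ground.label p
      target := fun w => unionMap U fun S => S.ground.target w
      left := {w | ∃ S ∈ U, w ∈ S.ground.left}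
      ty := fun p => unionMap U fun S => S.ground.ty p }
    {o | ∃ S ∈ U, o ∈ S.boxes}
    (fun o => (owner o).content ⟨o.1, owns o⟩)
    (fun o => (owner o).door ⟨o.1, owns o⟩)

/-- `o` is the `!`-port of the partial expansion `S` that is not a box of `S` and that has
exponent `j`: its arity is `c * k ^ j` for some `0 < c < k`. -/
def IsBang (S : Net α β) (k j : ℕ) (o : β) : Prop :=
  o ∈ S.ground.portsOf .bang ∧ o ∉ S.boxes ∧ ∃ c, 0 < c ∧ c < k ∧ S.arity o = c * k ^ j

end Net

end MELL

open MELL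

/-! ### Digits in base `k` of sums over classes of `k ^ j` elements. -/

namespace MELL

/-! Cut the expansion into levels: the root `R` and, for every expanded box and every
pseudo-experiment chosen for it, one copy of the content of that box. A level other than the root
has an exponent j > 0, its box having been copied k^j times. By k-injectivity the exponent
determines the parent level and the box, so the levels of exponent j are exactly k^j siblings, and
the root is alone with exponent 0. Everything rests on one counting principle, `digit_sum_classes`:
if a number is a sum over the levels of contributions smaller than k and equal on siblings, its
digit at j > 0 is the contribution of any single level of exponent j. One class may be exceptional,
that of a distinguished level ℓ, as long as ℓ alone contributes in its class and the root
contributes only if it is ℓ.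

The principle is used three times. The first use counts, level by level, the boxes whose content has
depth at least i. It shows that M_i(e) consists of the exponents of the levels whose content has
depth at least i (`Good.mem_expM_iff`). So j₀ is the exponent of a level L₁ whose content B has
depth exactly i: L₁ is present in the expansion and all its boxes are kept.

The second use splits the arity of a port according to the levels of its premises and of the kept
boxes of which it is a door (`digit_arity`), the exceptional level being the one that owns the port.
The ports critical for j₀ turn out to be the doors of the box of L₁ (`critical_eq`), and the only
`!`-port of the required arity is that box itself (`arity_box`, `isBang_iff`).

Now cut along the set Q of these doors. A port outside Q that is a door of an expanded box would
give its component cosize at least k, since whole classes of siblings contribute to its arity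
(`not_attached`). Hence a component of cosize less than k lies in one level, apart from its
conclusions (`exists_isLevelComponent`); conversely a component lying in one level has cosize less
than k (`IsLevelComponent.cosize_lt`), and every port owned by L₁ belongs to such a component
(`exists_component`).

The third use counts the components in a class of ≡, level by level. A level contains fewer than k
of them: types grow along wires, so a component has a wire ending in one of its conclusions q
(`exists_premise`), and distinct components of one class in one level provide distinct premises of
the same q from that level. Renaming a level as a sibling (`shift`) transports components and fixes
their conclusions, provided that none of these lies in the level itself; taking for ℓ the level of a
conclusion of maximal rank takes care of this. So the wanted digit is the number of members of the
class in L₁ (`digit_ncard_class`), and 𝒰 corresponds, class by class, to the components of L₁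
(`exists_matching`).

Finally, boxing a component of L₁ drops its conclusions except the doors of kept boxes, which are
`∘`-conclusions of B; the result is a piece of B (`isPart_boxed`). Each piece is replaced by the
equivalent element of 𝒰. The isomorphisms fix the conclusions, so they agree on shared ports and
glue (`isIso_glue`), and the targets of the other conclusions of B are not changed. -/

theorem digit_eq {k : ℕ} (hk : 1 < k) (n j : ℕ) : digit k n j = n / k ^ j % k :=
  Nat.getD_digits n j hk

/-- Such a sum already is a base `k` expansion: the terms below `j` add up to less than `k ^ j`, and
those above `j` are multiples of `k ^ (j + 1)`. -/
theorem digit_sum {k : ℕ} (hk : 1 < k) (F : Finset ℕ) (f : ℕ → ℕ) (hf : ∀ j ∈ F, f j < k) (j : ℕ) :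
    digit k (∑ i ∈ F, f i * k ^ i) j = if j ∈ F then f j else 0 := by
  set g : ℕ → ℕ := fun i => if i ∈ F then f i else 0 with hg
  have hgk : ∀ i, g i < k := fun i => by
    by_cases h : i ∈ F
    · simpa [hg, h] using hf i h
    · simp [hg, h]; omega
  have main : ∀ N, digit k (∑ i ∈ Finset.range N, g i * k ^ i) j = if j < N then g j else 0 := by
    intro N
    have hlt : ∀ M, ∑ i ∈ Finset.range M, g i * k ^ i < k ^ M := by
      intro M
      induction M with
      | zero => simp
      | succ M ih =>
        rw [Finset.sum_range_succ, pow_succ]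
        have := hgk M
        nlinarith [Nat.pow_pos (n := M) (show 0 < k by omega)]
    rw [digit_eq hk]
    split_ifs with h
    · obtain ⟨d, rfl⟩ : ∃ d, N = (j + 1) + d := ⟨N - (j + 1), by omega⟩
      rw [Finset.sum_range_add, Finset.sum_range_succ]
      have e1 : ∑ x ∈ Finset.range d, g (j + 1 + x) * k ^ (j + 1 + x) =
          k ^ j * (k * ∑ x ∈ Finset.range d, g (j + 1 + x) * k ^ x) := by
        rw [Finset.mul_sum, Finset.mul_sum]
        refine Finset.sum_congr rfl fun x _ => ?_
        rw [pow_add, pow_succ]; ring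
      rw [e1, add_assoc, mul_comm (g j), ← mul_add,
        Nat.add_mul_div_left _ _ (Nat.pow_pos (by omega)), Nat.div_eq_of_lt (hlt j), zero_add,
        Nat.add_mul_mod_self_left, Nat.mod_eq_of_lt (hgk j)]
    · rw [Nat.div_eq_of_lt, Nat.zero_mod]
      exact (hlt N).trans_le (Nat.pow_le_pow_right (by omega) (by omega))
  obtain ⟨N, hN⟩ : ∃ N, ∀ i ∈ F, i < N := ⟨F.sup id + 1, fun i hi => Nat.lt_succ_of_le
    (Finset.le_sup (f := id) hi)⟩
  have : ∑ i ∈ F, f i * k ^ i = ∑ i ∈ Finset.range N, g i * k ^ i := by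
    have hs : F ⊆ Finset.range N := fun i hi => Finset.mem_range.2 (hN i hi)
    rw [← Finset.sum_subset hs (f := fun i => g i * k ^ i)]
    · refine Finset.sum_congr rfl fun i hi => ?_
      simp [hg, hi]
    · intro i _ hi
      simp [hg, hi]
  rw [this, main]
  by_cases h : j ∈ F
  · simp [h, hN j h, hg]
  · simp [h, hg]

/-- Digits of a sum over a finite set partitioned by `J` into classes of `k ^ J L` elements, where
the summand is constant on every class, except the one of `ℓ`, on which it is `0` outside `ℓ`. -/
theorem digit_sum_classes {k : ℕ} (hk : 1 < k) {Λ : Type*} (A : Finset Λ) (J : Λ → ℕ)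
    (hJ : ∀ L ∈ A, (A.filter fun L' => J L' = J L).card = k ^ J L)
    (n : Λ → ℕ) (hn : ∀ L ∈ A, n L < k) (ℓ : Λ)
    (hℓ : ∀ L ∈ A, J L = J ℓ → L ≠ ℓ → n L = 0)
    (h0 : J ℓ ≠ 0 → ∀ L ∈ A, J L = 0 → n L = 0)
    (hc : ∀ L ∈ A, ∀ L' ∈ A, J L = J L' → J L ≠ J ℓ → n L = n L') :
    (∀ L ∈ A, 0 < J L → J L ≠ J ℓ → digit k (∑ L ∈ A, n L) (J L) = n L) ∧
    ∀ j, 0 < j → (j = J ℓ ∨ ∀ L ∈ A, J L ≠ j) → digit k (∑ L ∈ A, n L) j = 0 := by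
  classical
  have hex : ∀ j, ∃ f, ∀ L ∈ A, J L = j → j ≠ J ℓ → n L = f := by
    intro j
    by_cases h : ∃ L ∈ A, J L = j ∧ j ≠ J ℓ
    · obtain ⟨L, hL, rfl, h2⟩ := h
      exact ⟨n L, fun L' hL' h _ => hc L' hL' L hL h (by rwa [h])⟩
    · exact ⟨0, fun L hL h1 h2 => (h ⟨L, hL, h1, h2⟩).elim⟩
  choose f hf using hex
  -- The class of `ℓ` and the class of exponent `0` are taken out of the expansion; their joint sum
  -- `a` becomes the digit of index `0`.
  set F := insert 0 (((A.image J).erase 0).erase (J ℓ)) with hF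
  set a := ∑ L ∈ A.filter (fun L => J L = J ℓ ∨ J L = 0), n L with ha
  have hcard : ∀ L ∈ A, J L = 0 → ∀ L' ∈ A, J L' = 0 → L = L' := by
    intro L hL h0 L' hL' h0'
    have := hJ L hL
    rw [h0, pow_zero, Finset.card_eq_one] at this
    obtain ⟨x, hx⟩ := this
    have h1 : L ∈ ({x} : Finset Λ) := hx ▸ by simp [hL, h0]
    have h2 : L' ∈ ({x} : Finset Λ) := hx ▸ by simp [hL', h0']
    simp_all
  -- At most one term of `a` is nonzero. If `J ℓ = 0`, both classes are one singleton; otherwise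
  -- exponent `0` contributes nothing and `ℓ` alone contributes in its class.
  have hak : a < k := by
    by_cases h : ∃ L ∈ A.filter (fun L => J L = J ℓ ∨ J L = 0), n L ≠ 0
    · obtain ⟨L, hL, hL0⟩ := h
      rw [ha, Finset.sum_eq_single_of_mem L hL]
      · exact hn L (Finset.mem_filter.1 hL).1
      · intro L' hL' hne
        simp only [Finset.mem_filter] at hL hL'
        by_contra hL0'
        by_cases hz : J ℓ = 0
        · rw [hz, or_self] at hL hL'
          exact hne (hcard _ hL'.1 hL'.2 _ hL.1 hL.2)
        · have h1 : L = ℓ := by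
            by_contra h
            rcases hL.2 with h2 | h2
            · exact hL0 (hℓ _ hL.1 h2 h)
            · exact hL0 (h0 hz _ hL.1 h2)
          have h1' : L' = ℓ := by
            by_contra h
            rcases hL'.2 with h2 | h2
            · exact hL0' (hℓ _ hL'.1 h2 h)
            · exact hL0' (h0 hz _ hL'.1 h2)
          exact hne (h1'.trans h1.symm)
    · push Not at h
      rw [ha, Finset.sum_eq_zero h]
      omega
  set g : ℕ → ℕ := fun j => if j = 0 then a else f j with hg
  have hsum : ∑ L ∈ A, n L = ∑ j ∈ F, g j * k ^ j := by
    rw [hF, Finset.sum_insert (by simp)]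
    rw [← Finset.sum_filter_add_sum_filter_not A (fun L => J L = J ℓ ∨ J L = 0)]
    congr 1
    · simp [hg, ha]
    · rw [← Finset.sum_fiberwise_of_maps_to (t := ((A.image J).erase 0).erase (J ℓ)) (g := J)]
      · refine Finset.sum_congr rfl fun j hj => ?_
        simp only [Finset.mem_erase, Finset.mem_image] at hj
        obtain ⟨h1, h2, L, hL, rfl⟩ := hj
        have : ((A.filter fun L => ¬ (J L = J ℓ ∨ J L = 0)).filter fun L' => J L' = J L)
            = A.filter fun L' => J L' = J L := by
          ext L'
          simp only [Finset.mem_filter]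
          constructor
          · rintro ⟨⟨a, _⟩, b⟩; exact ⟨a, b⟩
          · rintro ⟨a, b⟩; exact ⟨⟨a, by rw [b]; tauto⟩, b⟩
        rw [this, Finset.sum_congr rfl (g := fun _ => f
          (J L)), Finset.sum_const, hJ L hL, smul_eq_mul]
        · simp [hg, h2, mul_comm]
        · intro L' hL'
          simp only [Finset.mem_filter] at hL'
          exact hf _ _ hL'.1 hL'.2 h1
      · intro L hL
        simp only [Finset.mem_filter, not_or] at hL
        simp only [Finset.mem_erase, Finset.mem_image]
        exact ⟨hL.2.1, hL.2.2, L, hL.1, rfl⟩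
  have hgk : ∀ j ∈ F, g j < k := by
    intro j hj
    by_cases h : j = 0
    · simpa [hg, h] using hak
    · simp only [hF, Finset.mem_insert, h, Finset.mem_erase, Finset.mem_image, false_or] at hj
      obtain ⟨h1, _, L, hL, rfl⟩ := hj
      simp only [hg, h, if_false]
      rw [← hf _ L hL rfl h1]
      exact hn L hL
  rw [hsum]
  constructor
  · intro L hL h1 h2
    rw [digit_sum hk F g hgk, if_pos, hg]
    · simp only [show J L ≠ 0 by omega, if_false]
      exact (hf _ L hL rfl h2).symm
    · simp only [hF, Finset.mem_insert, Finset.mem_erase, Finset.mem_image]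
      exact Or.inr ⟨h2, by omega, L, hL, rfl⟩
  · intro j hj h
    rw [digit_sum hk F g hgk, if_neg]
    simp only [hF, Finset.mem_insert, Finset.mem_erase, Finset.mem_image]
    rintro (h1 | ⟨h1, _, L, hL, h2⟩)
    · omega
    · rcases h with h | h
      · exact h1 h
      · exact h L hL h2

/-! ### Unfolding of nets; finiteness, depth and cosize. -/

namespace Net

variable {α β β' β'' : Type u}

theorem arity_eq (S : Net α β) (q : β) : S.arity q = (S.ground.premises q).ncard
    + ∑ᶠ o : S.boxes, {p | p ∈ (S.content o).notCircs ∧ S.door o p = some q}.ncard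
    + ∑ᶠ o : S.boxes, ∑ᶠ p ∈ {p | p ∈ (S.content o).circs ∧ S.door o p = some q},
      (S.content o).arity p := by
  cases S; rfl

theorem cosize_eq (S : Net α β) :
    S.cosize = max (⨆ p : S.ports, S.arity p) (⨆ o : S.boxes, (S.content o).cosize) := by
  cases S; rfl

theorem depth_eq (S : Net α β) : S.depth = ⨆ o : S.boxes, ((S.content o).depth + 1) := by
  cases S; rfl

theorem isIso_iff (S : Net α β) (S' : Net α β') (φ : β → β') : S.IsIso S' φ ↔
    S.ground.IsIso S'.ground φ ∧ S'.boxes = φ '' S.boxes ∧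
    ∀ (o : S.boxes) (o' : S'.boxes), (↑o' : β') = φ ↑o →
      ∃ ψ : α → α, (S.content o).IsIso (S'.content o') ψ ∧
        ∀ q ∈ (S.content o).conclusions, S'.door o' (ψ q) = (S.door o q).map φ := by
  cases S; cases S'; rfl

namespace IsCircPS

variable {R : Net α α}

theorem pre (h : R.IsCircPS) : R.IsPreDifferential := by cases h; assumption
theorem no_premise (h : R.IsCircPS) : ∀ w q, R.ground.target w = some q →
    q ∉ R.ground.portsOf .bang ∧ q ∉ R.ground.portsOf .circ := by cases h; assumption
theorem boxes_eq (h : R.IsCircPS) : R.boxes = R.ground.portsOf .bang := by cases h; assumption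
theorem circ_covered (h : R.IsCircPS) : ∀ q ∈ R.circs, ∃ (o : R.boxes) (p : α),
    R.door o p = some q := by cases h; assumption
theorem door_circ_id (h : R.IsCircPS) : ∀ (o : R.boxes), ∀ p ∈ (R.content o).circs,
    R.door o p = some p := by cases h; assumption
theorem contents (h : R.IsCircPS) : ∀ o : R.boxes, (R.content o).IsCircPS := by
  cases h; assumption

end IsCircPS

theorem IsPreDifferential.boxes_sub_ports {S : Net α β} (h : S.IsPreDifferential) :
    S.boxes ⊆ S.ports := fun o ho => (h.boxes_sub o ho).1.1

theorem IsPreDifferential.finite_boxes {S : Net α β} (h : S.IsPreDifferential) : Finite S.boxes :=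
  (h.ground.finite_ports.subset h.boxes_sub_ports).to_subtype

theorem IsPreDifferential.finite_ports {S : Net α β} (h : S.IsPreDifferential) : Finite S.ports :=
  h.ground.finite_ports.to_subtype

theorem IsPreDifferential.circs_sub {S : Net α β} (h : S.IsPreDifferential) :
    S.circs ⊆ S.conclusions := fun p hp => ⟨hp.1, fun hw => (h.ground.wires_sub p hw).2 hp.2⟩

theorem IsPreDifferential.door_ports {S : Net α β} (h : S.IsPreDifferential) {o : S.boxes} {p : α}
    {q : β} (hq : S.door o p = some q) : q ∈ S.ports := by
  rcases h.door_mem o p q hq with rfl | h' | h'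
  · exact h.boxes_sub_ports o.2
  · exact h'.1
  · exact h'.1

theorem depth_content_lt {S : Net α β} (h : S.IsPreDifferential) (o : S.boxes) :
    (S.content o).depth < S.depth := by
  have := h.finite_boxes
  rw [depth_eq S]
  exact Nat.lt_of_succ_le (le_ciSup (f := fun o : S.boxes => (S.content o).depth + 1)
    (Set.finite_range _).bddAbove o)

theorem lt_depth_iff {S : Net α β} (h : S.IsPreDifferential) (i : ℕ) :
    i < S.depth ↔ ∃ o : S.boxes, i ≤ (S.content o).depth := by
  constructor
  · intro hi
    by_contra hc
    push Not at hc
    have : S.depth ≤ i := by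
      rw [depth_eq]
      rcases isEmpty_or_nonempty S.boxes with he | he
      · simp
      · exact ciSup_le fun o => hc o
    omega
  · rintro ⟨o, ho⟩
    exact ho.trans_lt (depth_content_lt h o)

theorem cosize_lt_iff {S : Net α β} (h : S.IsPreDifferential) {k : ℕ} (hk : 0 < k) :
    S.cosize < k ↔ (∀ p ∈ S.ports, S.arity p < k) ∧ ∀ o : S.boxes, (S.content o).cosize < k := by
  have := h.finite_boxes
  have := h.finite_ports
  rw [cosize_eq, max_lt_iff]
  have key : ∀ {ι : Type u} [Finite ι] (f : ι → ℕ), (⨆ x, f x) < k ↔ ∀ x, f x < k := by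
    intro ι _ f
    constructor
    · intro h x
      exact (le_ciSup (Set.finite_range f).bddAbove x).trans_lt h
    · intro h
      rcases isEmpty_or_nonempty ι with he | he
      · simpa using hk
      · obtain ⟨x, hx⟩ := exists_eq_ciSup_of_finite (f := f)
        rw [← hx]; exact h x
  rw [key, key]
  simp [ports]

theorem boxes_box_finite {R : Net α α} (h : R.IsCircPS) : Finite R.Box := by
  induction h with
  | intro R pre _ _ _ _ _ ih =>
    have := pre.finite_boxes
    cases R with
    | mk G bx ct dr =>
      have : ∀ o : bx, Finite (Box (ct o)) := ih
      have : Finite bx := ‹Finite (mk G bx ct dr).boxes›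
      exact inferInstanceAs (Finite ((o : bx) × Option (Box (ct o))))

end Net
end MELL

/-! ### Levels of an expansion. -/

namespace MELL
namespace Net

variable {α β : Type u}

/-- Data describing the copies of box contents (the levels) out of which the partial expansions of
`R` are made: `cont L` is the net of which `L` is a copy, `emb L` names its ports in the expansion,
and, if `L` is not the root, then `L` is one of the `k ^ exp L` copies of the content of the box
`box L` of `cont (par L)`. -/
structure LevelData (R : Net α α) where
  Lv : Type u
  root : Lv
  cont : Lv → Net α α
  emb : Lv → α → R.Name
  exp : Lv → ℕ
  rank : Lv → ℕ
  par : Lv → Lv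
  box : Lv → Option α

namespace LevelData

variable {R : Net α α}

/-- `p` is a port of the level `L` which is not identified with a port of a lower level. -/
def Own (D : LevelData R) (L : D.Lv) (p : α) : Prop :=
  p ∈ (D.cont L).ports ∧ (p ∈ (D.cont L).circs → L = D.root)

/-- The levels that are present in the expansion of the boxes of depth `≥ i`. -/
def Active (D : LevelData R) (i : ℕ) (L : D.Lv) : Prop := L = D.root ∨ i ≤ (D.cont L).depth

/-- The levels form a tree, ranked by the distance to the root. The content of k-injectivity is in
`exp_inj`, by which only siblings share an exponent, and in `exp_card`, which includes the root as
the class of size `k ^ 0`. The `emb` fields say that a name determines its owner level and its port,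
and that a `∘`-conclusion of a level carries the name of the same port of the parent. -/
structure Good (D : LevelData R) (k : ℕ) (e : R.PseudoExp) : Prop where
  finite : Finite D.Lv
  cont_root : D.cont D.root = R
  circ : ∀ L, (D.cont L).IsCircPS
  cosize_lt : ∀ L, (D.cont L).cosize < k
  boxes_lt : ∀ L, (D.cont L).boxes.ncard < k
  cont_eq : ∀ L, L ≠ D.root →
    ∃ o : (D.cont (D.par L)).boxes, D.box L = some ↑o ∧ (D.cont (D.par L)).content o = D.cont L
  rank_root : D.rank D.root = 0
  rank_par : ∀ L, L ≠ D.root → D.rank L = D.rank (D.par L) + 1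
  child : ∀ L, ∀ o ∈ (D.cont L).boxes, ∃ L', L' ≠ D.root ∧ D.par L' = L ∧ D.box L' = some o
  exp_root : D.exp D.root = 0
  exp_pos : ∀ L, L ≠ D.root → 0 < D.exp L
  exp_inj : ∀ L L', L ≠ D.root → D.exp L = D.exp L' →
    L' ≠ D.root ∧ D.par L = D.par L' ∧ D.box L = D.box L'
  exp_eq : ∀ L L', L ≠ D.root → L' ≠ D.root → D.par L = D.par L' → D.box L = D.box L' →
    D.exp L = D.exp L'
  exp_card : ∀ L, {L' | D.exp L' = D.exp L}.ncard = k ^ D.exp L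
  mem_expM : ∀ j, j ∈ expM k R e 0 ↔ ∃ L, L ≠ D.root ∧ D.exp L = j
  emb_inj : ∀ L L' p p', D.Own L p → D.Own L' p' → D.emb L p = D.emb L' p' → L = L' ∧ p = p'
  emb_circ : ∀ L p, L ≠ D.root → p ∈ (D.cont L).circs → D.emb L p = D.emb (D.par L) p
  base_root : ∀ p, Name.toBase R (D.emb D.root p) = some p
  base_none : ∀ L p, L ≠ D.root → D.Own L p → Name.toBase R (D.emb L p) = none

/-- `S` is the expansion of the boxes of depth `≥ i` along the levels `D`. -/
structure Describes (D : LevelData R) (i : ℕ) (S : Net α R.Name) : Prop where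
  ports : ∀ x, x ∈ S.ports ↔ ∃ L p, D.Active i L ∧ D.Own L p ∧ D.emb L p = x
  label : ∀ L p, D.Active i L → D.Own L p →
    S.ground.label (D.emb L p) = (D.cont L).ground.label p
  ty : ∀ L p, D.Active i L → D.Own L p →
    S.ground.ty (D.emb L p) = (D.cont L).ground.ty p
  left : ∀ L p, D.Active i L → D.Own L p →
    (D.emb L p ∈ S.ground.left ↔ p ∈ (D.cont L).ground.left)
  wires : ∀ L p, D.Active i L → D.Own L p →
    (D.emb L p ∈ S.ground.wires ↔ L ≠ D.root ∨ p ∈ (D.cont L).ground.wires)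
  label_none : ∀ x, x ∉ S.ports → S.ground.label x = none
  ty_none : ∀ x, x ∉ S.ports → S.ground.ty x = none
  wires_sub : S.ground.wires ⊆ S.ports
  left_sub : S.ground.left ⊆ S.ports
  target_none : ∀ x, x ∉ S.ground.wires → S.ground.target x = none
  target_wire : ∀ L p, D.Active i L → p ∈ (D.cont L).ground.wires →
    S.ground.target (D.emb L p) = ((D.cont L).ground.target p).map (D.emb L)
  target_door : ∀ L p, D.Active i L → L ≠ D.root → p ∈ (D.cont L).notCircs →
    ∀ M, D.par L = M → ∀ o : (D.cont M).boxes, D.box L = some ↑o →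
    S.ground.target (D.emb L p) = ((D.cont M).door o p).map (D.emb M)
  boxes : ∀ x, x ∈ S.boxes ↔ ∃ L, ∃ o : (D.cont L).boxes, D.Active i L ∧
    ((D.cont L).content o).depth < i ∧ D.emb L o = x
  content : ∀ L, D.Active i L → ∀ (o : (D.cont L).boxes) (o' : S.boxes),
    (o' : R.Name) = D.emb L o → S.content o' = (D.cont L).content o
  door : ∀ L, D.Active i L → ∀ (o : (D.cont L).boxes) (o' : S.boxes),
    (o' : R.Name) = D.emb L o → ∀ q,
      S.door o' q = ((D.cont L).door o q).map (D.emb L)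

theorem Good.own_wire {D : LevelData R} {k : ℕ} {e : R.PseudoExp} (h : D.Good k e) {L : D.Lv} {p
    : α}
    (hp : p ∈ (D.cont L).ground.wires) : D.Own L p :=
  ⟨((h.circ L).pre.ground.wires_sub p hp).1,
    fun hc => (((h.circ L).pre.ground.wires_sub p hp).2 hc.2).elim⟩

theorem Good.own_notCirc {D : LevelData R} {k : ℕ} {e : R.PseudoExp} (_ : D.Good k e) {L : D.Lv}
    {p : α} (hp : p ∈ (D.cont L).notCircs) : D.Own L p :=
  ⟨hp.1.1, fun hc => (hp.2 hc).elim⟩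

theorem Good.own_box {D : LevelData R} {k : ℕ} {e : R.PseudoExp} (h : D.Good k e) {L : D.Lv}
    (o : (D.cont L).boxes) : D.Own L o := by
  have := ((h.circ L).pre.boxes_sub o o.2).1
  exact ⟨this.1, fun hc => by simpa using this.2.symm.trans hc.2⟩

theorem Good.depth_lt {D : LevelData R} {k : ℕ} {e : R.PseudoExp} (h : D.Good k e) {L : D.Lv}
    (hL : L ≠ D.root) : (D.cont L).depth < (D.cont (D.par L)).depth := by
  obtain ⟨o, -, h2⟩ := h.cont_eq L hL
  rw [← h2]
  exact depth_content_lt (h.circ _).pre _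

theorem Good.depth_le {D : LevelData R} {k : ℕ} {e : R.PseudoExp} (h : D.Good k e) (L : D.Lv) :
    (D.cont L).depth ≤ R.depth := by
  suffices H : ∀ n L, D.rank L = n → (D.cont L).depth ≤ R.depth from H _ L rfl
  intro n
  induction n with
  | zero =>
    intro L hL
    by_cases hr : L = D.root
    · rw [hr, h.cont_root]
    · have := h.rank_par L hr; omega
  | succ n ih =>
    intro L hL
    by_cases hr : L = D.root
    · rw [hr, h.cont_root]
    · have := h.rank_par L hr
      exact (h.depth_lt hr).le.trans (ih _ (by omega))

end LevelData

/-! ### Construction of the levels by induction on the depth. -/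

section Step

variable {G : Ground α} {bx : Set α} {ct : bx → Net α α} {dr : bx → α → Option α}

/-- The port of the expansion named by `Name.lift`. -/
noncomputable def Name.liftTotal (dr : bx → α → Option α) (o : bx) (e : PseudoExp (ct o))
    (x : Name (ct o)) : Name (mk G bx ct dr) :=
  (Name.lift ct dr o e x).getD (.inr ⟨o, e, x⟩)

theorem Name.lift_eq_some (hR : (mk G bx ct dr).IsCircPS) (o : bx) (e : PseudoExp (ct o))
    (x : Name (ct o)) :
    Name.lift ct dr o e x = some (Name.liftTotal (G := G) dr o e x) := by
  unfold Name.liftTotal Name.lift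
  split
  · rename_i p hp
    split_ifs with hc
    · have := hR.door_circ_id o p hc
      change dr o p = some p at this
      rw [this]; rfl
    · rfl
  · rfl

theorem Name.liftTotal_circ (hR : (mk G bx ct dr).IsCircPS) {o : bx} {e : PseudoExp (ct o)}
    {x : Name (ct o)} {p : α} (hx : Name.toBase (ct o) x = some p) (hp : p ∈ (ct o).circs) :
    Name.liftTotal (G := G) dr o e x = .inl p := by
  have h1 := Name.lift_eq_some hR o e x
  have h2 : Name.lift ct dr o e x = (dr o p).map .inl := by
    unfold Name.lift; rw [hx]; simp [hp]
  have : dr o p = some p := hR.door_circ_id o p hp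
  rw [h1, this] at h2
  exact Option.some_injective _ h2

theorem Name.liftTotal_not {o : bx} {e : PseudoExp (ct o)}
    {x : Name (ct o)} (hx : ¬ ∃ p ∈ (ct o).circs, Name.toBase (ct o) x = some p) :
    Name.liftTotal (G := G) dr o e x = .inr ⟨o, e, x⟩ := by
  unfold Name.liftTotal Name.lift
  split
  · rename_i p hp
    rw [if_neg fun hc => hx ⟨p, hc, hp⟩]; rfl
  · rfl

variable (G ct dr) in
open Classical in
/-- The levels of `(G, bx, ct, dr)` from those of the contents of its boxes. -/
noncomputable def LevelData.step (k : ℕ) (cp : (o : bx) → Finset (PseudoExp (ct o)))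
    (D : ∀ (o : bx), {x // x ∈ cp o} → LevelData (ct o)) : LevelData (Net.mk G bx ct dr) where
  Lv := Option ((o : bx) × (e : {x // x ∈ cp o}) × (D o e).Lv)
  root := none
  cont L := match L with
    | none => Net.mk G bx ct dr
    | some ⟨o, e, L⟩ => (D o e).cont L
  emb L p := match L with
    | none => .inl p
    | some ⟨o, e, L⟩ => Name.liftTotal dr o e ((D o e).emb L p)
  exp L := match L with
    | none => 0
    | some ⟨o, e, L⟩ => if L = (D o e).root then Nat.log k (cp o).card else (D o e).exp L
  rank L := match L with
    | none => 0
    | some ⟨o, e, L⟩ => (D o e).rank L + 1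
  par L := match L with
    | none => none
    | some ⟨o, e, L⟩ => if L = (D o e).root then none else some ⟨o, e, (D o e).par L⟩
  box L := match L with
    | none => none
    | some ⟨o, e, L⟩ => if L = (D o e).root then some ↑o else (D o e).box L

/-- `Name.liftTotal` identifies a name with a port of the outer net only if it is a `∘`-conclusion
of the content. The names owned by deeper levels have no base port, and at the root of the copy `hc`
excludes the `∘`-conclusions. -/
theorem LevelData.emb_step {cp : (o : bx) → Finset (PseudoExp (ct o))}
    {D : ∀ (o : bx), {x // x ∈ cp o} → LevelData (ct o)} {k : ℕ}
    {o : bx} {e : {x // x ∈ cp o}} (hD : (D o e).Good k e.1) {L : (D o e).Lv} {p : α}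
    (hp : p ∈ ((D o e).cont L).ports) (hc : p ∉ ((D o e).cont L).circs) :
    (step G ct dr k cp D).emb (some ⟨o, e, L⟩) p = .inr ⟨o, e.1, (D o e).emb L p⟩ := by
  refine Name.liftTotal_not ?_
  rintro ⟨q, hq, hx⟩
  by_cases hL : L = (D o e).root
  · subst hL
    rw [hD.base_root] at hx
    rw [hD.cont_root] at hc
    simp only [Option.some.injEq] at hx
    exact hc (hx ▸ hq)
  · rw [hD.base_none L p hL ⟨hp, fun h => (hc h).elim⟩] at hx
    simp at hx

/-- This is where k-injectivity is turned into the tree structure: disjointness for distinct boxes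
separates the boxes, disjointness for distinct pseudo-experiments separates the copies of one box,
and the first clause makes the number of copies of a box a power of `k`. -/
theorem LevelData.Good.step {k : ℕ} (hk : 1 < k) (hR : (Net.mk G bx ct dr).IsCircPS)
    (hkb : Nat.card (Net.mk G bx ct dr).Box < k) (hkc : (Net.mk G bx ct dr).cosize < k)
    (n : ℕ) (cp : (o : bx) → Finset (PseudoExp (ct o)))
    (he : KInjective k (Net.mk G bx ct dr) (n, cp))
    {D : ∀ (o : bx), {x // x ∈ cp o} → LevelData (ct o)} (hD : ∀ o e', (D o e').Good k e'.1) :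
    (LevelData.step G ct dr k cp D).Good k (n, cp) := by
  have hfin : Finite bx := hR.pre.finite_boxes
  have hfinD : ∀ o e', Finite (D o e').Lv := fun o e' => (hD o e').finite
  obtain ⟨he1, he2, he3, he4⟩ := he
  have hcard : ∀ o : bx, ∃ j > 0, (cp o).card = k ^ j := fun o => he1 ⟨o, none⟩ _ rfl
  have hlog : ∀ o : bx, 0 < Nat.log k (cp o).card ∧ k ^ Nat.log k (cp o).card = (cp o).card := by
    intro o
    obtain ⟨j, hj, h⟩ := hcard o
    rw [h, Nat.log_pow hk]
    exact ⟨hj, rfl⟩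
  -- The number of copies is a positive power, so no box disappears; this provides the children of
  -- the root.
  have hne : ∀ o : bx, ∃ e', e' ∈ cp o := fun o => by
    obtain ⟨j, hj, h⟩ := hcard o
    exact Finset.card_pos.1 (h ▸ Nat.pow_pos (by omega))
  have hexp_pos : ∀ L, L ≠ none → 0 < (LevelData.step G ct dr k cp D).exp L := by
    rintro (_ | ⟨o, e', L⟩) hL
    · exact (hL rfl).elim
    · simp only [LevelData.step]
      split_ifs with h
      · exact (hlog o).1
      · exact (hD o e').exp_pos L h
  have hinj : ∀ L L', L ≠ none → (LevelData.step G ct dr k cp D).exp L =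
      (LevelData.step G ct dr k cp D).exp L' →
      L' ≠ none ∧ (LevelData.step G ct dr k cp D).par L = (LevelData.step G ct dr k cp D).par L' ∧
      (LevelData.step G ct dr k cp D).box L = (LevelData.step G ct dr k cp D).box L' := by
    rintro L L' hL hLL
    have hL' : L' ≠ none := by
      rintro rfl
      have := hexp_pos L hL
      rw [hLL] at this
      exact absurd this (lt_irrefl 0)
    refine ⟨hL', ?_⟩
    obtain _ | ⟨o, e', L⟩ := L
    · exact (hL rfl).elim
    obtain _ | ⟨o₁, e₁, L₁⟩ := L'
    · exact (hL' rfl).elim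
    simp only [LevelData.step] at hLL ⊢
    have hb : ∀ (o : bx) (e' : {x // x ∈ cp o}) (L : (D o e').Lv), L ≠ (D o e').root →
        ∃ b : Box (ct o), k ^ (D o e').exp L ∈ copies (ct o) e'.1 b := fun o e' L h =>
      ((hD o e').mem_expM _).2 ⟨L, h, rfl⟩
    -- If both levels are roots of copies, their boxes share a number of copies and coincide. A root
    -- of a copy and a deeper level would identify a box at depth `0` with a deeper one. If both are
    -- deeper, they are compared inside a single copy.
    split_ifs at hLL ⊢ with h h' h'
    · have := he3 ⟨o, none⟩ ⟨o₁, none⟩ ⟨(cp o).card, rfl, by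
        have h1 := (hlog o).2
        rw [hLL, (hlog o₁).2] at h1
        exact h1.symm⟩
      obtain rfl : o = o₁ := congrArg Sigma.fst this
      exact ⟨rfl, rfl⟩
    · obtain ⟨b, hb⟩ := hb _ _ _ h'
      have := he3 ⟨o, none⟩ ⟨o₁, some b⟩ ⟨(cp o).card, rfl, by
        rw [← (hlog o).2, hLL]
        exact ⟨e₁.1, e₁.2, hb⟩⟩
      cases this
    · obtain ⟨b, hb⟩ := hb _ _ _ h
      have := he3 ⟨o, some b⟩ ⟨o₁, none⟩ ⟨(cp o₁).card, by
        rw [← (hlog o₁).2, ← hLL]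
        exact ⟨e'.1, e'.2, hb⟩, rfl⟩
      cases this
    · obtain ⟨b, hb1⟩ := hb _ _ _ h
      obtain ⟨b', hb2⟩ := hb _ _ _ h'
      have := he3 ⟨o, some b⟩ ⟨o₁, some b'⟩ ⟨k ^ (D o e').exp L, ⟨e'.1, e'.2, hb1⟩,
        ⟨e₁.1, e₁.2, by rw [hLL]; exact hb2⟩⟩
      cases this
      -- The boxes now agree, and a common number of copies forces the same pseudo-experiment of
      -- `o`; the rest is the hypothesis on that copy.
      have := he2 o b e' e'.2 e₁ e₁.2 ⟨_, hb1, by rw [hLL]; exact hb2⟩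
      obtain rfl : e' = e₁ := Subtype.ext this
      obtain ⟨h1, h2, h3⟩ := (hD o e').exp_inj L L₁ h hLL
      exact ⟨by rw [h2], h3⟩
  have hexp_eq : ∀ L L', L ≠ none → L' ≠ none →
      (LevelData.step G ct dr k cp D).par L = (LevelData.step G ct dr k cp D).par L' →
      (LevelData.step G ct dr k cp D).box L = (LevelData.step G ct dr k cp D).box L' →
      (LevelData.step G ct dr k cp D).exp L = (LevelData.step G ct dr k cp D).exp L' := by
    intro L L' hL hL' hp hb
    obtain _ | ⟨o, e', L⟩ := L
    · exact (hL rfl).elim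
    obtain _ | ⟨o₁, e₁, L₁⟩ := L'
    · exact (hL' rfl).elim
    simp only [LevelData.step] at hp hb ⊢
    split_ifs at hp hb ⊢ with h h' h'
    · have : o = o₁ := Subtype.ext (Option.some_injective _ hb)
      rw [this]
    · have hp := Option.some_injective _ hp
      obtain rfl : o = o₁ := congrArg Sigma.fst hp
      simp only [Sigma.mk.injEq, heq_eq_eq, true_and] at hp
      obtain ⟨h1, h2⟩ := hp
      obtain rfl : e' = e₁ := h1
      exact (hD _ _).exp_eq _ _ h h' (eq_of_heq h2) hb
  refine
    { finite := inferInstanceAs (Finite (Option ((o : bx) × (e : {x // x ∈ cp o}) × (D o e).Lv)))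
      cont_root := rfl
      circ := ?_
      cosize_lt := ?_
      boxes_lt := ?_
      cont_eq := ?_
      rank_root := rfl
      rank_par := ?_
      child := ?_
      exp_root := rfl
      exp_pos := hexp_pos
      exp_inj := hinj
      exp_eq := hexp_eq
      exp_card := ?_
      mem_expM := ?_
      emb_inj := ?_
      emb_circ := ?_
      base_root := fun _ => rfl
      base_none := ?_ }
  · rintro (_ | ⟨o, e', L⟩)
    · exact hR
    · exact (hD o e').circ L
  · rintro (_ | ⟨o, e', L⟩)
    · exact hkc
    · exact (hD o e').cosize_lt L
  · rintro (_ | ⟨o, e', L⟩)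
    · refine lt_of_le_of_lt ?_ hkb
      have := boxes_box_finite hR
      rw [← Nat.card_coe_set_eq]
      refine Nat.card_le_card_of_injective
        (fun o : bx => ((⟨o, none⟩ : (o : bx) × Option (Box (ct o))) : (Net.mk G bx ct dr).Box)) ?_
      intro o o' h
      exact congrArg Sigma.fst h
    · exact (hD o e').boxes_lt L
  · rintro (_ | ⟨o, e', L⟩) hL
    · exact (hL rfl).elim
    · by_cases h : L = (D o e').root
      · have h1 : (LevelData.step G ct dr k cp D).par (some ⟨o, e', L⟩) = none := if_pos h
        have h2 : (LevelData.step G ct dr k cp D).box (some ⟨o, e', L⟩) = some ↑o := if_pos h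
        rw [h1, h2, h]
        exact ⟨o, rfl, (hD o e').cont_root.symm⟩
      · have h1 : (LevelData.step G ct dr k cp D).par (some ⟨o, e', L⟩) =
          some ⟨o, e', (D o e').par L⟩ := if_neg h
        have h2 : (LevelData.step G ct dr k cp D).box (some ⟨o, e', L⟩) = (D o e').box L := if_neg h
        rw [h1, h2]
        exact (hD o e').cont_eq L h
  · rintro (_ | ⟨o, e', L⟩) hL
    · exact (hL rfl).elim
    · simp only [LevelData.step]
      split_ifs with h
      · subst h
        simp [(hD o e').rank_root]
      · simp [(hD o e').rank_par L h]
  · rintro (_ | ⟨o, e', L⟩) o' ho'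
    · obtain ⟨e', he'⟩ := hne ⟨o', ho'⟩
      refine ⟨some ⟨⟨o', ho'⟩, ⟨e', he'⟩, (D _ _).root⟩, by simp [LevelData.step], ?_⟩
      simp [LevelData.step]
    · obtain ⟨L', h1, h2, h3⟩ := (hD o e').child L o' ho'
      refine ⟨some ⟨o, e', L'⟩, by simp [LevelData.step], ?_⟩
      simp [LevelData.step, h1, h2, h3]
  · intro L
    by_cases hL : L = none
    · subst hL
      have : {L' | (LevelData.step G ct dr k cp D).exp L' =
          (LevelData.step G ct dr k cp D).exp none} = {none} := by
        ext L'
        simp only [Set.mem_ofPred_eq]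
        refine ⟨fun h => ?_, fun h => by rw [h]⟩
        by_contra hn
        have := hexp_pos L' hn
        rw [h] at this
        exact absurd this (lt_irrefl 0)
      exact (congrArg Set.ncard this).trans (Set.ncard_singleton _)
    · have hset : {L' | (LevelData.step G ct dr k cp D).exp L' =
          (LevelData.step G ct dr k cp D).exp L} = {L' | L' ≠ none ∧
            (LevelData.step G ct dr k cp D).par L = (LevelData.step G ct dr k cp D).par L' ∧
            (LevelData.step G ct dr k cp D).box L = (LevelData.step G ct dr k cp D).box L'} := by
        ext L'
        exact ⟨fun h => hinj L L' hL h.symm, fun h => (hexp_eq L L' hL h.1 h.2.1 h.2.2).symm⟩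
      obtain _ | ⟨o, e', L⟩ := L
      · exact (hL rfl).elim
      by_cases hr : L = (D o e').root
      · have h1 : (LevelData.step G ct dr k cp D).exp (some ⟨o, e', L⟩) = Nat.log k
          (cp o).card := by
          simp [LevelData.step, hr]
        rw [hset, h1, (hlog o).2]
        -- The siblings of the root of a copy are the roots of all the copies of the same box, as
        -- many as there are elements in `cp o`.
        have : {L' | L' ≠ none ∧
            (LevelData.step G ct dr k cp D).par (some ⟨o, e', L⟩) =
              (LevelData.step G ct dr k cp D).par L' ∧
            (LevelData.step G ct dr k cp D).box (some ⟨o, e', L⟩) =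
              (LevelData.step G ct dr k cp D).box L'} =
            Set.range (fun e₁ : {x // x ∈ cp o} => (some ⟨o, e₁, (D o e₁).root⟩ :
              Option ((o : bx) × (e : {x // x ∈ cp o}) × (D o e).Lv))) := by
          ext L'
          simp only [LevelData.step, hr, if_true, Set.mem_ofPred_eq, Set.mem_range]
          constructor
          · rintro ⟨h1, h2, h3⟩
            obtain _ | ⟨o₁, e₁, L₁⟩ := L'
            · exact (h1 rfl).elim
            simp only at h2 h3
            split_ifs at h2 h3 with h
            · obtain rfl : o = o₁ := Subtype.ext (Option.some_injective _ h3)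
              exact ⟨e₁, by rw [h]⟩
          · rintro ⟨e₁, rfl⟩
            simp
        refine (congrArg Set.ncard (this.trans Set.image_univ.symm)).trans
          ((Set.ncard_image_of_injective _ ?_).trans ?_)
        · intro e₁ e₂ h
          simp only [Option.some.injEq, Sigma.mk.injEq, heq_eq_eq, true_and] at h
          exact h.1
        · rw [Set.ncard_univ]; simp
      · have h1 : (LevelData.step G ct dr k cp D).exp (some ⟨o, e', L⟩) = (D o e').exp L := by
          simp [LevelData.step, hr]
        rw [h1, ← (hD o e').exp_card L]
        -- The siblings of a deeper level all lie in the same copy, so the cardinality computed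
        -- there is unchanged.
        have : {L' | (LevelData.step G ct dr k cp D).exp L' = (D o e').exp L} =
            (fun L' : (D o e').Lv => (some ⟨o, e', L'⟩ :
              Option ((o : bx) × (e : {x // x ∈ cp o}) × (D o e).Lv))) ''
              {L' | (D o e').exp L' = (D o e').exp L} := by
          ext L'
          simp only [Set.mem_ofPred_eq]
          constructor
          · intro h
            obtain ⟨h3, h4, h5⟩ := hinj (some ⟨o, e', L⟩) L' (by simp) (by rw [h1, h])
            obtain _ | ⟨o₁, e₁, L₁⟩ := L'
            · exact (h3 rfl).elim
            simp only [LevelData.step, hr, if_false] at h4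
            by_cases hr1 : L₁ = (D o₁ e₁).root
            · simp [hr1] at h4
            · simp only [hr1, if_false, Option.some.injEq] at h4
              obtain rfl : o = o₁ := congrArg Sigma.fst h4
              simp only [Sigma.mk.injEq, heq_eq_eq, true_and] at h4
              obtain rfl : e' = e₁ := h4.1
              refine ⟨L₁, ?_, rfl⟩
              simpa [LevelData.step, hr1] using h
          · rintro ⟨L₁, h, rfl⟩
            have hr1 : L₁ ≠ (D o e').root := by
              rintro rfl
              have := (hD o e').exp_pos L hr
              rw [← h, (hD o e').exp_root] at this
              exact absurd this (lt_irrefl 0)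
            simpa [LevelData.step, hr1] using h
        refine (congrArg Set.ncard this).trans (Set.ncard_image_of_injective _ ?_)
        intro L₁ L₂ h
        have h := Option.some_injective ((o : bx) × (e : {x // x ∈ cp o}) × (D o e).Lv) h
        simp only [Sigma.mk.injEq, heq_eq_eq, true_and] at h
        exact h
  · intro j
    constructor
    · rintro ⟨⟨o, _ | b⟩, hb⟩
      · have hb : k ^ j = (cp o).card := hb
        obtain ⟨e', he'⟩ := hne o
        refine ⟨some ⟨o, ⟨e', he'⟩, (D _ _).root⟩, by simp [LevelData.step], ?_⟩
        simp [LevelData.step, ← hb, Nat.log_pow hk]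
      · obtain ⟨e', he', hb⟩ := hb
        obtain ⟨L, h1, h2⟩ := ((hD o ⟨e', he'⟩).mem_expM j).1 ⟨b, hb⟩
        refine ⟨some ⟨o, ⟨e', he'⟩, L⟩, by simp [LevelData.step], ?_⟩
        simp [LevelData.step, h1, h2]
    · rintro ⟨L, hL, h⟩
      obtain _ | ⟨o, e', L⟩ := L
      · exact (hL rfl).elim
      simp only [LevelData.step] at h
      split_ifs at h with hr
      · exact ⟨⟨o, none⟩, by rw [← h, (hlog o).2]; rfl⟩
      · obtain ⟨b, hb⟩ := ((hD o e').mem_expM j).2 ⟨L, hr, h⟩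
        exact ⟨⟨o, some b⟩, e'.1, e'.2, hb⟩
  · rintro (_ | ⟨o, e', L⟩) (_ | ⟨o', e'', L'⟩) p p' ⟨hp1, hp2⟩ ⟨hp1', hp2'⟩ h
    · exact ⟨rfl, Sum.inl_injective h⟩
    · erw [LevelData.emb_step (hD _ _) hp1' (fun h => by cases hp2' h)] at h
      cases h
    · erw [LevelData.emb_step (hD _ _) hp1 (fun h => by cases hp2 h)] at h
      cases h
    · have hc := fun h => Option.some_ne_none _ (hp2 h)
      have hc' := fun h => Option.some_ne_none _ (hp2' h)
      erw [LevelData.emb_step (hD _ _) hp1 hc, LevelData.emb_step (hD _ _) hp1' hc'] at h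
      have h := Sum.inr_injective h
      obtain rfl : o = o' := congrArg Sigma.fst h
      simp only [Sigma.mk.injEq, heq_eq_eq, true_and] at h
      obtain ⟨h1, h2⟩ := Prod.mk.inj h
      obtain rfl : e' = e'' := Subtype.ext h1
      obtain ⟨rfl, rfl⟩ := (hD o e').emb_inj L L' p p' ⟨hp1, fun h => (hc h).elim⟩
        ⟨hp1', fun h => (hc' h).elim⟩ h2
      exact ⟨rfl, rfl⟩
  · rintro (_ | ⟨o, e', L⟩) p hL hp
    · exact (hL rfl).elim
    · simp only [LevelData.step] at hp ⊢
      split_ifs with hr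
      · subst hr
        refine Name.liftTotal_circ hR ((hD o e').base_root p) ?_
        rwa [(hD o e').cont_root] at hp
      · rw [(hD o e').emb_circ L p hr hp]
  · rintro (_ | ⟨o, e', L⟩) p hL ⟨hp1, hp2⟩
    · exact (hL rfl).elim
    · erw [LevelData.emb_step (hD _ _) hp1 (fun h => by cases hp2 h)]
      rfl

end Step
end Net
end MELL

/-! ### Partial expansions are described by levels. -/

namespace MELL
namespace Net

variable {α β : Type u}

section Step

variable {G : Ground α} {bx : Set α} {ct : bx → Net α α} {dr : bx → α → Option α}

/-- Depth decreases from a level to its children, so an active level inside a copy forces the copied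
box to be expanded. The `∘`-conclusions removed from the copy are exactly the ports that its root
ceases to own. -/
theorem LevelData.isCopyPort_iff {k i : ℕ} {cp : (o : bx) → Finset (PseudoExp (ct o))}
    {D : ∀ (o : bx), {x // x ∈ cp o} → LevelData (ct o)} (hD : ∀ o e', (D o e').Good k e'.1)
    (hT : ∀ o e', (D o e').Describes i (taylor i _ e'.1)) (o : bx) (e : PseudoExp (ct o)) (x : Name
      (ct o)) :
    IsCopyPort i ct cp (fun o e => taylor i (ct o) e) o e x ↔
      ∃ (he : e ∈ cp o) (L : (D o ⟨e, he⟩).Lv) (p : α),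
        (LevelData.step G ct dr k cp D).Active i (some ⟨o, ⟨e, he⟩, L⟩) ∧
        (LevelData.step G ct dr k cp D).Own (some ⟨o, ⟨e, he⟩, L⟩) p ∧
        (D o ⟨e, he⟩).emb L p = x := by
  constructor
  · rintro ⟨⟨hi, he⟩, hx, hc⟩
    obtain ⟨L, p, hL, ⟨hp1, hp2⟩, rfl⟩ := ((hT o ⟨e, he⟩).ports x).1 hx
    refine ⟨he, L, p, Or.inr ?_, ⟨hp1, fun h => (hc ⟨p, ?_, ?_⟩).elim⟩, rfl⟩
    · rcases hL with rfl | hL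
      · change i ≤ ((D o ⟨e, he⟩).cont _).depth
        rwa [(hD o ⟨e, he⟩).cont_root]
      · exact hL
    · have := hp2 h
      subst this
      rwa [← (hD o ⟨e, he⟩).cont_root]
    · have := hp2 h
      subst this
      exact (hD o ⟨e, he⟩).base_root p
  · rintro ⟨he, L, p, hL, ⟨hp1, hp2⟩, rfl⟩
    have hc : p ∉ ((D o ⟨e, he⟩).cont L).circs := fun h => Option.some_ne_none _ (hp2 h)
    have hL : i ≤ ((D o ⟨e, he⟩).cont L).depth := hL.resolve_left (Option.some_ne_none _)
    refine ⟨⟨hL.trans ((hD o ⟨e, he⟩).depth_le L), he⟩, ((hT o ⟨e, he⟩).ports _).2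
      ⟨L, p, Or.inr hL, ⟨hp1, fun h => (hc h).elim⟩, rfl⟩, ?_⟩
    rintro ⟨q, hq, hx⟩
    by_cases hr : L = (D o ⟨e, he⟩).root
    · subst hr
      rw [(hD o ⟨e, he⟩).base_root] at hx
      rw [(hD o ⟨e, he⟩).cont_root] at hc
      exact hc (Option.some_injective _ hx ▸ hq)
    · rw [(hD o ⟨e, he⟩).base_none L p hr ⟨hp1, fun h => (hc h).elim⟩] at hx
      simp at hx

theorem LevelData.Describes.step {k i : ℕ} (hR : (Net.mk G bx ct dr).IsCircPS)
    (n : ℕ) (cp : (o : bx) → Finset (PseudoExp (ct o)))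
    {D : ∀ (o : bx), {x // x ∈ cp o} → LevelData (ct o)} (hD : ∀ o e', (D o e').Good k e'.1)
    (hG : (LevelData.step G ct dr k cp D).Good k (n, cp))
    (hT : ∀ o e', (D o e').Describes i (taylor i _ e'.1)) :
    (LevelData.step G ct dr k cp D).Describes i (taylor i (Net.mk G bx ct dr) (n, cp)) := by
  have hcopy := LevelData.isCopyPort_iff (G := G) (dr := dr) hD hT
  have hown : ∀ {o : bx} {e' : {x // x ∈ cp o}} {L : (D o e').Lv} {p : α},
      (LevelData.step G ct dr k cp D).Own (some ⟨o, e', L⟩) p → (D o e').Own L p :=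
    fun h => ⟨h.1, fun hc => (Option.some_ne_none _ (h.2 hc)).elim⟩
  have hact : ∀ {o : bx} {e' : {x // x ∈ cp o}} {L : (D o e').Lv},
      (LevelData.step G ct dr k cp D).Active i (some ⟨o, e', L⟩) → (D o e').Active i L :=
    fun h => Or.inr (h.resolve_left (Option.some_ne_none _))
  have hemb : ∀ {o : bx} {e' : {x // x ∈ cp o}} {L : (D o e').Lv} {p : α},
      (LevelData.step G ct dr k cp D).Own (some ⟨o, e', L⟩) p →
      (LevelData.step G ct dr k cp D).emb (some ⟨o, e', L⟩) p = .inr ⟨o, e'.1, (D o e').emb L p⟩ :=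
    fun h => LevelData.emb_step (hD _ _) h.1 fun hc => Option.some_ne_none _ (h.2 hc)
  have hcp : ∀ {o : bx} {e' : {x // x ∈ cp o}} {L : (D o e').Lv} {p : α},
      (LevelData.step G ct dr k cp D).Active i (some ⟨o, e', L⟩) →
      (LevelData.step G ct dr k cp D).Own (some ⟨o, e', L⟩) p →
      IsCopyPort i ct cp (fun o e => taylor i (ct o) e) o e'.1 ((D o e').emb L p) :=
    fun {o e' L p} h1 h2 => (hcopy o e'.1 _).2 ⟨e'.2, L, p, h1, h2, rfl⟩
  have hcirc : ∀ {o : bx} {e' : {x // x ∈ cp o}} {L : (D o e').Lv} {p : α} {q},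
      (LevelData.step G ct dr k cp D).Own (some ⟨o, e', L⟩) p →
      Name.toBase (ct o) ((D o e').emb L p) = some q →
      L = (D o e').root ∧ p = q := by
    intro o e' L p q h hq
    by_cases hr : L = (D o e').root
    · subst hr
      rw [(hD o e').base_root] at hq
      exact ⟨rfl, Option.some_injective _ hq⟩
    · rw [(hD o e').base_none L p hr (hown h)] at hq
      simp at hq
  refine ⟨?_, ?_, ?_, ?_, ?_, ?_, ?_, ?_, ?_, ?_, ?_, ?_, ?_, ?_, ?_⟩
  · rintro (p | ⟨o, e', x⟩)
    · constructor
      · intro h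
        exact ⟨none, p, Or.inl rfl, ⟨h, fun _ => rfl⟩, rfl⟩
      · rintro ⟨_ | ⟨o, e', L⟩, q, h1, h2, h3⟩
        · obtain rfl : q = p := Sum.inl_injective h3
          exact h2.1
        · rw [hemb h2] at h3; cases h3
    · refine (hcopy o e' x).trans ⟨?_, ?_⟩
      · rintro ⟨he, L, p, h1, h2, rfl⟩
        exact ⟨some ⟨o, ⟨e', he⟩, L⟩, p, h1, h2, hemb h2⟩
      · rintro ⟨_ | ⟨o₁, e₁, L⟩, q, h1, h2, h3⟩
        · cases h3
        · rw [hemb h2] at h3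
          cases h3
          exact ⟨e₁.2, L, q, h1, h2, rfl⟩
  · rintro (_ | ⟨o, e', L⟩) p h1 h2
    · rfl
    · rw [hemb h2]
      exact (if_pos (hcp h1 h2)).trans ((hT o e').label L p (hact h1) (hown h2))
  · rintro (_ | ⟨o, e', L⟩) p h1 h2
    · rfl
    · rw [hemb h2]
      exact (if_pos (hcp h1 h2)).trans ((hT o e').ty L p (hact h1) (hown h2))
  · rintro (_ | ⟨o, e', L⟩) p h1 h2
    · exact Iff.rfl
    · rw [hemb h2]
      exact ⟨fun h => ((hT o e').left L p (hact h1) (hown h2)).1 h.2,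
        fun h => ⟨(hcp h1 h2).1, ((hT o e').left L p (hact h1) (hown h2)).2 h⟩⟩
  · rintro (_ | ⟨o, e', L⟩) p h1 h2
    · exact ⟨fun h => Or.inr h, fun h => h.resolve_left fun h => h rfl⟩
    · rw [hemb h2]
      exact ⟨fun _ => Or.inl (Option.some_ne_none _), fun _ => hcp h1 h2⟩
  · rintro (p | ⟨o, e', x⟩) h
    · by_contra hc
      exact h ((hR.pre.ground.label_dom p).2 hc)
    · exact if_neg h
  · rintro (p | ⟨o, e', x⟩) h
    · by_contra hc
      exact h ((hR.pre.ground.ty_dom p).2 hc)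
    · exact if_neg h
  · rintro (p | ⟨o, e', x⟩) h
    · exact (hR.pre.ground.wires_sub p h).1
    · exact h
  · rintro (p | ⟨o, e', x⟩) h
    · exact (hR.pre.ground.wires_sub p (hR.pre.ground.left_sub p h).1).1
    · obtain ⟨⟨hi, he⟩, h⟩ := h
      obtain ⟨L, p, h1, h2, rfl⟩ := ((hT o ⟨e', he⟩).ports x).1 ((hT o ⟨e', he⟩).left_sub h)
      have h3 := ((hD o ⟨e', he⟩).circ L).pre.ground.left_sub p
        (((hT o ⟨e', he⟩).left L p h1 h2).1 h)
      refine hcp (e' := ⟨e', he⟩) (L := L) ?_ (hG.own_wire h3.1)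
      refine Or.inr ?_
      rcases h1 with rfl | h1
      · change i ≤ ((D o ⟨e', he⟩).cont _).depth
        rwa [(hD o ⟨e', he⟩).cont_root]
      · exact h1
  · rintro (p | ⟨o, e', x⟩) h
    · have : G.target p = none := by
        by_contra hc
        exact h ((hR.pre.ground.target_dom p).2 hc)
      exact congrArg (Option.map Sum.inl) this
    · exact if_neg h
  · rintro (_ | ⟨o, e', L⟩) p h1 h2
    · rfl
    · have h2' := hG.own_wire h2
      rw [hemb h2']
      refine (if_pos (hcp h1 h2')).trans ?_
      have h3 := (hT o e').target_wire L p (hact h1) h2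
      obtain ⟨q, hq⟩ := Option.ne_none_iff_exists'.1
        ((((hD o e').circ L).pre.ground.target_dom p).1 h2)
      change _ = (((D o e').cont L).ground.target p).map _
      simp only [h3, hq, Option.map_some]
      exact Name.lift_eq_some hR o e'.1 _
  · rintro (_ | ⟨o, e', L⟩) p h1 hr h2 M hM o' ho'
    · exact (hr rfl).elim
    · have h2' := hG.own_notCirc h2
      rw [hemb h2']
      refine (if_pos (hcp h1 h2')).trans ?_
      by_cases h : L = (D o e').root
      · subst h
        -- A conclusion of the content has no target in the expansion of the content, so its target
        -- in the larger expansion comes from the door map of `o`.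
        have h3 : (taylor i (ct o) e'.1).ground.target ((D o e').emb (D o e').root p) = none := by
          refine (hT o e').target_none _ fun hw => ?_
          rcases ((hT o e').wires _ p (hact h1) (hown h2')).1 hw with h | h
          · exact h rfl
          · exact h2.1.2 h
        obtain rfl : none = M := (if_pos rfl).symm.trans hM
        obtain rfl : o = o' := Subtype.ext (Option.some_injective _ ((if_pos rfl).symm.trans ho'))
        simp only [h3, (hD o e').base_root]
        rfl
      · obtain rfl : some ⟨o, e', (D o e').par L⟩ = M := (if_neg h).symm.trans hM
        have ho' : (D o e').box L = some ↑o' := (if_neg h).symm.trans ho'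
        have h3 := (hT o e').target_door L p (hact h1) h h2 _ rfl o' ho'
        obtain ⟨q, hq⟩ := Option.ne_none_iff_exists'.1
          ((((hD o e').circ _).pre.door_dom o' p).1 (by
            obtain ⟨o₁, h4, h5⟩ := (hD o e').cont_eq L h
            obtain rfl : o' = o₁ := Subtype.ext (Option.some_injective _ (ho'.symm.trans h4))
            rw [h5]
            exact h2.1))
        change _ = (((D o e').cont ((D o e').par L)).door o' p).map _
        simp only [h3, hq, Option.map_some]
        exact Name.lift_eq_some hR o e'.1 _
  · rintro (p | ⟨o, e', x⟩)
    · constructor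
      · rintro ⟨h, h1⟩
        exact ⟨none, ⟨p, h⟩, Or.inl rfl, h1, rfl⟩
      · rintro ⟨_ | ⟨o, e', L⟩, o', h1, h2, h3⟩
        · obtain rfl : (o' : α) = p := Sum.inl_injective h3
          exact ⟨o'.2, h2⟩
        · rw [hemb (hG.own_box o')] at h3; cases h3
    · constructor
      · rintro ⟨⟨h1, h2⟩, h3⟩
        obtain ⟨L, o', h4, h5, rfl⟩ := ((hT o ⟨e', h2⟩).boxes x).1 h3
        refine ⟨some ⟨o, ⟨e', h2⟩, L⟩, o', Or.inr ?_, h5, hemb (hG.own_box (L := some ⟨o,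
          ⟨e', h2⟩, L⟩) o')⟩
        rcases h4 with rfl | h4
        · change i ≤ ((D o ⟨e', h2⟩).cont _).depth
          rwa [(hD o ⟨e', h2⟩).cont_root]
        · exact h4
      · rintro ⟨_ | ⟨o₁, e₁, L⟩, o', h1, h2, h3⟩
        · cases h3
        · rw [hemb (hG.own_box o')] at h3
          cases h3
          exact ⟨(hcp h1 (hG.own_box o')).1, ((hT _ e₁).boxes _).2 ⟨L, o', hact h1, h2, rfl⟩⟩
  · rintro (_ | ⟨o, e', L⟩) h1 o' ⟨x, hx⟩ h
    · obtain rfl : x = .inl ↑o' := h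
      rfl
    · rw [hemb (hG.own_box o')] at h
      obtain rfl : x = _ := h
      exact (hT o e').content L (hact h1) o' ⟨_, hx.2⟩ rfl
  · rintro (_ | ⟨o, e', L⟩) h1 o' ⟨x, hx⟩ h q
    · obtain rfl : x = .inl ↑o' := h
      rfl
    · rw [hemb (hG.own_box o')] at h
      obtain rfl : x = _ := h
      have h3 := (hT o e').door L (hact h1) o' ⟨_, hx.2⟩ rfl q
      change ((taylor i (ct o) e'.1).door ⟨(D o e').emb L ↑o', hx.2⟩ q).bind
        (Name.lift ct dr o e'.1) = (((D o e').cont L).door o' q).map _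
      rw [h3]
      cases h4 : ((D o e').cont L).door o' q with
      | none => rfl
      | some r => exact Name.lift_eq_some hR o e'.1 _

end Step

/-- Every `k`-injective pseudo-experiment has levels that describe its partial expansions. -/
theorem IsCircPS.exists_levelData {k : ℕ} (hk : 1 < k) {R : Net α α} (hR : R.IsCircPS) :
    ∀ e : R.PseudoExp, Nat.card R.Box < k → R.cosize < k → KInjective k R e →
      ∃ D : LevelData R, D.Good k e ∧ ∀ i, D.Describes i (taylor i R e) := by
  induction hR with
  | intro R h1 h2 h3 h4 h5 h6 ih =>
    intro e hkb hkc he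
    have hR : R.IsCircPS := .intro R h1 h2 h3 h4 h5 h6
    cases R with
    | mk G bx ct dr =>
      have hb : ∀ o : bx, Nat.card (Box (ct o)) < k := fun o => by
        refine lt_of_le_of_lt ?_ hkb
        have := boxes_box_finite hR
        refine Nat.card_le_card_of_injective (fun b : Box (ct o) =>
          ((⟨o, some b⟩ : (o : bx) × Option (Box (ct o))) : (Net.mk G bx ct dr).Box)) ?_
        intro b b' h
        cases h
        rfl
      have hc := ((cosize_lt_iff h1 (by omega)).1 hkc).2
      obtain ⟨n, cp⟩ := e
      have he' : ∀ (o : bx) (e' : {x // x ∈ cp o}), KInjective k (ct o) e'.1 :=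
        fun o e' => he.2.2.2 o e'.1 e'.2
      choose D hD hT using fun (o : bx) (e' : {x // x ∈ cp o}) =>
        ih o e'.1 (hb o) (hc o) (he' o e')
      have hG := LevelData.Good.step hk hR hkb hkc n cp he hD
      exact ⟨_, hG, fun i => LevelData.Describes.step hR n cp hD hG fun o e' => hT o e' i⟩

end Net
end MELL

/-! ### Owners of ports, ancestors and attached ports. -/

namespace MELL
namespace Net

variable {α β : Type u}

namespace LevelData

variable {R : Net α α} {k i : ℕ} {e : R.PseudoExp} {D : LevelData R} {S : Net α R.Name}

theorem Own.not_circ {L : D.Lv} {p : α} (h : D.Own L p) (hL : L ≠ D.root) :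
    p ∉ (D.cont L).circs := fun hc => hL (h.2 hc)

/-- `M` is reached from `L` by going to parents. -/
def Anc (D : LevelData R) (M L : D.Lv) : Prop := ∃ n, M = D.par^[n] L ∧ D.rank M + n = D.rank L

theorem Anc.refl (L : D.Lv) : D.Anc L L := ⟨0, rfl, rfl⟩

theorem Anc.rank_le {M L : D.Lv} (h : D.Anc M L) : D.rank M ≤ D.rank L := by
  obtain ⟨n, -, h⟩ := h; omega

theorem Anc.eq_of_rank {M M' L : D.Lv} (h : D.Anc M L) (h' : D.Anc M' L)
    (hr : D.rank M = D.rank M') : M = M' := by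
  obtain ⟨n, rfl, h1⟩ := h
  obtain ⟨n', rfl, h2⟩ := h'
  obtain rfl : n = n' := by omega
  rfl

theorem Anc.of_par (hG : D.Good k e) {M L : D.Lv} (hL : L ≠ D.root) (h : D.Anc M (D.par L)) :
    D.Anc M L := by
  obtain ⟨n, rfl, h⟩ := h
  refine ⟨n + 1, rfl, ?_⟩
  rw [hG.rank_par L hL]
  omega

theorem Good.active_par (hG : D.Good k e) {L : D.Lv} (hL : L ≠ D.root) (h : D.Active i L) :
    D.Active i (D.par L) :=
  Or.inr ((h.resolve_left hL).trans (hG.depth_lt hL).le)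

theorem Active.depth {L : D.Lv} (h : D.Active i L) (hL : L ≠ D.root) : i ≤ (D.cont L).depth :=
  h.resolve_left hL

/-- In a `∘`-PS the door map is the identity on `∘`-conclusions. So the parent has the same port,
with the same type, and its label can only be `?` or `∘`. -/
theorem Good.door_circ (hG : D.Good k e) {L : D.Lv} (hL : L ≠ D.root) {p : α}
    (hp : p ∈ (D.cont L).circs) {o : (D.cont (D.par L)).boxes} (ho : D.box L = some ↑o) :
    (D.cont (D.par L)).content o = D.cont L ∧ (D.cont (D.par L)).door o p = some p ∧
    p ∈ (D.cont (D.par L)).ports ∧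
    (D.cont (D.par L)).ground.ty p = (D.cont L).ground.ty p ∧
    ((D.cont (D.par L)).ground.label p = some .whynot ∨
      (D.cont (D.par L)).ground.label p = some .circ) := by
  obtain ⟨o', h1, h2⟩ := hG.cont_eq L hL
  obtain rfl : o = o' := Subtype.ext (Option.some_injective _ (ho.symm.trans h1))
  have hpre := (hG.circ (D.par L)).pre
  rw [← h2] at hp
  have h3 := (hG.circ _).door_circ_id o p hp
  refine ⟨h2, h3, hpre.door_ports h3, ?_, ?_⟩
  · rw [hpre.ty_circ o p hp p h3, h2]
  · rcases hpre.door_mem o p p h3 with h | h | h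
    · exact (hpre.door_circ o p hp p h3 (h ▸ (hpre.boxes_sub o o.2).1)).elim
    · exact Or.inl h.2
    · exact Or.inr h.2

/-- Every port of a level is an own port, with the same name, of the level or of an ancestor. -/
theorem Good.exists_own (hG : D.Good k e) {L : D.Lv} (hL : D.Active i L) {p : α}
    (hp : p ∈ (D.cont L).ports) : ∃ M, D.Active i M ∧ D.Own M p ∧ D.emb M p = D.emb L p ∧
      D.Anc M L ∧ (M = L ∨ L ≠ D.root ∧ p ∈ (D.cont L).circs ∧ D.Anc M (D.par L)) ∧
      (D.cont M).ground.ty p = (D.cont L).ground.ty p ∧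
      ((D.cont M).ground.label p = (D.cont L).ground.label p ∨
        (p ∈ (D.cont L).circs ∧ ((D.cont M).ground.label p = some .whynot ∨
          (D.cont M).ground.label p = some .circ))) := by
  suffices H : ∀ n L, D.rank L = n → D.Active i L → p ∈ (D.cont L).ports →
      ∃ M, D.Active i M ∧ D.Own M p ∧ D.emb M p = D.emb L p ∧
      D.Anc M L ∧ (M = L ∨ L ≠ D.root ∧ p ∈ (D.cont L).circs ∧ D.Anc M (D.par L)) ∧
      (D.cont M).ground.ty p = (D.cont L).ground.ty p ∧
      ((D.cont M).ground.label p = (D.cont L).ground.label p ∨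
        (p ∈ (D.cont L).circs ∧ ((D.cont M).ground.label p = some .whynot ∨
          (D.cont M).ground.label p = some .circ))) from H _ L rfl hL hp
  intro n
  induction n with
  | zero =>
    intro L hr hL hp
    have : L = D.root := by
      by_contra h
      have := hG.rank_par L h
      omega
    exact ⟨L, hL, ⟨hp, fun _ => this⟩, rfl, .refl L, Or.inl rfl, rfl, Or.inl rfl⟩
  | succ n ih =>
    intro L hr hL hp
    by_cases hc : p ∈ (D.cont L).circs ∧ L ≠ D.root
    · obtain ⟨hc, hne⟩ := hc
      obtain ⟨o, h1, -⟩ := hG.cont_eq L hne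
      obtain ⟨h2, h3, h4, h5, h6⟩ := hG.door_circ hne hc h1
      obtain ⟨M, a1, a2, a3, a4, a5, a6, a7⟩ := ih (D.par L) (by have := hG.rank_par L hne; omega)
        (hG.active_par hne hL) h4
      refine ⟨M, a1, a2, a3.trans (hG.emb_circ L p hne hc).symm, a4.of_par hG hne,
        Or.inr ⟨hne, hc, a4⟩, a6.trans h5, Or.inr ⟨hc, ?_⟩⟩
      rcases a7 with h | h
      · rwa [h]
      · exact h.2
    · exact ⟨L, hL, ⟨hp, fun h => by_contra fun h' => hc ⟨h, h'⟩⟩, rfl, .refl L, Or.inl rfl, rfl,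
        Or.inl rfl⟩

/-- Passing to the owner of a port never changes the underlying element of `α`, so two levels can
share a name only for the same element. -/
theorem Good.emb_eq (hG : D.Good k e) {L L' : D.Lv} (hL : D.Active i L) (hL' : D.Active i L')
    {p p' : α} (hp : p ∈ (D.cont L).ports) (hp' : p' ∈ (D.cont L').ports)
    (h : D.emb L p = D.emb L' p') : p = p' := by
  obtain ⟨M, _, h1, h2, _⟩ := hG.exists_own hL hp
  obtain ⟨M', _, h1', h2', _⟩ := hG.exists_own hL' hp'
  exact (hG.emb_inj _ _ _ _ h1 h1' (h2.trans (h.trans h2'.symm))).2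

/-- If an own port of `M` is a port of `L`, then either `L = M` or it is a `∘`-conclusion of `L`. -/
theorem Good.own_emb (hG : D.Good k e) {L M : D.Lv} (hL : D.Active i L)
    {p q : α} (hp : p ∈ (D.cont L).ports) (hq : D.Own M q)
    (h : D.emb L p = D.emb M q) :
    p = q ∧ (L = M ∨ L ≠ D.root ∧ p ∈ (D.cont L).circs ∧ D.Anc M (D.par L)) ∧ D.Anc M L := by
  obtain ⟨M', _, h1, h2, h3, h4, _⟩ := hG.exists_own hL hp
  obtain ⟨rfl, rfl⟩ := hG.emb_inj _ _ _ _ h1 hq (h2.trans h)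
  exact ⟨rfl, h4.imp_left Eq.symm, h3⟩

/-- The level of a port of the expansion. -/
noncomputable def lv (D : LevelData R) (x : R.Name) : D.Lv :=
  open Classical in
  if h : ∃ L p, D.Own L p ∧ D.emb L p = x then h.choose else D.root

theorem Good.lv_emb (hG : D.Good k e) {L : D.Lv} {p : α} (h : D.Own L p) :
    D.lv (D.emb L p) = L := by
  have h' : ∃ L' p', D.Own L' p' ∧ D.emb L' p' = D.emb L p := ⟨L, p, h, rfl⟩
  rw [lv, dif_pos h']
  obtain ⟨p', h1, h2⟩ := h'.choose_spec
  exact (hG.emb_inj _ _ _ _ h1 h h2).1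

/-- `p` is a door of a box of `L` that is expanded. -/
def Attached (D : LevelData R) (i : ℕ) (L : D.Lv) (p : α) : Prop :=
  ∃ o : (D.cont L).boxes, i ≤ ((D.cont L).content o).depth ∧ ∃ p', (D.cont L).door o p' = some p

/-- A door in the parent may be a `∘`-conclusion of the parent. It is then a door, one level lower,
of the box copied by the parent, which is expanded as well; this repeats until the owner is reached.
-/
theorem Good.attached_of_door (hG : D.Good k e) {L M : D.Lv} (hL : D.Active i L)
    (hr : L ≠ D.root) {o : (D.cont (D.par L)).boxes} (ho : D.box L = some ↑o) {p' p q : α}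
    (hd : (D.cont (D.par L)).door o p' = some p) (hq : D.Own M q)
    (h : D.emb (D.par L) p = D.emb M q) : p = q ∧ D.Attached i M q := by
  suffices H : ∀ n L, D.rank L = n → D.Active i L → L ≠ D.root →
    ∀ o : (D.cont (D.par L)).boxes, D.box L = some ↑o → ∀ p' p,
    (D.cont (D.par L)).door o p' = some p → D.emb (D.par L) p = D.emb M q →
    p = q ∧ D.Attached i M q from H _ L rfl hL hr o ho p' p hd h
  intro n
  induction n with
  | zero =>
    intro L hn hL hr
    have := hG.rank_par L hr
    omega
  | succ n ih =>
    intro L hn hL hr o ho p' p hd h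
    obtain ⟨rfl, h1, -⟩ := hG.own_emb (hG.active_par hr hL) ((hG.circ _).pre.door_ports hd) hq h
    refine ⟨rfl, ?_⟩
    rcases h1 with rfl | ⟨h1, h2, -⟩
    · obtain ⟨o', h3, h4⟩ := hG.cont_eq L hr
      obtain rfl : o = o' := Subtype.ext (Option.some_injective _ (ho.symm.trans h3))
      exact ⟨o, by rw [h4]; exact hL.depth hr, p', hd⟩
    · obtain ⟨o', h3, -⟩ := hG.cont_eq (D.par L) h1
      obtain ⟨h4, h5, h6, -⟩ := hG.door_circ h1 h2 h3
      refine (ih (D.par L) (by have := hG.rank_par L hr; omega) (hG.active_par hr hL) h1 o' h3 p p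
        h5 ?_).2
      rw [← hG.emb_circ _ p h1 h2, h]

theorem Good.attached_of_circ (hG : D.Good k e) {L M : D.Lv} (hL : D.Active i L)
    (hr : L ≠ D.root) {p q : α} (hp : p ∈ (D.cont L).circs) (hq : D.Own M q)
    (h : D.emb L p = D.emb M q) : p = q ∧ D.Attached i M q := by
  obtain ⟨o, ho, -⟩ := hG.cont_eq L hr
  obtain ⟨-, h2, -⟩ := hG.door_circ hr hp ho
  exact hG.attached_of_door hL hr ho h2 hq (by rw [← h, hG.emb_circ L p hr hp])

theorem Good.attached_label (hG : D.Good k e) {L : D.Lv} {p : α} (h : D.Attached i L p) :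
    (D.cont L).ground.label p = some .bang ∨ (D.cont L).ground.label p = some .whynot ∨
    (D.cont L).ground.label p = some .circ := by
  obtain ⟨o, -, p', hd⟩ := h
  rcases (hG.circ L).pre.door_mem o p' p hd with rfl | h | h
  · exact Or.inl ((hG.circ L).pre.boxes_sub o o.2).1.2
  · exact Or.inr (Or.inl h.2)
  · exact Or.inr (Or.inr h.2)

/-- A door labelled `!` can only belong to its own box, and that box is kept. -/
theorem Good.not_attached_kept (hG : D.Good k e) {L : D.Lv} {o : (D.cont L).boxes}
    (ho : ((D.cont L).content o).depth < i) : ¬ D.Attached i L ↑o := by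
  rintro ⟨o', h1, p', hd⟩
  have hb := ((hG.circ L).pre.boxes_sub o o.2).1.2
  rcases (hG.circ L).pre.door_mem o' p' o hd with h | h | h
  · obtain rfl : o = o' := Subtype.ext h
    omega
  · simpa using hb.symm.trans h.2
  · simpa using hb.symm.trans h.2

/-! ### The expansion is a differential `∘`-PS. -/

namespace Describes

theorem emb_port (hT : D.Describes i S) (hG : D.Good k e) {L : D.Lv} (hL : D.Active i L) {p : α}
    (hp : p ∈ (D.cont L).ports) : D.emb L p ∈ S.ports := by
  obtain ⟨M, h1, h2, h3, -⟩ := hG.exists_own hL hp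
  exact (hT.ports _).2 ⟨M, p, h1, h2, h3⟩

theorem emb_ty (hT : D.Describes i S) (hG : D.Good k e) {L : D.Lv} (hL : D.Active i L) {p : α}
    (hp : p ∈ (D.cont L).ports) : S.ground.ty (D.emb L p) = (D.cont L).ground.ty p := by
  obtain ⟨M, h1, h2, h3, -, -, h4, -⟩ := hG.exists_own hL hp
  rw [← h3, hT.ty M p h1 h2, h4]

theorem emb_label (hT : D.Describes i S) (hG : D.Good k e) {L : D.Lv} (hL : D.Active i L) {p : α}
    (hp : p ∈ (D.cont L).ports) : S.ground.label (D.emb L p) = (D.cont L).ground.label p ∨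
    (p ∈ (D.cont L).circs ∧ (S.ground.label (D.emb L p) = some .whynot ∨
          S.ground.label (D.emb L p) = some .circ)) := by
  obtain ⟨M, h1, h2, h3, -, -, -, h4⟩ := hG.exists_own hL hp
  rwa [← h3, hT.label M p h1 h2]

/-- Either the wire stays in its level, and then its target is owned by that level because `∘`-ports
of a `∘`-PS have no premises; or it is a conclusion of a copied content and goes to a door in the
parent, which need not own that door. -/
theorem target_cases (hT : D.Describes i S) (hG : D.Good k e) {w x : R.Name}
    (h : S.ground.target w = some x) : ∃ L q p, D.Active i L ∧ D.Own L q ∧ D.emb L q = w ∧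
      ((q ∈ (D.cont L).ground.wires ∧ (D.cont L).ground.target q = some p ∧ D.Own L p ∧
        x = D.emb L p) ∨
      (L ≠ D.root ∧ q ∈ (D.cont L).notCircs ∧ ∃ o : (D.cont (D.par L)).boxes, D.box L = some ↑o ∧
        (D.cont (D.par L)).content o = D.cont L ∧ (D.cont (D.par L)).door o q = some p ∧
        x = D.emb (D.par L) p)) := by
  have hw : w ∈ S.ground.wires := by
    by_contra hw
    rw [hT.target_none w hw] at h
    simp at h
  obtain ⟨L, q, hL, hq, rfl⟩ := (hT.ports w).1 (hT.wires_sub hw)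
  refine ⟨L, q, ?_⟩
  by_cases hqw : q ∈ (D.cont L).ground.wires
  · rw [hT.target_wire L q hL hqw, Option.map_eq_some_iff] at h
    obtain ⟨p, h1, h2⟩ := h
    exact ⟨p, hL, hq, rfl, Or.inl ⟨hqw, h1, ⟨((hG.circ L).pre.ground.target_mem q p h1).1,
      fun hc => (((hG.circ L).no_premise q p h1).2 hc).elim⟩, h2.symm⟩⟩
  · have hr := ((hT.wires L q hL hq).1 hw).resolve_right hqw
    have hn : q ∈ (D.cont L).notCircs := ⟨⟨hq.1, hqw⟩, hq.not_circ hr⟩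
    obtain ⟨o, ho, hc⟩ := hG.cont_eq L hr
    rw [hT.target_door L q hL hr hn _ rfl o ho, Option.map_eq_some_iff] at h
    obtain ⟨p, h1, h2⟩ := h
    exact ⟨p, hL, hq, rfl, Or.inr ⟨hr, hn, o, ho, hc, h1, h2.symm⟩⟩

theorem door_cases (hT : D.Describes i S) {b : S.boxes} {q : α} {x : R.Name}
    (h : S.door b q = some x) : ∃ L, ∃ o : (D.cont L).boxes, ∃ p, D.Active i L ∧
      ((D.cont L).content o).depth < i ∧ D.emb L o = b ∧ S.content b = (D.cont L).content o ∧
      (D.cont L).door o q = some p ∧ x = D.emb L p := by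
  obtain ⟨L, o, hL, ho, hb⟩ := (hT.boxes b).1 b.2
  rw [hT.door L hL o b hb.symm, Option.map_eq_some_iff] at h
  obtain ⟨p, h1, h2⟩ := h
  exact ⟨L, o, p, hL, ho, hb, hT.content L hL o b hb.symm, h1, h2.symm⟩

/-- Premises from other levels can only arrive through the door map of an expanded box, so an
unattached port sees just its own level. -/
theorem premises_unattached (hT : D.Describes i S) (hG : D.Good k e) {L : D.Lv}
    (hL : D.Active i L) {p : α} (hp : D.Own L p) (ha : ¬ D.Attached i L p) :
    S.ground.premises (D.emb L p) = D.emb L '' (D.cont L).ground.premises p := by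
  ext w
  constructor
  · rintro ⟨-, h⟩
    obtain ⟨M, q, p', hM, hq, rfl, ⟨h1, h2, h3, h4⟩ | ⟨h1, h2, o, h3, h4, h5, h6⟩⟩ :=
      hT.target_cases hG h
    · obtain ⟨rfl, rfl⟩ := hG.emb_inj _ _ _ _ hp h3 h4
      exact ⟨q, ⟨h1, h2⟩, rfl⟩
    · exact (ha (hG.attached_of_door hM h1 h3 h5 hp h6.symm).2).elim
  · rintro ⟨q, ⟨h1, h2⟩, rfl⟩
    refine ⟨(hT.wires L q hL (hG.own_wire h1)).2 (Or.inr h1), ?_⟩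
    rw [hT.target_wire L q hL h1, h2]; rfl

/-- Doors are exponential ports, so multiplicative ports are never attached: arity two, left
premises and types are checked inside one level. -/
theorem own_mult (hT : D.Describes i S) (hG : D.Good k e) {x : R.Name}
    (hx : x ∈ S.ground.multPorts) : ∃ L p, D.Active i L ∧ D.Own L p ∧ D.emb L p = x ∧
      ¬ D.Attached i L p ∧ p ∈ (D.cont L).ground.multPorts ∧
      S.ground.label x = (D.cont L).ground.label p := by
  have hx' : x ∈ S.ports := by rcases hx with h | h <;> exact h.1
  obtain ⟨L, p, hL, hp, rfl⟩ := (hT.ports x).1 hx'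
  have hl := hT.label L p hL hp
  have hm : p ∈ (D.cont L).ground.multPorts := by
    rcases hx with h | h
    · exact Or.inl ⟨hp.1, hl.symm.trans h.2⟩
    · exact Or.inr ⟨hp.1, hl.symm.trans h.2⟩
  refine ⟨L, p, hL, hp, rfl, fun ha => ?_, hm, hl⟩
  have := hG.attached_label ha
  rcases hm with h | h
  · simp [h.2] at this
  · simp [h.2] at this

theorem injOn_emb (hG : D.Good k e) {L : D.Lv} (hL : D.Active i L) :
    Set.InjOn (D.emb L) (D.cont L).ports := fun _ hp _ hq h => hG.emb_eq hL hL hp hq h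

theorem left_premises (hT : D.Describes i S) (hG : D.Good k e) {L : D.Lv}
    (hL : D.Active i L) {p : α} (hp : D.Own L p) (ha : ¬ D.Attached i L p) :
    S.ground.left ∩ S.ground.premises (D.emb L p) =
      D.emb L '' ((D.cont L).ground.left ∩ (D.cont L).ground.premises p) := by
  rw [hT.premises_unattached hG hL hp ha]
  ext w
  constructor
  · rintro ⟨h, q, hq, rfl⟩
    exact ⟨q, ⟨(hT.left L q hL (hG.own_wire hq.1)).1 h, hq⟩, rfl⟩
  · rintro ⟨q, ⟨h, hq⟩, rfl⟩
    exact ⟨(hT.left L q hL (hG.own_wire hq.1)).2 h, q, hq, rfl⟩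

theorem premise_ty (hT : D.Describes i S) (hG : D.Good k e) {w x : R.Name}
    (h : S.ground.target w = some x) {C : Ty}
    (hx : S.ground.label x = some .bang ∧ S.ground.ty x = some (.bang C) ∨
      (S.ground.label x = some .whynot ∨ S.ground.label x = some .circ) ∧
      S.ground.ty x = some (.whynot C)) : S.ground.ty w = some C := by
  obtain ⟨L, q, p, hL, hq, rfl, ⟨h1, h2, h3, rfl⟩ | ⟨h1, h2, o, h3, h4, h5, rfl⟩⟩ :=
    hT.target_cases hG h
  · rw [hT.ty L q hL hq]
    rw [hT.ty L p hL h3, hT.label L p hL h3] at hx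
    rcases hx with ⟨hx, hx'⟩ | ⟨hx, hx'⟩
    · obtain ⟨C', h6, h7⟩ := (hG.circ L).pre.ground.ty_bang p ⟨h3.1, hx⟩
      rw [h7 q ⟨h1, h2⟩]
      rw [h6] at hx'
      simpa using hx'
    · obtain ⟨C', h6, h7⟩ := (hG.circ L).pre.ground.ty_whynot p
        (hx.elim (fun hx => Or.inl ⟨h3.1, hx⟩) (fun hx => Or.inr ⟨h3.1, hx⟩))
      rw [h7 q ⟨h1, h2⟩]
      rw [h6] at hx'
      simpa using hx'
  · rw [hT.ty L q hL hq]
    rw [hT.emb_ty hG (hG.active_par h1 hL) ((hG.circ _).pre.door_ports h5)] at hx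
    obtain ⟨A, h6, h7⟩ := (hG.circ _).pre.ty_notCirc o q (by rw [h4]; exact h2) p h5
    rw [h4] at h6
    rw [h6]
    rcases hx with ⟨-, hx⟩ | ⟨-, hx⟩ <;> rw [hx] at h7 <;> simp at h7 <;> rw [h7]

theorem ground_isDifferential (hT : D.Describes i S) (hG : D.Good k e) :
    S.ground.IsDifferential where
  finite_ports := by
    have := hG.finite
    have : S.ports ⊆ ⋃ L, D.emb L '' (D.cont L).ports := by
      intro x hx
      obtain ⟨L, p, _, hp, rfl⟩ := (hT.ports x).1 hx
      exact Set.mem_iUnion.2 ⟨L, p, hp.1, rfl⟩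
    exact (Set.finite_iUnion fun L => (hG.circ L).pre.ground.finite_ports.image _).subset this
  label_dom x := by
    constructor
    · intro hx
      obtain ⟨L, p, hL, hp, rfl⟩ := (hT.ports x).1 hx
      rw [hT.label L p hL hp]
      exact ((hG.circ L).pre.ground.label_dom p).1 hp.1
    · intro h
      by_contra hx
      exact h (hT.label_none x hx)
  ty_dom x := by
    constructor
    · intro hx
      obtain ⟨L, p, hL, hp, rfl⟩ := (hT.ports x).1 hx
      rw [hT.ty L p hL hp]
      exact ((hG.circ L).pre.ground.ty_dom p).1 hp.1
    · intro h
      by_contra hx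
      exact h (hT.ty_none x hx)
  wires_sub w hw := by
    refine ⟨hT.wires_sub hw, ?_⟩
    obtain ⟨L, p, hL, hp, rfl⟩ := (hT.ports w).1 (hT.wires_sub hw)
    rw [hT.label L p hL hp]
    rcases (hT.wires L p hL hp).1 hw with h | h
    · exact fun hc => hp.not_circ h ⟨hp.1, hc⟩
    · exact ((hG.circ L).pre.ground.wires_sub p h).2
  target_dom w := by
    constructor
    · intro hw
      obtain ⟨L, p, hL, hp, rfl⟩ := (hT.ports w).1 (hT.wires_sub hw)
      by_cases hpw : p ∈ (D.cont L).ground.wires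
      · rw [hT.target_wire L p hL hpw, ne_eq, Option.map_eq_none_iff]
        exact ((hG.circ L).pre.ground.target_dom p).1 hpw
      · have hr := ((hT.wires L p hL hp).1 hw).resolve_right hpw
        have hn : p ∈ (D.cont L).notCircs := ⟨⟨hp.1, hpw⟩, hp.not_circ hr⟩
        obtain ⟨o, ho, hc⟩ := hG.cont_eq L hr
        rw [hT.target_door L p hL hr hn _ rfl o ho, ne_eq, Option.map_eq_none_iff]
        exact ((hG.circ _).pre.door_dom o p).1 (by rw [hc]; exact hn.1)
    · intro h
      by_contra hw
      exact h (hT.target_none w hw)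
  target_mem w x h := by
    obtain ⟨L, q, p, hL, hq, rfl, ⟨h1, h2, h3, rfl⟩ | ⟨h1, h2, o, h3, h4, h5, rfl⟩⟩ :=
      hT.target_cases hG h
    · refine ⟨hT.emb_port hG hL h3.1, ?_⟩
      rw [hT.label L p hL h3]
      exact ((hG.circ L).pre.ground.target_mem q p h2).2
    · have hp := (hG.circ _).pre.door_ports h5
      have hL' := hG.active_par h1 hL
      refine ⟨hT.emb_port hG hL' hp, ?_⟩
      obtain ⟨M, a1, a2, a3, -⟩ := hG.exists_own hL' hp
      rw [← a3, hT.label M p a1 a2]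
      rcases hG.attached_label (hG.attached_of_door hL h1 h3 h5 a2 a3.symm).2 with h | h | h <;>
        simp [h]
  binary x hx := by
    obtain ⟨L, p, hL, hp, rfl, ha, hm, -⟩ := hT.own_mult hG hx
    rw [hT.premises_unattached hG hL hp ha, Set.InjOn.ncard_image]
    · exact (hG.circ L).pre.ground.binary p hm
    · exact (injOn_emb hG hL).mono fun q hq => ((hG.circ L).pre.ground.wires_sub q hq.1).1
  left_sub w hw := by
    obtain ⟨L, p, hL, hp, rfl⟩ := (hT.ports w).1 (hT.left_sub hw)
    obtain ⟨h1, q, h2, h3⟩ := (hG.circ L).pre.ground.left_sub p ((hT.left L p hL hp).1 hw)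
    refine ⟨(hT.wires L p hL hp).2 (Or.inr h1), D.emb L q, ?_, ?_⟩
    · have hq : D.Own L q := by
        rcases h2 with h2 | h2
        · exact ⟨h2.1, fun hc => by simpa using h2.2.symm.trans hc.2⟩
        · exact ⟨h2.1, fun hc => by simpa using h2.2.symm.trans hc.2⟩
      rcases h2 with h2 | h2
      · exact Or.inl ⟨hT.emb_port hG hL hq.1, (hT.label L q hL hq).trans h2.2⟩
      · exact Or.inr ⟨hT.emb_port hG hL hq.1, (hT.label L q hL hq).trans h2.2⟩
    · rw [hT.target_wire L p hL h1, h3]; rfl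
  left_unique x hx := by
    obtain ⟨L, p, hL, hp, rfl, ha, hm, -⟩ := hT.own_mult hG hx
    rw [hT.left_premises hG hL hp ha, Set.InjOn.ncard_image]
    · exact (hG.circ L).pre.ground.left_unique p hm
    · exact (injOn_emb hG hL).mono fun q hq => ((hG.circ L).pre.ground.wires_sub q hq.2.1).1
  ty_one x hx := by
    obtain ⟨L, p, hL, hp, rfl⟩ := (hT.ports x).1 hx.1
    rw [hT.ty L p hL hp]
    exact (hG.circ L).pre.ground.ty_one p ⟨hp.1, (hT.label L p hL hp).symm.trans hx.2⟩
  ty_bot x hx := by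
    obtain ⟨L, p, hL, hp, rfl⟩ := (hT.ports x).1 hx.1
    rw [hT.ty L p hL hp]
    exact (hG.circ L).pre.ground.ty_bot p ⟨hp.1, (hT.label L p hL hp).symm.trans hx.2⟩
  ty_tensor x hx w₁ hw₁ w₂ hw₂ h1 h2 A B hA hB := by
    obtain ⟨L, p, hL, hp, rfl, ha, hm, hl⟩ := hT.own_mult hG (Or.inl hx)
    rw [hT.premises_unattached hG hL hp ha] at hw₁ hw₂
    obtain ⟨q₁, hq₁, rfl⟩ := hw₁
    obtain ⟨q₂, hq₂, rfl⟩ := hw₂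
    rw [hT.left L _ hL (hG.own_wire hq₁.1)] at h1
    rw [hT.left L _ hL (hG.own_wire hq₂.1)] at h2
    rw [hT.ty L _ hL (hG.own_wire hq₁.1)] at hA
    rw [hT.ty L _ hL (hG.own_wire hq₂.1)] at hB
    rw [hT.ty L p hL hp]
    exact (hG.circ L).pre.ground.ty_tensor p ⟨hp.1, hl.symm.trans hx.2⟩ q₁ hq₁ q₂ hq₂ h1 h2 A B hA
      hB
  ty_par x hx w₁ hw₁ w₂ hw₂ h1 h2 A B hA hB := by
    obtain ⟨L, p, hL, hp, rfl, ha, hm, hl⟩ := hT.own_mult hG (Or.inr hx)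
    rw [hT.premises_unattached hG hL hp ha] at hw₁ hw₂
    obtain ⟨q₁, hq₁, rfl⟩ := hw₁
    obtain ⟨q₂, hq₂, rfl⟩ := hw₂
    rw [hT.left L _ hL (hG.own_wire hq₁.1)] at h1
    rw [hT.left L _ hL (hG.own_wire hq₂.1)] at h2
    rw [hT.ty L _ hL (hG.own_wire hq₁.1)] at hA
    rw [hT.ty L _ hL (hG.own_wire hq₂.1)] at hB
    rw [hT.ty L p hL hp]
    exact (hG.circ L).pre.ground.ty_par p ⟨hp.1, hl.symm.trans hx.2⟩ q₁ hq₁ q₂ hq₂ h1 h2 A B hA hB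
  ty_bang x hx := by
    obtain ⟨L, p, hL, hp, rfl⟩ := (hT.ports x).1 hx.1
    obtain ⟨C, hC, -⟩ := (hG.circ L).pre.ground.ty_bang p
      ⟨hp.1, (hT.label L p hL hp).symm.trans hx.2⟩
    have hC' := (hT.ty L p hL hp).trans hC
    exact ⟨C, hC', fun w hw => hT.premise_ty hG hw.2 (Or.inl ⟨hx.2, hC'⟩)⟩
  ty_whynot x hx := by
    have hx' : x ∈ S.ports := by rcases hx with h | h <;> exact h.1
    have hl : S.ground.label x = some .whynot ∨ S.ground.label x = some .circ := by
      rcases hx with h | h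
      · exact Or.inl h.2
      · exact Or.inr h.2
    obtain ⟨L, p, hL, hp, rfl⟩ := (hT.ports x).1 hx'
    obtain ⟨C, hC, -⟩ := (hG.circ L).pre.ground.ty_whynot p (by
      rw [hT.label L p hL hp] at hl
      exact hl.imp (fun h => ⟨hp.1, h⟩) (fun h => ⟨hp.1, h⟩))
    have hC' := (hT.ty L p hL hp).trans hC
    exact ⟨C, hC', fun w hw => hT.premise_ty hG hw.2 (Or.inr ⟨hl, hC'⟩)⟩

theorem isDiffPS (hT : D.Describes i S) (hG : D.Good k e) : S.IsDiffPS := by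
  have hb : ∀ b : S.boxes, ∃ L, ∃ o : (D.cont L).boxes, D.Active i L ∧
      ((D.cont L).content o).depth < i ∧ D.emb L o = b ∧ S.content b = (D.cont L).content o ∧
      ∀ q, S.door b q = ((D.cont L).door o q).map (D.emb L) := by
    intro b
    obtain ⟨L, o, hL, ho, hb⟩ := (hT.boxes b).1 b.2
    exact ⟨L, o, hL, ho, hb, hT.content L hL o b hb.symm, hT.door L hL o b hb.symm⟩
  refine ⟨{ ground := hT.ground_isDifferential hG, boxes_sub := ?_, door_dom := ?_, door_mem := ?_,
            door_injOn := ?_, door_main := ?_, door_circ := ?_, ty_circ := ?_, ty_notCirc := ?_ },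
              ?_⟩
  · intro x hx
    obtain ⟨L, o, hL, ho, h, -⟩ := hb ⟨x, hx⟩
    obtain rfl : D.emb L o = x := h
    have h1 := (hG.circ L).pre.boxes_sub o o.2
    refine ⟨⟨hT.emb_port hG hL h1.1.1, (hT.label L o hL (hG.own_box o)).trans h1.1.2⟩, ?_⟩
    rw [hT.premises_unattached hG hL (hG.own_box o)
      (hG.not_attached_kept ho), h1.2, Set.image_empty]
  · intro b p
    obtain ⟨L, o, hL, ho, h, hc, hd⟩ := hb b
    rw [hc, hd, ne_eq, Option.map_eq_none_iff]
    exact (hG.circ L).pre.door_dom o p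
  · intro b p x hx
    obtain ⟨L, o, hL, ho, h, hc, hd⟩ := hb b
    rw [hd, Option.map_eq_some_iff] at hx
    obtain ⟨q, hq, rfl⟩ := hx
    have hq' := (hG.circ L).pre.door_ports hq
    have hlab := hT.emb_label hG hL hq'
    have hport := hT.emb_port hG hL hq'
    rcases (hG.circ L).pre.door_mem o p q hq with rfl | h1 | h1
    · exact Or.inl h
    · rcases hlab with h2 | ⟨-, h2 | h2⟩
      · exact Or.inr (Or.inl ⟨hport, h2.trans h1.2⟩)
      · exact Or.inr (Or.inl ⟨hport, h2⟩)
      · exact Or.inr (Or.inr ⟨hport, h2⟩)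
    · rcases hlab with h2 | ⟨-, h2 | h2⟩
      · exact Or.inr (Or.inr ⟨hport, h2.trans h1.2⟩)
      · exact Or.inr (Or.inl ⟨hport, h2⟩)
      · exact Or.inr (Or.inr ⟨hport, h2⟩)
  · intro b p hp p' hp' h
    obtain ⟨L, o, hL, ho, -, hc, hd⟩ := hb b
    rw [hc] at hp hp'
    rw [hd, hd] at h
    obtain ⟨q, hq⟩ := Option.ne_none_iff_exists'.1 (((hG.circ L).pre.door_dom o p).1
      (((hG.circ L).contents o).pre.circs_sub hp))
    obtain ⟨q', hq'⟩ := Option.ne_none_iff_exists'.1 (((hG.circ L).pre.door_dom o p').1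
      (((hG.circ L).contents o).pre.circs_sub hp'))
    rw [hq, hq'] at h
    obtain rfl := hG.emb_eq hL hL ((hG.circ L).pre.door_ports hq) ((hG.circ L).pre.door_ports hq')
      (Option.some_injective _ h)
    exact (hG.circ L).pre.door_injOn o p hp p' hp' (hq.trans hq'.symm)
  · intro b
    obtain ⟨L, o, hL, ho, h, hc, hd⟩ := hb b
    obtain ⟨p, hp⟩ := (hG.circ L).pre.door_main o
    exact ⟨p, by rw [hd, hp, ← h]; rfl⟩
  · intro b p hp x hx
    obtain ⟨L, o, hL, ho, h, hc, hd⟩ := hb b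
    rw [hc] at hp
    rw [hd, Option.map_eq_some_iff] at hx
    obtain ⟨q, hq, rfl⟩ := hx
    have hq' := (hG.circ L).pre.door_ports hq
    intro hbang
    rcases hT.emb_label hG hL hq' with h2 | ⟨-, h2 | h2⟩
    · exact (hG.circ L).pre.door_circ o p hp q hq ⟨hq', h2.symm.trans hbang.2⟩
    · simpa using h2.symm.trans hbang.2
    · simpa using h2.symm.trans hbang.2
  · intro b p hp x hx
    obtain ⟨L, o, hL, ho, h, hc, hd⟩ := hb b
    rw [hc] at hp ⊢
    rw [hd, Option.map_eq_some_iff] at hx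
    obtain ⟨q, hq, rfl⟩ := hx
    rw [hT.emb_ty hG hL ((hG.circ L).pre.door_ports hq)]
    exact (hG.circ L).pre.ty_circ o p hp q hq
  · intro b p hp x hx
    obtain ⟨L, o, hL, ho, h, hc, hd⟩ := hb b
    rw [hc] at hp ⊢
    rw [hd, Option.map_eq_some_iff] at hx
    obtain ⟨q, hq, rfl⟩ := hx
    rw [hT.emb_ty hG hL ((hG.circ L).pre.door_ports hq)]
    exact (hG.circ L).pre.ty_notCirc o p hp q hq
  · intro b
    obtain ⟨L, o, hL, ho, h, hc, hd⟩ := hb b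
    rw [hc]
    exact (hG.circ L).contents o

end Describes
end LevelData
end Net
end MELL

/-! ### Arities as sums of contributions of levels. -/

namespace MELL

theorem finsum_mem_le_of_subset {ι : Type*} {s t : Set ι} (hst : s ⊆ t) (ht : t.Finite)
    (f : ι → ℕ) : ∑ᶠ i ∈ s, f i ≤ ∑ᶠ i ∈ t, f i := by
  rw [← finsum_mem_add_sdiff (f := f) hst ht]
  exact Nat.le_add_right _ _

theorem finsum_mem_le_finsum {ι : Type*} [Finite ι] (s : Set ι) (f : ι → ℕ) :
    ∑ᶠ i ∈ s, f i ≤ ∑ᶠ i, f i := by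
  rw [← finsum_mem_univ f]
  exact finsum_mem_le_of_subset (Set.subset_univ s) Set.finite_univ f

theorem le_finsum_mem {ι : Type*} {s : Set ι} (hs : s.Finite) (f : ι → ℕ) {i : ι} (hi : i ∈ s) :
    f i ≤ ∑ᶠ i ∈ s, f i := by
  rw [← finsum_mem_singleton (f := f) (a := i)]
  exact finsum_mem_le_of_subset (Set.singleton_subset_iff.2 hi) hs f

theorem finsum_mem_const {ι : Type*} (s : Set ι) (c : ℕ) : ∑ᶠ _i ∈ s, c = s.ncard * c := by
  rw [← finsum_one, finsum_mem_mul]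
  simp

namespace Net

variable {α β : Type u}

/-- The contribution of a box with content `B` and door map `f` to the arity of `x`. -/
noncomputable def contentArity (B : Net α α) (f : α → Option β) (x : β) : ℕ :=
  {p | p ∈ B.notCircs ∧ f p = some x}.ncard + ∑ᶠ p ∈ {p | p ∈ B.circs ∧ f p = some x}, B.arity p

theorem arity_eq_contentArity (S : Net α β) [Finite S.boxes] (x : β) :
    S.arity x = (S.ground.premises x).ncard +
      ∑ᶠ o : S.boxes, contentArity (S.content o) (S.door o) x := by
  rw [arity_eq, add_assoc]
  congr 1
  exact (finsum_add_distrib (Set.toFinite _) (Set.toFinite _)).symm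

theorem IsPreDifferential.finite_notCircs {S : Net α β} (h : S.IsPreDifferential) :
    S.notCircs.Finite := h.ground.finite_ports.subset fun _ hp => hp.1.1

theorem IsPreDifferential.finite_circs {S : Net α β} (h : S.IsPreDifferential) :
    S.circs.Finite := h.ground.finite_ports.subset fun _ hp => hp.1

theorem contentArity_pos {B : Net α α} (hB : B.IsPreDifferential)
    (hc : ∀ p ∈ B.circs, 0 < B.arity p) {f : α → Option β} {x : β} {p : α}
    (hp : p ∈ B.conclusions) (hf : f p = some x) : 0 < contentArity B f x := by
  by_cases h : p ∈ B.circs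
  · refine Nat.add_pos_right _ ((hc p h).trans_le ?_)
    exact le_finsum_mem (hB.finite_circs.subset fun q hq => hq.1) _ ⟨h, hf⟩
  · refine Nat.add_pos_left ?_ _
    rw [Set.ncard_pos (hB.finite_notCircs.subset fun q hq => hq.1)]
    exact ⟨p, ⟨hp, h⟩, hf⟩

theorem exists_of_contentArity_ne_zero {B : Net α α} {f : α → Option β} {x : β}
    (h : contentArity B f x ≠ 0) : ∃ p, f p = some x := by
  by_contra hn
  push Not at hn
  apply h
  have h1 : {p | p ∈ B.notCircs ∧ f p = some x} = ∅ :=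
    Set.eq_empty_of_forall_notMem fun p hp => hn p hp.2
  have h2 : {p | p ∈ B.circs ∧ f p = some x} = ∅ :=
    Set.eq_empty_of_forall_notMem fun p hp => hn p hp.2
  rw [contentArity, h1, h2, Set.ncard_empty, finsum_mem_empty, add_zero]

/-- A `∘`-port is a door of some box. The conclusion behind that door counts for one if it is not
labelled `∘`, and otherwise contributes its own arity, positive by induction. -/
theorem IsCircPS.arity_circ_pos {R : Net α α} (hR : R.IsCircPS) : ∀ p ∈ R.circs, 0 < R.arity p := by
  induction hR with
  | intro R h1 h2 h3 h4 h5 h6 ih =>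
    intro p hp
    have := h1.finite_boxes
    rw [arity_eq_contentArity]
    obtain ⟨o, q, hq⟩ := h4 p hp
    refine Nat.add_pos_right _ ((contentArity_pos (h6 o).pre (ih o) ?_ hq).trans_le
      (le_finsum_mem Set.finite_univ (fun o => contentArity (R.content o) (R.door o) p)
        (Set.mem_univ o) |>.trans ?_))
    · exact (h1.door_dom o q).2 (by simp [hq])
    · rw [finsum_mem_univ]

theorem arity_lt_of_cosize {S : Net α β} (h : S.IsPreDifferential) {k : ℕ} (hk : 0 < k)
    (hc : S.cosize < k) {p : β} (hp : p ∈ S.ports) : S.arity p < k :=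
  ((cosize_lt_iff h hk).1 hc).1 p hp

/-- A nonzero contribution is part of the arity of an actual port, which the cosize bounds. -/
theorem contentArity_lt {S : Net α β} (h : S.IsPreDifferential) {k : ℕ} (hk : 0 < k)
    (hc : S.cosize < k) (o : S.boxes) (x : β) : contentArity (S.content o) (S.door o) x < k := by
  by_cases h0 : contentArity (S.content o) (S.door o) x = 0
  · omega
  obtain ⟨p, hp⟩ := exists_of_contentArity_ne_zero h0
  have := h.finite_boxes
  refine lt_of_le_of_lt ?_ (arity_lt_of_cosize h hk hc (h.door_ports hp))
  rw [arity_eq_contentArity]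
  refine le_trans ?_ (Nat.le_add_left _ _)
  refine (le_finsum_mem Set.finite_univ (fun o => contentArity (S.content o) (S.door o) x)
        (Set.mem_univ o)).trans ?_
  rw [finsum_mem_univ]

/-- The contribution of the boxes with content of depth `< i` to the arity of `p`. -/
noncomputable def keptArity (i : ℕ) (B : Net α β) (p : β) : ℕ :=
  ∑ᶠ o ∈ {o : B.boxes | (B.content o).depth < i}, contentArity (B.content o) (B.door o) p

theorem keptArity_le (i : ℕ) (B : Net α β) [Finite B.boxes] (p : β) :
    (B.ground.premises p).ncard + keptArity i B p ≤ B.arity p := by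
  rw [arity_eq_contentArity]
  exact Nat.add_le_add_left (finsum_mem_le_finsum _ _) _

open Classical in
/-- The contribution of a copy of the content `B` of the box `b` of `P` to the arity of a port `p`
of `P`, when its boxes with content of depth `≥ i` are ignored. -/
noncomputable def outerArity (i : ℕ) (P : Net α α) (b : Option α) (B : Net α α) (p : α) : ℕ :=
  {q | q ∈ B.notCircs ∧ ∃ o : P.boxes, b = some ↑o ∧ P.door o q = some p}.ncard +
    if p ∈ B.circs then keptArity i B p else 0

namespace LevelData

variable {R : Net α α} {k i : ℕ} {e : R.PseudoExp} {D : LevelData R} {S : Net α R.Name}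

/-- The counting principle for levels. The class of exponent `0` is the root alone, so the condition
on it concerns one level only. -/
theorem Good.digit_finsum (hG : D.Good k e) (hk : 1 < k) (n : D.Lv → ℕ) (hn : ∀ L, n L < k)
    (ℓ : D.Lv) (h1 : ∀ L, D.exp L = D.exp ℓ → L ≠ ℓ → n L = 0) (h0 : ℓ ≠ D.root → n D.root = 0)
    (hc : ∀ L L', D.exp L = D.exp L' → D.exp L ≠ D.exp ℓ → n L = n L') :
    (∀ L, L ≠ D.root → D.exp L ≠ D.exp ℓ → digit k (∑ᶠ L, n L) (D.exp L) = n L) ∧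
    ∀ j, 0 < j → (j = D.exp ℓ ∨ ∀ L, D.exp L ≠ j) → digit k (∑ᶠ L, n L) j = 0 := by
  classical
  have := hG.finite
  have := Fintype.ofFinite D.Lv
  rw [finsum_eq_sum_of_fintype]
  have hroot : ∀ L, D.exp L = 0 → L = D.root := fun L h => by
    by_contra hL
    have := hG.exp_pos L hL
    omega
  obtain ⟨a, b⟩ := digit_sum_classes hk Finset.univ D.exp
    (fun L _ => by
      rw [← hG.exp_card L, Set.ncard_eq_toFinset_card', Set.toFinset_ofPred]) n (fun L _ => hn L) ℓ
    (fun L _ => h1 L)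
    (fun hℓ L _ hL => by
      rw [hroot L hL]
      refine h0 ?_
      rintro rfl
      exact hℓ hG.exp_root)
    (fun L _ L' _ => hc L L')
  exact ⟨fun L hL => a L (Finset.mem_univ _) (hG.exp_pos L hL),
    fun j hj h => b j hj (h.imp_right fun h L _ => h L)⟩

/-- The contribution of the level `L` to the arity of `x`. -/
noncomputable def levelArity (D : LevelData R) (S : Net α R.Name) (x : R.Name) (L : D.Lv) : ℕ :=
  {w | w ∈ S.ground.premises x ∧ D.lv w = L}.ncard +
    ∑ᶠ b ∈ {b : S.boxes | D.lv b = L}, contentArity (S.content b) (S.door b) x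

theorem finsum_levelArity (hG : D.Good k e) (hS : S.IsPreDifferential) (x : R.Name) :
    S.arity x = ∑ᶠ L, D.levelArity S x L := by
  have := hG.finite
  have := hS.finite_boxes
  have hp : (S.ground.premises x).Finite :=
    hS.ground.finite_ports.subset fun w hw => (hS.ground.wires_sub w hw.1).1
  unfold levelArity
  rw [arity_eq_contentArity, finsum_add_distrib (Set.toFinite _) (Set.toFinite _)]
  congr 1
  · rw [← Set.ncard_iUnion_of_finite]
    · congr 1
      ext w
      simp
    · exact fun L => hp.subset fun w hw => hw.1
    · intro L L' hne
      exact Set.disjoint_left.2 fun w hw hw' => hne (hw.2.symm.trans hw'.2)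
  · rw [← finsum_mem_iUnion, ← finsum_mem_univ]
    · congr 1
      -- Every box has exactly one level, so the fibres of `D.lv` exhaust the boxes.
      ext b
      simp
    · intro L L' hne
      exact Set.disjoint_left.2 fun w hw hw' => hne (Eq.trans (Eq.symm hw) hw')
    · exact fun L => Set.toFinite _

/-- The doors, in the level `L`, of the kept boxes of `L`. -/
theorem Describes.finsum_boxes (hT : D.Describes i S) (hG : D.Good k e) (L : D.Lv) (x : R.Name)
    (hL : D.Active i L) :
    ∑ᶠ b ∈ {b : S.boxes | D.lv b = L}, contentArity (S.content b) (S.door b) x =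
    ∑ᶠ o ∈ {o : (D.cont L).boxes | ((D.cont L).content o).depth < i},
      contentArity ((D.cont L).content o) (fun q => ((D.cont L).door o q).map (D.emb L)) x := by
  rw [← finsum_set_coe_eq_finsum_mem, ← finsum_set_coe_eq_finsum_mem]
  symm
  refine finsum_eq_of_bijective (fun o => ⟨⟨D.emb L ↑o.1, (hT.boxes _).2 ⟨L, o.1, hL, o.2, rfl⟩⟩,
    hG.lv_emb (hG.own_box o.1)⟩) ⟨?_, ?_⟩ ?_
  · intro o o' h
    have h : D.emb L ↑o.1 = D.emb L ↑o'.1 := congrArg (fun b => ((b.1 : S.boxes) : R.Name)) h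
    exact Subtype.ext (Subtype.ext (hG.emb_inj _ _ _ _ (hG.own_box o.1) (hG.own_box o'.1) h).2)
  · rintro ⟨⟨b, hb⟩, hl⟩
    obtain ⟨M, o, hM, ho, rfl⟩ := (hT.boxes b).1 hb
    obtain rfl : M = L := (hG.lv_emb (hG.own_box o)).symm.trans hl
    exact ⟨⟨o, ho⟩, rfl⟩
  · intro o
    have h1 := hT.content L hL o.1 ⟨D.emb L ↑o.1, (hT.boxes _).2 ⟨L, o.1, hL, o.2, rfl⟩⟩ rfl
    have h2 := hT.door L hL o.1 ⟨D.emb L ↑o.1, (hT.boxes _).2 ⟨L, o.1, hL, o.2, rfl⟩⟩ rfl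
    rw [h1, funext h2]

theorem Good.emb_door_iff (hG : D.Good k e) {L M : D.Lv} (hL : D.Active i L) {p : α}
    (hp : D.Own M p) (o : (D.cont L).boxes) (q : α) :
    ((D.cont L).door o q).map (D.emb L) = some (D.emb M p) ↔
      (D.cont L).door o q = some p ∧ D.emb L p = D.emb M p := by
  rw [Option.map_eq_some_iff]
  constructor
  · rintro ⟨p', h1, h2⟩
    obtain ⟨rfl, -⟩ := hG.own_emb hL ((hG.circ L).pre.door_ports h1) hp h2
    exact ⟨h1, h2⟩
  · rintro ⟨h1, h2⟩
    exact ⟨p, h1, h2⟩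

theorem contentArity_emb_door (hG : D.Good k e) {L M : D.Lv} (hL : D.Active i L) {p : α}
    (hp : D.Own M p) (o : (D.cont L).boxes) (h : D.emb L p = D.emb M p) :
    contentArity ((D.cont L).content o) (fun q => ((D.cont L).door o q).map (D.emb L)) (D.emb M p) =
    contentArity ((D.cont L).content o) ((D.cont L).door o) p := by
  simp only [contentArity, hG.emb_door_iff hL hp, h, and_true]

theorem contentArity_emb_door_eq_zero (hG : D.Good k e) {L M : D.Lv} (hL : D.Active i L) {p : α}
    (hp : D.Own M p) (o : (D.cont L).boxes) (h : ¬ (p ∈ (D.cont L).ports ∧ D.emb L p = D.emb M p)) :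
    contentArity ((D.cont L).content o) (fun q => ((D.cont L).door o q).map (D.emb L)) (D.emb M p) =
    0 := by
  by_contra hne
  obtain ⟨q, hq⟩ := exists_of_contentArity_ne_zero hne
  obtain ⟨h1, h2⟩ := (hG.emb_door_iff hL hp o q).1 hq
  exact h ⟨(hG.circ L).pre.door_ports h1, h2⟩

/-! ### Bounds for the contributions, and the digits of an arity. -/

namespace Describes

theorem active_lv (hT : D.Describes i S) (hG : D.Good k e) {x : R.Name} (hx : x ∈ S.ports) :
    D.Active i (D.lv x) := by
  obtain ⟨L, p, hL, hp, rfl⟩ := (hT.ports x).1 hx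
  rwa [hG.lv_emb hp]

theorem levelArity_inactive (hT : D.Describes i S) (hG : D.Good k e) {L : D.Lv}
    (hL : ¬ D.Active i L) (x : R.Name) : D.levelArity S x L = 0 := by
  have h1 : {w | w ∈ S.ground.premises x ∧ D.lv w = L} = ∅ := by
    refine Set.eq_empty_of_forall_notMem ?_
    rintro w ⟨hw, rfl⟩
    exact hL (hT.active_lv hG (hT.wires_sub hw.1))
  have h2 : {b : S.boxes | D.lv b = L} = ∅ := by
    refine Set.eq_empty_of_forall_notMem ?_
    rintro ⟨b, hb⟩ rfl
    exact hL (hT.active_lv hG ((hT.isDiffPS hG).1.boxes_sub_ports hb))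
  rw [levelArity, h1, h2, Set.ncard_empty, finsum_mem_empty, add_zero]

/-- What the owner contributes to its own port is part of the arity of that port in the content,
hence less than `k`. -/
theorem levelArity_own_lt (hT : D.Describes i S) (hG : D.Good k e) (hk : 0 < k) {L : D.Lv}
    (hL : D.Active i L) {p : α} (hp : D.Own L p) : D.levelArity S (D.emb L p) L < k := by
  have hfin := (hG.circ L).pre.finite_boxes
  refine lt_of_le_of_lt ?_ (arity_lt_of_cosize (hG.circ L).pre hk (hG.cosize_lt L) hp.1)
  refine le_trans ?_ (keptArity_le i _ p)
  refine Nat.add_le_add ?_ (le_of_eq ?_)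
  · have hpf : ((D.cont L).ground.premises p).Finite := (hG.circ L).pre.ground.finite_ports.subset
      fun w hw => ((hG.circ L).pre.ground.wires_sub w hw.1).1
    refine (Set.ncard_le_ncard (t := D.emb L '' (D.cont L).ground.premises p) ?_
      (hpf.image _)).trans (Set.ncard_image_le hpf)
    rintro w ⟨⟨hw, hw'⟩, hl⟩
    obtain ⟨M, q, p', hM, hq, rfl, ⟨h1, h2, h3, h4⟩ | ⟨h1, h2, o, h3, h4, h5, h6⟩⟩ :=
      hT.target_cases hG hw'
    · obtain ⟨rfl, rfl⟩ := hG.emb_inj _ _ _ _ hp h3 h4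
      exact ⟨q, ⟨h1, h2⟩, rfl⟩
    · obtain rfl : M = L := (hG.lv_emb hq).symm.trans hl
      -- The conclusions of a level are sent to ports owned by strictly lower ranks, never to ports
      -- of the level itself.
      have := (hG.own_emb (hG.active_par h1 hM) ((hG.circ _).pre.door_ports h5) hp
        h6.symm).2.2.rank_le
      have := hG.rank_par M h1
      omega
  · rw [hT.finsum_boxes hG L _ hL, keptArity]
    refine finsum_mem_congr rfl fun o _ => contentArity_emb_door hG hL hp o rfl

/-- A level that does not own the port reaches it in two ways: by a conclusion not labelled `∘` sent
there by the door map, or by kept boxes, if the port is one of its `∘`-conclusions. Both require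
that the parent of the level sees the port. -/
theorem levelArity_outer (hT : D.Describes i S) (hG : D.Good k e) {L M : D.Lv} (hr : L ≠ D.root)
    (hL : D.Active i L) {p : α} (hp : D.Own M p) (hML : M ≠ L) :
    (D.emb (D.par L) p = D.emb M p → D.levelArity S (D.emb M p) L =
      outerArity i (D.cont (D.par L)) (D.box L) (D.cont L) p) ∧
    (D.emb (D.par L) p ≠ D.emb M p → D.levelArity S (D.emb M p) L = 0) := by
  have hfin := (hG.circ L).pre.finite_boxes
  have h1 : {w | w ∈ S.ground.premises (D.emb M p) ∧ D.lv w = L} = D.emb L ''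
      {q | q ∈ (D.cont L).notCircs ∧ D.emb (D.par L) p = D.emb M p ∧
        ∃ o : (D.cont (D.par L)).boxes, D.box L = some ↑o ∧
          (D.cont (D.par L)).door o q = some p} := by
    ext w
    constructor
    · rintro ⟨⟨hw, hw'⟩, rfl⟩
      obtain ⟨N, q, p', hN, hq, rfl, ⟨h1, h2, h3, h4⟩ | ⟨h1, h2, o, h3, h4, h5, h6⟩⟩ :=
        hT.target_cases hG hw'
      · rw [hG.lv_emb hq] at hML
        exact (hML (hG.emb_inj _ _ _ _ hp h3 h4).1).elim
      · rw [hG.lv_emb hq]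
        obtain ⟨rfl, -⟩ := hG.own_emb (hG.active_par h1 hN)
          ((hG.circ _).pre.door_ports h5) hp h6.symm
        exact ⟨q, ⟨h2, h6.symm, o, h3, h5⟩, rfl⟩
    · rintro ⟨q, ⟨h1, h2, o, h3, h4⟩, rfl⟩
      have hq := hG.own_notCirc h1
      refine ⟨⟨(hT.wires L q hL hq).2 (Or.inl hr), ?_⟩, hG.lv_emb hq⟩
      rw [hT.target_door L q hL hr h1 _ rfl o h3, h4, Option.map_some, h2]
  rw [levelArity, hT.finsum_boxes hG L _ hL, h1]
  constructor
  · intro h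
    rw [outerArity]
    congr 1
    · rw [Set.InjOn.ncard_image]
      · simp only [h, true_and]
      · exact (injOn_emb hG hL).mono fun q hq => hq.1.1.1
    · split_ifs with hc
      · rw [keptArity]
        refine finsum_mem_congr rfl fun o _ => contentArity_emb_door hG hL hp o ?_
        rw [hG.emb_circ L p hr hc, h]
      · rw [finsum_mem_congr rfl fun o _ => contentArity_emb_door_eq_zero hG hL hp o ?_]
        · simp
        · rintro ⟨h2, h3⟩
          obtain ⟨-, h4 | h4, -⟩ := hG.own_emb hL h2 hp h3
          · exact hML h4.symm
          · exact hc h4.2.1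
  · intro h
    rw [finsum_mem_congr rfl fun o _ => contentArity_emb_door_eq_zero hG hL hp o ?_]
    · simp [h]
    · rintro ⟨h2, h3⟩
      obtain ⟨-, h4 | h4, -⟩ := hG.own_emb hL h2 hp h3
      · exact hML h4.symm
      · exact h (by rw [← hG.emb_circ L p hr h4.2.1, h3])

end Describes

/-- The quantity is at most the contribution of the box to the arity of `p` in the parent:
restricting to the kept boxes only lowers the arity of a `∘`-conclusion. -/
theorem Good.outerArity_lt (hG : D.Good k e) (hk : 0 < k) {L : D.Lv} (hr : L ≠ D.root) (p : α) :
    outerArity i (D.cont (D.par L)) (D.box L) (D.cont L) p < k := by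
  obtain ⟨o, ho, hc⟩ := hG.cont_eq L hr
  refine lt_of_le_of_lt ?_ (contentArity_lt (hG.circ (D.par L)).pre hk (hG.cosize_lt _) o p)
  have hfin := (hG.circ L).pre.finite_boxes
  rw [outerArity, contentArity, hc]
  refine Nat.add_le_add (le_of_eq ?_) ?_
  · congr 1
    ext q
    constructor
    · rintro ⟨h1, o', h2, h3⟩
      obtain rfl : o = o' := Subtype.ext (Option.some_injective _ (ho.symm.trans h2))
      exact ⟨h1, h3⟩
    · rintro ⟨h1, h3⟩
      exact ⟨h1, o, ho, h3⟩
  · split_ifs with h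
    · refine ((Nat.le_add_left _ _).trans (keptArity_le i (D.cont L) p)).trans ?_
      exact le_finsum_mem ((hG.circ L).pre.finite_circs.subset fun q hq => hq.1) (D.cont L).arity
        ⟨h, (hG.door_circ hr h ho).2.1⟩
    · exact Nat.zero_le _

theorem Good.exists_door_of_outerArity (hG : D.Good k e) {L : D.Lv} (hr : L ≠ D.root) {p : α}
    (h : outerArity i (D.cont (D.par L)) (D.box L) (D.cont L) p ≠ 0) :
    ∃ (o : (D.cont (D.par L)).boxes) (q : α), D.box L = some ↑o ∧
      (D.cont (D.par L)).door o q = some p := by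
  by_cases hc : p ∈ (D.cont L).circs
  · obtain ⟨o, ho, -⟩ := hG.cont_eq L hr
    exact ⟨o, p, ho, (hG.door_circ hr hc ho).2.1⟩
  · rw [outerArity, if_neg hc, add_zero] at h
    obtain ⟨q, -, o, h1, h2⟩ := Set.nonempty_of_ncard_ne_zero h
    exact ⟨o, q, h1, h2⟩

theorem keptArity_pos (hG : D.Good k e) {L : D.Lv} {p p' : α} {o : (D.cont L).boxes}
    (ho : ((D.cont L).content o).depth < i) (hd : (D.cont L).door o p' = some p) :
    0 < keptArity i (D.cont L) p := by
  have := (hG.circ L).pre.finite_boxes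
  refine (contentArity_pos ((hG.circ L).contents o).pre ((hG.circ L).contents o).arity_circ_pos
    (((hG.circ L).pre.door_dom o p').2 (by simp [hd])) hd).trans_le ?_
  exact le_finsum_mem (Set.toFinite _) (fun o => contentArity ((D.cont L).content o)
    ((D.cont L).door o) p) ho

/-- A door of an expanded box receives something from some level above. -/
theorem Good.exists_outerArity_pos (hG : D.Good k e) {x : R.Name} {L : D.Lv} (hr : L ≠ D.root)
    (hL : D.Active i L) {o : (D.cont (D.par L)).boxes} (ho : D.box L = some ↑o) {p' p : α}
    (hd : (D.cont (D.par L)).door o p' = some p) (hx : D.emb (D.par L) p = x) :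
    ∃ L', L' ≠ D.root ∧ D.Active i L' ∧ D.rank L ≤ D.rank L' ∧ D.emb (D.par L') p = x ∧
      0 < outerArity i (D.cont (D.par L')) (D.box L') (D.cont L') p := by
  suffices H : ∀ n L, (D.cont L).depth ≤ n → L ≠ D.root → D.Active i L →
      ∀ o : (D.cont (D.par L)).boxes, D.box L = some ↑o → ∀ p',
      (D.cont (D.par L)).door o p' = some p → D.emb (D.par L) p = x →
      ∃ L', L' ≠ D.root ∧ D.Active i L' ∧ D.rank L ≤ D.rank L' ∧ D.emb (D.par L') p = x ∧
        0 < outerArity i (D.cont (D.par L')) (D.box L') (D.cont L') p from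
    H _ L le_rfl hr hL o ho p' hd hx
  intro n
  induction n with
  | zero =>
    intro L hn hr hL o ho p' hd hx
    refine ⟨L, hr, hL, le_rfl, hx, ?_⟩
    obtain ⟨o', h3, hc⟩ := hG.cont_eq L hr
    obtain rfl : o = o' := Subtype.ext (Option.some_injective _ (ho.symm.trans h3))
    have hp' : p' ∈ (D.cont L).conclusions := by
      rw [← hc]; exact ((hG.circ _).pre.door_dom o p').2 (by simp [hd])
    by_cases hcirc : p' ∈ (D.cont L).circs
    -- A content of depth `0` has no box, hence no `∘`-conclusion.
    · obtain ⟨o', q, -⟩ := (hG.circ L).circ_covered p' hcirc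
      have := depth_content_lt (hG.circ L).pre o'
      omega
    · refine Nat.add_pos_left ?_ _
      rw [Set.ncard_pos ((hG.circ L).pre.finite_notCircs.subset fun q hq => hq.1)]
      exact ⟨p', ⟨hp', hcirc⟩, o, ho, hd⟩
  | succ n ih =>
    intro L hn hr hL o ho p' hd hx
    obtain ⟨o', h3, hc⟩ := hG.cont_eq L hr
    obtain rfl : o = o' := Subtype.ext (Option.some_injective _ (ho.symm.trans h3))
    have hp' : p' ∈ (D.cont L).conclusions := by
      rw [← hc]; exact ((hG.circ _).pre.door_dom o p').2 (by simp [hd])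
    by_cases hcirc : p' ∈ (D.cont L).circs
    · obtain ⟨-, h4, -⟩ := hG.door_circ hr hcirc ho
      obtain rfl : p' = p := Option.some_injective _ (h4.symm.trans hd)
      obtain ⟨o', q, hq⟩ := (hG.circ L).circ_covered p' hcirc
      have hdep := depth_content_lt (hG.circ L).pre o'
      -- The `∘`-conclusion is a door of an inner box `o'`. If `o'` is kept, it contributes in `L`;
      -- if it is expanded, the search continues in a child of smaller depth.
      by_cases hk : ((D.cont L).content o').depth < i
      · refine ⟨L, hr, hL, le_rfl, hx, Nat.add_pos_right _ ?_⟩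
        rw [if_pos hcirc]
        exact keptArity_pos hG hk hq
      · obtain ⟨L', a1, rfl, a3⟩ := hG.child L o' o'.2
        obtain ⟨o₁, b1, b2⟩ := hG.cont_eq L' a1
        obtain rfl : o' = o₁ := Subtype.ext (Option.some_injective _ (a3.symm.trans b1))
        obtain ⟨L'', c1, c2, c3, c4, c5⟩ := ih L' (by rw [← b2]; omega) a1
          (Or.inr (by rw [← b2]; omega)) o' a3 q hq (by rw [hG.emb_circ _ _ hr hcirc, hx])
        have := hG.rank_par L' a1
        exact ⟨L'', c1, c2, by omega, c4, c5⟩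
    · refine ⟨L, hr, hL, le_rfl, hx, Nat.add_pos_left ?_ _⟩
      rw [Set.ncard_pos ((hG.circ L).pre.finite_notCircs.subset fun q hq => hq.1)]
      exact ⟨p', ⟨hp', hcirc⟩, o, ho, hd⟩

/-- Siblings: copies of the content of the same box. -/
theorem Good.sib (hG : D.Good k e) {L L' : D.Lv} (hr : L ≠ D.root) (h : D.exp L = D.exp L') :
    L' ≠ D.root ∧ D.par L = D.par L' ∧ D.box L = D.box L' ∧ D.cont L = D.cont L' ∧
      D.rank L = D.rank L' := by
  obtain ⟨h1, h2, h3⟩ := hG.exp_inj L L' hr h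
  obtain ⟨o, ho, hc⟩ := hG.cont_eq L hr
  obtain ⟨o', ho', hc'⟩ := hG.cont_eq L' h1
  have hcc : D.cont L = D.cont L' := by
    rw [← hc, ← hc']
    rw [h3, ho', Option.some.injEq] at ho
    clear ho' hc hc'
    revert o o'
    rw [h2]
    intro o o' ho
    rw [Subtype.ext ho]
  exact ⟨h1, h2, h3, hcc, by rw [hG.rank_par L hr, hG.rank_par L' h1, h2]⟩

theorem Good.active_sib (hG : D.Good k e) {L L' : D.Lv} (h : D.exp L = D.exp L')
    (hL : D.Active i L) : D.Active i L' := by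
  by_cases hr : L = D.root
  · have : L' = D.root := by
      by_contra h'
      have := hG.exp_pos L' h'
      rw [← h, hr, hG.exp_root] at this
      exact absurd this (lt_irrefl 0)
    exact Or.inl this
  · obtain ⟨-, -, -, h4, -⟩ := hG.sib hr h
    exact Or.inr (by rw [← h4]; exact hL.depth hr)

namespace Describes

theorem levelArity_ne_zero (hT : D.Describes i S) (hG : D.Good k e) {L M : D.Lv} {p : α}
    (hp : D.Own M p) (h : D.levelArity S (D.emb M p) L ≠ 0) : D.Active i L ∧
    (L = M ∨ L ≠ D.root ∧ D.Anc M (D.par L) ∧ D.emb (D.par L) p = D.emb M p ∧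
      outerArity i (D.cont (D.par L)) (D.box L) (D.cont L) p ≠ 0) := by
  have hL : D.Active i L := by
    by_contra hL
    exact h (hT.levelArity_inactive hG hL _)
  refine ⟨hL, ?_⟩
  by_cases hML : M = L
  · exact Or.inl hML.symm
  by_cases hr : L = D.root
  · exfalso
    subst hr
    by_cases h1 : {w | w ∈ S.ground.premises (D.emb M p) ∧ D.lv w = D.root} = ∅
    · rw [levelArity, h1, hT.finsum_boxes hG _ _ hL, finsum_mem_congr rfl fun o _ =>
        contentArity_emb_door_eq_zero hG hL hp o ?_] at h
      · simp at h
      · rintro ⟨h2, h3⟩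
        obtain ⟨-, h4 | h4, -⟩ := hG.own_emb hL h2 hp h3
        · exact hML h4.symm
        · exact h4.1 rfl
    · obtain ⟨w, ⟨-, hw⟩, hl⟩ := Set.nonempty_iff_ne_empty.2 h1
      obtain ⟨N, q, p', hN, hq, rfl, ⟨h1, h2, h3, h4⟩ | ⟨h1, h2, o, h3, h4, h5, h6⟩⟩ :=
        hT.target_cases hG hw
      · rw [hG.lv_emb hq] at hl
        exact hML ((hG.emb_inj _ _ _ _ hp h3 h4).1.trans hl)
      · rw [hG.lv_emb hq] at hl
        exact h1 hl
  · obtain ⟨h1, h2⟩ := hT.levelArity_outer hG hr hL hp hML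
    by_cases he : D.emb (D.par L) p = D.emb M p
    · rw [h1 he] at h
      obtain ⟨o, q, h3, h4⟩ := hG.exists_door_of_outerArity hr h
      exact Or.inr ⟨hr, (hG.own_emb (hG.active_par hr hL)
        ((hG.circ _).pre.door_ports h4) hp he).2.2,
        he, h⟩
    · exact (h (h2 he)).elim

theorem levelArity_lt (hT : D.Describes i S) (hG : D.Good k e) (hk : 0 < k) {L M : D.Lv} {p : α}
    (hp : D.Own M p) : D.levelArity S (D.emb M p) L < k := by
  by_cases h : D.levelArity S (D.emb M p) L = 0
  · omega
  obtain ⟨hL, rfl | ⟨hr, h2, h3, h4⟩⟩ := hT.levelArity_ne_zero hG hp h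
  · exact hT.levelArity_own_lt hG hk hL hp
  · have hML : M ≠ L := by
      rintro rfl
      have := h2.rank_le
      have := hG.rank_par M hr
      omega
    rw [(hT.levelArity_outer hG hr hL hp hML).1 h3]
    exact hG.outerArity_lt hk hr p

/-- The contribution of a level other than the owner depends only on its parent, box and content,
which siblings have in common. -/
theorem levelArity_sib (hT : D.Describes i S) (hG : D.Good k e) {L L' M : D.Lv} {p : α}
    (hp : D.Own M p) (h : D.exp L = D.exp L') (hM : M ≠ L) (hM' : M ≠ L') :
    D.levelArity S (D.emb M p) L = D.levelArity S (D.emb M p) L' := by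
  by_cases hr : L = D.root
  · have : L' = D.root := by
      by_contra h'
      have := hG.exp_pos L' h'
      rw [← h, hr, hG.exp_root] at this
      exact absurd this (lt_irrefl 0)
    rw [hr, this]
  · obtain ⟨h1, h2, h3, h4, -⟩ := hG.sib hr h
    by_cases hL : D.Active i L
    · obtain ⟨a1, a2⟩ := hT.levelArity_outer hG hr hL hp hM
      obtain ⟨b1, b2⟩ := hT.levelArity_outer hG h1 (hG.active_sib h hL) hp hM'
      by_cases he : D.emb (D.par L) p = D.emb M p
      · rw [a1 he, b1 (by rw [← h2, he]), h2, h3, h4]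
      · rw [a2 he, b2 (by rw [← h2]; exact he)]
    · rw [hT.levelArity_inactive hG hL, hT.levelArity_inactive hG fun hL' =>
        hL (hG.active_sib h.symm hL')]

/-- The exceptional level is the owner `M`. Any other contributing level has rank above that of `M`;
this excludes the siblings of `M`, and also the root when it is not `M`. -/
theorem digit_arity (hT : D.Describes i S) (hG : D.Good k e) (hk : 1 < k) {M : D.Lv} {p : α}
    (hp : D.Own M p) :
    (∀ L, L ≠ D.root → D.exp L ≠ D.exp M →
      digit k (S.arity (D.emb M p)) (D.exp L) = D.levelArity S (D.emb M p) L) ∧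
    ∀ j, 0 < j → (j = D.exp M ∨ ∀ L, D.exp L ≠ j) → digit k (S.arity (D.emb M p)) j = 0 := by
  rw [finsum_levelArity hG (hT.isDiffPS hG).1]
  have hrank : ∀ {L}, D.levelArity S (D.emb M p) L ≠ 0 → L ≠ M → L ≠ D.root ∧
      D.rank M < D.rank L := by
    intro L h hne
    obtain ⟨-, h | ⟨h1, h2, -⟩⟩ := hT.levelArity_ne_zero hG hp h
    · exact (hne h).elim
    · have := h2.rank_le
      have := hG.rank_par L h1
      exact ⟨h1, by omega⟩
  refine hG.digit_finsum hk _ (fun L => hT.levelArity_lt hG (by omega) hp) M ?_ ?_ ?_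
  · intro L hL hne
    by_contra h
    obtain ⟨h1, h2⟩ := hrank h hne
    have := (hG.sib h1 hL).2.2.2.2
    omega
  · intro hM
    by_contra h
    exact (hrank h (Ne.symm hM)).1 rfl
  · intro L L' h hne
    refine hT.levelArity_sib hG hp h ?_ ?_
    · rintro rfl; exact hne rfl
    · rintro rfl; exact hne h

/-- An attached port receives at least `k` from the levels above it. -/
theorem le_finsum_levelArity (hT : D.Describes i S) (hG : D.Good k e) (hk : 1 < k) {M : D.Lv} {p
    : α}
    (hp : D.Own M p) (ha : D.Attached i M p) :
    k ≤ ∑ᶠ L ∈ {L | L ≠ M}, D.levelArity S (D.emb M p) L := by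
  have := hG.finite
  obtain ⟨o, hi, p', hd⟩ := ha
  obtain ⟨L₀, h1, rfl, h3⟩ := hG.child M o o.2
  obtain ⟨o', b1, b2⟩ := hG.cont_eq L₀ h1
  obtain rfl : o = o' := Subtype.ext (Option.some_injective _ (h3.symm.trans b1))
  -- All the siblings of this `L` contribute the same positive amount, and there are `k ^ D.exp L ≥
  -- k` of them, none being the owner since their rank is larger.
  obtain ⟨L, a1, a2, a3, a4, a5⟩ := hG.exists_outerArity_pos (i := i) h1 (Or.inr (by rwa
    [← b2])) h3 hd rfl
  have hrank := hG.rank_par L₀ h1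
  have hne : ∀ L', D.exp L' = D.exp L → L' ≠ D.par L₀ := by
    rintro L' hL' rfl
    have := (hG.sib a1 hL'.symm).2.2.2.2
    omega
  refine le_trans ?_ (finsum_mem_le_of_subset (s := {L' | D.exp L' = D.exp L})
    (fun L' hL' => hne L' hL') (Set.toFinite _) _)
  have hcongr : ∑ᶠ L' ∈ {L' | D.exp L' = D.exp L}, D.levelArity S (D.emb (D.par L₀) p) L' =
      ∑ᶠ L' ∈ {L' | D.exp L' = D.exp L}, D.levelArity S (D.emb (D.par L₀) p) L :=
    finsum_mem_congr rfl fun L' hL' => hT.levelArity_sib hG hp hL' (hne L' hL').symm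
      (hne L rfl).symm
  have hpos : 0 < D.levelArity S (D.emb (D.par L₀) p) L := by
    rw [(hT.levelArity_outer hG a1 a2 hp (hne L rfl).symm).1 a4]
    exact a5
  rw [hcongr, finsum_mem_const, hG.exp_card L]
  have h2 := hG.exp_pos L a1
  calc k = k ^ 1 := (pow_one k).symm
    _ ≤ k ^ D.exp L := Nat.pow_le_pow_right (by omega) h2
    _ ≤ _ := Nat.le_mul_of_pos_right _ hpos

end Describes
end LevelData
end Net
end MELL

/-! ### Exponents, critical ports and the `!`-port. -/

namespace MELL
namespace Net

variable {α β : Type u}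

namespace LevelData

variable {R : Net α α} {k i : ℕ} {e : R.PseudoExp} {D : LevelData R} {S : Net α R.Name}

/-- An exponent is the same thing as a pair of a level and a box of its content: siblings share the
pair, and distinct pairs have distinct exponents. Choosing a child for each pair gives the count. -/
theorem Good.ncard_boxes (hG : D.Good k e) (i : ℕ) :
    {j | ∃ L, L ≠ D.root ∧ D.exp L = j ∧ i ≤ (D.cont L).depth}.ncard =
      ∑ᶠ L, {o : (D.cont L).boxes | i ≤ ((D.cont L).content o).depth}.ncard := by
  have := hG.finite
  have hfin : ∀ L, Finite (D.cont L).boxes := fun L => (hG.circ L).pre.finite_boxes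
  choose c hc1 hc2 hc3 using hG.child
  have hc4 : ∀ L (o : (D.cont L).boxes), (D.cont L).content o = D.cont (c L o o.2) := by
    intro L o
    obtain ⟨o', h1, h2⟩ := hG.cont_eq (c L o o.2) (hc1 _ _ _)
    rw [← h2]
    have h3 := hc3 L o o.2
    rw [h3, Option.some.injEq] at h1
    clear h2 h3
    have h4 := hc2 L o o.2
    revert o'
    rw [h4]
    intro o' h1
    rw [Subtype.ext h1]
  have himg : ∀ L, {o : (D.cont L).boxes | i ≤ ((D.cont L).content o).depth}.ncard =
      ((fun o : (D.cont L).boxes => D.exp (c L o o.2)) ''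
        {o : (D.cont L).boxes | i ≤ ((D.cont L).content o).depth}).ncard := by
    intro L
    rw [Set.ncard_image_of_injective]
    intro o o' h
    have := (hG.exp_inj _ _ (hc1 L o o.2) h).2.2
    rw [hc3, hc3] at this
    exact Subtype.ext (Option.some_injective _ this)
  rw [finsum_congr himg, ← Set.ncard_iUnion_of_finite]
  · congr 1
    ext j
    simp only [Set.mem_ofPred_eq, Set.mem_iUnion]
    constructor
    · rintro ⟨L, hL, rfl, hi⟩
      obtain ⟨o, h1, h2⟩ := hG.cont_eq L hL
      refine ⟨D.par L, o, by rw [Set.mem_ofPred_eq, h2]; exact hi, ?_⟩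
      refine hG.exp_eq _ _ (hc1 _ _ _) hL ?_ ?_
      · rw [hc2]
      · rw [hc3, h1]
    · rintro ⟨L, o, ho, rfl⟩
      refine ⟨_, hc1 L o o.2, rfl, ?_⟩
      rw [← hc4]
      exact ho
  · exact fun L => Set.toFinite _
  · intro L L' hne
    refine Set.disjoint_left.2 ?_
    rintro _ ⟨o, -, rfl⟩ ⟨o', -, h⟩
    have := (hG.exp_inj _ _ (hc1 L' o' o'.2) h).2.1
    rw [hc2, hc2] at this
    exact hne this.symm

/-- In the inductive step the cardinality is a sum over levels of the number of boxes with content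
of depth at least `i`. Its digit at the exponent of a level is that number, which is nonzero exactly
if the level has depth at least `i + 1`. -/
theorem Good.mem_expM_iff (hG : D.Good k e) (hk : 1 < k) (i j : ℕ) :
    j ∈ expM k R e i ↔ ∃ L, L ≠ D.root ∧ D.exp L = j ∧ i ≤ (D.cont L).depth := by
  induction i generalizing j with
  | zero => simpa using hG.mem_expM j
  | succ i ih =>
    have hfin : ∀ L, Finite (D.cont L).boxes := fun L => (hG.circ L).pre.finite_boxes
    have hset : expM k R e i = {j | ∃ L, L ≠ D.root ∧ D.exp L = j ∧ i ≤ (D.cont L).depth} :=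
      Set.ext ih
    set m : D.Lv → ℕ := fun L =>
      {o : (D.cont L).boxes | i ≤ ((D.cont L).content o).depth}.ncard with hm
    obtain ⟨h1, h2⟩ := hG.digit_finsum hk m
      (fun L => by
        refine lt_of_le_of_lt ?_ (hG.boxes_lt L)
        rw [← Nat.card_coe_set_eq (D.cont L).boxes, ← Set.ncard_univ]
        exact Set.ncard_le_ncard (Set.subset_univ _))
      -- No class is exceptional here, and the root can serve as the distinguished level because it
      -- is alone in its class.
      D.root
      (fun L h hL => by
        have := hG.exp_pos L hL
        rw [h, hG.exp_root] at this
        exact absurd this (lt_irrefl 0))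
      (fun h => (h rfl).elim)
      (fun L L' h hL => by
        have hL : L ≠ D.root := by rintro rfl; exact hL rfl
        simp only [hm]
        rw [(hG.sib hL h).2.2.2.1])
    have hstep : j ∈ expM k R e (i + 1) ↔ 0 < j ∧ digit k (∑ᶠ L, m L) j ≠ 0 := by
      rw [← hG.ncard_boxes i, ← hset]
      exact Iff.rfl
    rw [hstep]
    have hpos : ∀ L, m L ≠ 0 ↔ i + 1 ≤ (D.cont L).depth := by
      intro L
      rw [Nat.succ_le_iff, lt_depth_iff (hG.circ L).pre, hm]
      simp only
      rw [← Nat.pos_iff_ne_zero, Set.ncard_pos]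
      rfl
    constructor
    · rintro ⟨hj, hd⟩
      have : ∃ L, D.exp L = j := by
        by_contra hn
        push Not at hn
        exact hd (h2 j hj (Or.inr hn))
      obtain ⟨L, rfl⟩ := this
      have hL : L ≠ D.root := by rintro rfl; rw [hG.exp_root] at hj; omega
      refine ⟨L, hL, rfl, ?_⟩
      rwa [h1 L hL (by rw [hG.exp_root]; omega), hpos] at hd
    · rintro ⟨L, hL, rfl, hi⟩
      have := hG.exp_pos L hL
      refine ⟨this, ?_⟩
      rwa [h1 L hL (by rw [hG.exp_root]; omega), hpos]

/-- The doors of the box of which `L` is a copy of the content. -/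
def doors (D : LevelData R) (L : D.Lv) : Set R.Name :=
  {x | ∃ o : (D.cont (D.par L)).boxes, D.box L = some ↑o ∧ ∃ q p,
    (D.cont (D.par L)).door o q = some p ∧ D.emb (D.par L) p = x}

namespace Describes

theorem exp_of_door (hT : D.Describes i S) (hG : D.Good k e) {L : D.Lv} (hr : L ≠ D.root)
    (hL : D.Active i L) {x : R.Name} (hx : x ∈ D.doors L) : x ∈ S.ground.expPorts ∧
    ∃ M p, D.Active i M ∧ D.Own M p ∧ D.emb M p = x ∧ D.Anc M (D.par L) ∧
      p ∈ (D.cont (D.par L)).ports ∧ D.emb (D.par L) p = x ∧ D.Attached i M p ∧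
      (∃ (o : (D.cont (D.par L)).boxes) (q : α), D.box L = some ↑o ∧
      (D.cont (D.par L)).door o q = some p) := by
  obtain ⟨o, ho, q, p, hd, rfl⟩ := hx
  have hp := (hG.circ _).pre.door_ports hd
  obtain ⟨M, h1, h2, h3, h4, -⟩ := hG.exists_own (hG.active_par hr hL) hp
  have ha := (hG.attached_of_door hL hr ho hd h2 h3.symm).2
  refine ⟨?_, M, p, h1, h2, h3, h4, hp, rfl, ha, o, q, ho, hd⟩
  have hl := hT.label M p h1 h2
  have hpt := hT.emb_port hG h1 h2.1
  rw [← h3]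
  rcases hG.attached_label ha with h | h | h
  · exact Or.inl (Or.inl ⟨hpt, hl.trans h⟩)
  · exact Or.inl (Or.inr ⟨hpt, hl.trans h⟩)
  · exact Or.inr ⟨hpt, hl.trans h⟩

/-- The ports that are critical for the exponent of `L` are the doors of its box, if all the boxes
in `L` are kept. -/
theorem critical_eq (hT : D.Describes i S) (hG : D.Good k e) (hk : 1 < k) {L : D.Lv}
    (hr : L ≠ D.root) (hi : (D.cont L).depth = i) : S.critical k (D.exp L) = D.doors L := by
  have hL : D.Active i L := Or.inr hi.ge
  ext x
  constructor
  · rintro ⟨hx, hd⟩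
    have hx' : x ∈ S.ports := by rcases hx with (h | h) | h <;> exact h.1
    obtain ⟨M, p, hM, hp, rfl⟩ := (hT.ports x).1 hx'
    obtain ⟨h1, h2⟩ := hT.digit_arity hG hk hp
    have hne : D.exp L ≠ D.exp M := fun h => hd (h2 _ (hG.exp_pos L hr) (Or.inl h))
    rw [h1 L hr hne] at hd
    obtain ⟨-, rfl | ⟨-, -, h3, h4⟩⟩ := hT.levelArity_ne_zero hG hp hd
    · exact (hne rfl).elim
    · obtain ⟨o, q, h5, h6⟩ := hG.exists_door_of_outerArity hr h4
      exact ⟨o, h5, q, p, h6, h3⟩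
  · intro hx
    obtain ⟨h1, M, p, hM, hp, rfl, h2, h3, h4, h5, o, q, h6, h7⟩ := hT.exp_of_door hG hr hL hx
    refine ⟨h1, ?_⟩
    have hrank := h2.rank_le
    have hrank' := hG.rank_par L hr
    have hML : M ≠ L := by rintro rfl; omega
    have hne : D.exp L ≠ D.exp M := fun h => by
      have := (hG.sib hr h).2.2.2.2
      omega
    rw [(hT.digit_arity hG hk hp).1 L hr hne, (hT.levelArity_outer hG hr hL hp hML).1 h4]
    refine Nat.ne_of_gt ?_
    obtain ⟨o', b1, b2⟩ := hG.cont_eq L hr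
    obtain rfl : o = o' := Subtype.ext (Option.some_injective _ (h6.symm.trans b1))
    have hq : q ∈ (D.cont L).conclusions := by
      rw [← b2]; exact ((hG.circ _).pre.door_dom o q).2 (by simp [h7])
    by_cases hc : q ∈ (D.cont L).circs
    · obtain rfl : q = p := Option.some_injective _ ((hG.door_circ hr hc h6).2.1.symm.trans h7)
      refine Nat.add_pos_right _ ?_
      rw [if_pos hc]
      -- Here the depth has to be exactly `i`: the box that covers the `∘`-conclusion is then kept,
      -- so it contributes in `L` itself and not in a deeper level.
      obtain ⟨o', q', hq'⟩ := (hG.circ L).circ_covered q hc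
      exact keptArity_pos hG (by rw [← hi]; exact depth_content_lt (hG.circ L).pre o') hq'
    · refine Nat.add_pos_left ?_ _
      rw [Set.ncard_pos ((hG.circ L).pre.finite_notCircs.subset fun q hq => hq.1)]
      exact ⟨q, ⟨hq, hc⟩, o, h6, h7⟩

/-- The arity of an expanded box. -/
theorem arity_box (hT : D.Describes i S) (hG : D.Good k e) {L : D.Lv} (hr : L ≠ D.root)
    (hL : D.Active i L) (o : (D.cont (D.par L)).boxes) (ho : D.box L = some ↑o) :
    S.arity (D.emb (D.par L) ↑o) =
      {q | (D.cont (D.par L)).door o q = some ↑o}.ncard * k ^ D.exp L ∧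
    0 < {q | (D.cont (D.par L)).door o q = some ↑o}.ncard ∧
    D.levelArity S (D.emb (D.par L) ↑o) L = {q | (D.cont (D.par L)).door o q = some ↑o}.ncard := by
  have := hG.finite
  obtain ⟨o', b1, b2⟩ := hG.cont_eq L hr
  obtain rfl : o = o' := Subtype.ext (Option.some_injective _ (ho.symm.trans b1))
  have hp := hG.own_box o
  have hP := hG.active_par hr hL
  have hpre := (hG.circ (D.par L)).pre
  have hbang := (hpre.boxes_sub o o.2).1
  have hrank := hG.rank_par L hr
  have hML : ∀ L', D.exp L' = D.exp L → D.par L ≠ L' := by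
    rintro L' h rfl
    have := (hG.sib hr h.symm).2.2.2.2
    omega
  have hnotcirc : ∀ q, (D.cont (D.par L)).door o q = some ↑o → q ∈ (D.cont L).notCircs := by
    intro q hq
    rw [← b2]
    refine ⟨(hpre.door_dom o q).2 (by simp [hq]), fun hc => ?_⟩
    exact hpre.door_circ o q hc _ hq hbang
  have hcirc : (↑o : α) ∉ (D.cont L).circs := by
    intro hc
    obtain ⟨-, -, -, -, h | h⟩ := hG.door_circ hr hc ho
    · simpa using hbang.2.symm.trans h
    · simpa using hbang.2.symm.trans h
  have hl : D.levelArity S (D.emb (D.par L) ↑o) L =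
      {q | (D.cont (D.par L)).door o q = some ↑o}.ncard := by
    rw [(hT.levelArity_outer hG hr hL hp (hML L rfl)).1 rfl, outerArity, if_neg hcirc, add_zero]
    congr 1
    ext q
    constructor
    · rintro ⟨-, o', h1, h2⟩
      obtain rfl : o = o' := Subtype.ext (Option.some_injective _ (ho.symm.trans h1))
      exact h2
    · intro h
      exact ⟨hnotcirc q h, o, ho, h⟩
  refine ⟨?_, ?_, hl⟩
  · rw [finsum_levelArity hG (hT.isDiffPS hG).1]
    -- The owner contributes nothing, since a `!`-port has no premise there and is a door of no box
    -- but its own, which is expanded. A level above contributes only if it copies the content of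
    -- that very box, that is, if it is a sibling of `L`.
    have hzero : ∀ L', D.exp L' ≠ D.exp L → D.levelArity S (D.emb (D.par L) ↑o) L' = 0 := by
      intro L' hL'
      by_contra h
      obtain ⟨hA, rfl | ⟨h1, -, h2, h3⟩⟩ := hT.levelArity_ne_zero hG hp h
      · have h1 : {w | w ∈ S.ground.premises (D.emb (D.par L) ↑o) ∧ D.lv w = D.par L} = ∅ := by
          refine Set.eq_empty_of_forall_notMem ?_
          rintro w ⟨⟨-, hw⟩, hlw⟩
          obtain ⟨N, q, p', hN, hq, rfl, ⟨h1, h2, h3, h4⟩ | ⟨h1, h2, o', h3, h4, h5, h6⟩⟩ :=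
            hT.target_cases hG hw
          · obtain ⟨rfl, rfl⟩ := hG.emb_inj _ _ _ _ hp h3 h4
            exact ((hG.circ _).no_premise q _ h2).1 hbang
          · rw [hG.lv_emb hq] at hlw
            have := (hG.own_emb (hG.active_par h1 hN) ((hG.circ _).pre.door_ports h5) hp
              h6.symm).2.2.rank_le
            have := hG.rank_par N h1
            have := congrArg D.rank hlw
            omega
        rw [levelArity, h1, hT.finsum_boxes hG _ _ hP] at h
        rw [finsum_mem_congr rfl (g := fun _ => 0)] at h
        · simp at h
        · intro o' ho'
          by_contra h4
          obtain ⟨q, hq⟩ := exists_of_contentArity_ne_zero h4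
          obtain ⟨h5, -⟩ := (hG.emb_door_iff hP hp o' q).1 hq
          rcases hpre.door_mem o' q _ h5 with h6 | h6 | h6
          · obtain rfl : o = o' := Subtype.ext h6
            have hlt : ((D.cont (D.par L)).content o).depth < i := ho'
            have := hL.depth hr
            rw [b2] at hlt
            omega
          · simpa using hbang.2.symm.trans h6.2
          · simpa using hbang.2.symm.trans h6.2
      · obtain ⟨o', q, h4, h5⟩ := hG.exists_door_of_outerArity h1 h3
        have h6 := hG.attached_of_door hA h1 h4 h5 hp h2
        have h7 := (hG.own_emb (hG.active_par h1 hA) ((hG.circ _).pre.door_ports h5) hp h2).2.1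
        have hpar : D.par L' = D.par L := by
          rcases h7 with h7 | ⟨h7, h8, -⟩
          · exact h7
          · exfalso
            obtain ⟨o₁, h9, -⟩ := hG.cont_eq _ h7
            obtain ⟨-, -, -, -, -⟩ := hG.door_circ h7 h8 h9
            have h10 := hT.label _ _ hP hp
            rw [hbang.2, ← h2, hG.emb_circ _ _ h7 h8] at h10
            obtain ⟨b1, b2, b3, b4, b5⟩ := hG.door_circ h7 h8 h9
            rcases hT.emb_label hG (hG.active_par h7 (hG.active_par h1 hA)) b3 with b | ⟨-, b | b⟩
            · rcases b5 with b5 | b5 <;> simp [h10, b5] at b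
            · simp [h10] at b
            · simp [h10] at b
        rcases (hG.circ _).pre.door_mem o' q _ h5 with h8 | h8 | h8
        · refine hL' (hG.exp_eq _ _ h1 hr hpar ?_)
          rw [h4, ho, ← h8]
        · rw [hpar] at h8
          simpa using hbang.2.symm.trans h8.2
        · rw [hpar] at h8
          simpa using hbang.2.symm.trans h8.2
    have h1 : ∑ᶠ L', D.levelArity S (D.emb (D.par L) ↑o) L' =
        ∑ᶠ L' ∈ {L' | D.exp L' = D.exp L}, D.levelArity S (D.emb (D.par L) ↑o) L := by
      rw [← finsum_mem_univ, ← finsum_mem_add_sdiff (Set.subset_univ {L' | D.exp L' = D.exp L})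
        (Set.toFinite _)]
      have h2 : ∑ᶠ L' ∈ Set.univ \ {L' | D.exp L' = D.exp L},
          D.levelArity S (D.emb (D.par L) ↑o) L' = 0 :=
        (finsum_mem_congr rfl fun L' hL' => hzero L' hL'.2).trans (by simp)
      rw [h2, add_zero]
      exact finsum_mem_congr rfl fun L' hL' => hT.levelArity_sib hG hp hL' (hML L' hL') (hML L rfl)
    rw [h1, hl, finsum_mem_const, hG.exp_card L, mul_comm]
  · obtain ⟨q, hq⟩ := hpre.door_main o
    exact (Set.ncard_pos ((hG.circ L).pre.finite_notCircs.subset hnotcirc)).2 ⟨q, hq⟩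

/-- An arity `c * k ^ j` with `0 < c < k` has digit `c` at `j`, so such a port is critical, hence a
door of the box; and the only door labelled `!` is the box. Conversely, `c` is a contribution of one
level, hence less than `k`. -/
theorem isBang_iff (hT : D.Describes i S) (hG : D.Good k e) (hk : 1 < k) {L : D.Lv} (hr
    : L ≠ D.root)
    (hi : (D.cont L).depth = i) (o : (D.cont (D.par L)).boxes) (ho : D.box L = some ↑o)
    (x : R.Name) : S.IsBang k (D.exp L) x ↔ x = D.emb (D.par L) ↑o := by
  have hL : D.Active i L := Or.inr hi.ge
  obtain ⟨o', b1, b2⟩ := hG.cont_eq L hr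
  obtain rfl : o = o' := Subtype.ext (Option.some_injective _ (ho.symm.trans b1))
  have hpre := (hG.circ (D.par L)).pre
  have hP := hG.active_par hr hL
  have hp := hG.own_box o
  have hbang := (hpre.boxes_sub o o.2).1
  constructor
  · rintro ⟨h1, h2, c, h3, h4, h5⟩
    have hx : x ∈ S.critical k (D.exp L) := by
      refine ⟨Or.inl (Or.inl h1), ?_⟩
      rw [h5, digit_eq hk, Nat.mul_div_cancel _ (Nat.pow_pos (by omega)), Nat.mod_eq_of_lt h4]
      omega
    rw [hT.critical_eq hG hk hr hi] at hx
    obtain ⟨o', h6, q, p, h7, rfl⟩ := hx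
    obtain rfl : o = o' := Subtype.ext (Option.some_injective _ (ho.symm.trans h6))
    rcases hpre.door_mem o q p h7 with rfl | h8 | h8
    · rfl
    · rcases hT.emb_label hG hP h8.1 with h9 | ⟨-, h9 | h9⟩
      · rw [h1.2, h8.2] at h9; simp at h9
      · rw [h1.2] at h9; simp at h9
      · rw [h1.2] at h9; simp at h9
    · rcases hT.emb_label hG hP h8.1 with h9 | ⟨-, h9 | h9⟩
      · rw [h1.2, h8.2] at h9; simp at h9
      · rw [h1.2] at h9; simp at h9
      · rw [h1.2] at h9; simp at h9
  · rintro rfl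
    obtain ⟨h1, h2, h3⟩ := hT.arity_box hG hr hL o ho
    refine ⟨⟨hT.emb_port hG hP hp.1, (hT.label _ _ hP hp).trans hbang.2⟩, ?_, _, h2, ?_, h1⟩
    · intro hb
      obtain ⟨M, o', hM, hd, he⟩ := (hT.boxes _).1 hb
      obtain ⟨rfl, h⟩ := hG.emb_inj _ _ _ _ (hG.own_box o') hp he
      obtain rfl : o' = o := Subtype.ext h
      rw [b2] at hd
      omega
    · rw [← h3]
      exact hT.levelArity_lt hG (by omega) hp

end Describes
end LevelData
end Net
end MELL

/-! ### Components as sets of ports. -/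

namespace MELL
namespace Net

variable {α β : Type u}

open Classical in
/-- The only possible net on the set `P` of ports that is a component of `S` above `Q`. -/
noncomputable def restrict (S : Net α β) (Q P : Set β) : Net α β :=
  .mk
    { wires := {w | w ∈ S.ground.wires ∧ w ∈ P ∧ w ∉ Q ∧ ∃ q ∈ P, S.ground.target w = some q}
      ports := P
      label := fun p => if p ∈ P then S.ground.label p else none
      target := fun w =>
        if w ∈ S.ground.wires ∧ w ∈ P ∧ w ∉ Q ∧ ∃ q ∈ P, S.ground.target w = some q then
          S.ground.target w else none
      left := S.ground.left ∩
        {w | w ∈ S.ground.wires ∧ ∃ q, (q ∈ P ∧ q ∈ S.ground.multPorts) ∧ S.ground.target w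
          = some q}
      ty := fun p => if p ∈ P then S.ground.ty p else none }
    (S.boxes ∩ P) (fun o => S.content ⟨o, o.2.1⟩) (fun o => S.door ⟨o, o.2.1⟩)

section restrict

variable {S : Net α β} {Q P : Set β}

theorem restrict_label {p : β} (hp : p ∈ P) :
    (S.restrict Q P).ground.label p = S.ground.label p := if_pos hp

theorem restrict_ty {p : β} (hp : p ∈ P) :
    (S.restrict Q P).ground.ty p = S.ground.ty p := if_pos hp

theorem restrict_target {w : β} (hw : w ∈ (S.restrict Q P).ground.wires) :
    (S.restrict Q P).ground.target w = S.ground.target w := if_pos hw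

theorem restrict_target_some {w q : β} (h : (S.restrict Q P).ground.target w = some q) :
    w ∈ (S.restrict Q P).ground.wires ∧ S.ground.target w = some q ∧ q ∈ P := by
  by_cases hw : w ∈ (S.restrict Q P).ground.wires
  · rw [restrict_target hw] at h
    obtain ⟨q', hq', h'⟩ := hw.2.2.2
    obtain rfl := Option.some_injective _ (h.symm.trans h')
    exact ⟨hw, h, hq'⟩
  · have : (S.restrict Q P).ground.target w = none := if_neg hw
    simp [this] at h

theorem mem_restrict_portsOf {p : β} {l : Label} (hP : P ⊆ S.ports) :
    p ∈ (S.restrict Q P).ground.portsOf l ↔ p ∈ P ∧ p ∈ S.ground.portsOf l := by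
  constructor
  · rintro ⟨h1, h2⟩
    have h1 : p ∈ P := h1
    exact ⟨h1, hP h1, by rwa [restrict_label h1] at h2⟩
  · rintro ⟨h1, h2⟩
    exact ⟨h1, by rw [restrict_label h1]; exact h2.2⟩

theorem mem_restrict_multPorts {p : β} (hP : P ⊆ S.ports) :
    p ∈ (S.restrict Q P).ground.multPorts ↔ p ∈ P ∧ p ∈ S.ground.multPorts := by
  simp only [Ground.multPorts, Set.mem_union, mem_restrict_portsOf hP]
  tauto

theorem mem_restrict_premises {w p : β} : w ∈ (S.restrict Q P).ground.premises p ↔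
    w ∈ S.ground.premises p ∧ w ∈ P ∧ w ∉ Q ∧ p ∈ P := by
  constructor
  · rintro ⟨-, h⟩
    obtain ⟨h1, h2, h3⟩ := restrict_target_some h
    exact ⟨⟨h1.1, h2⟩, h1.2.1, h1.2.2.1, h3⟩
  · rintro ⟨⟨h1, h2⟩, h3, h4, h5⟩
    have hw : w ∈ (S.restrict Q P).ground.wires := ⟨h1, h3, h4, p, h5, h2⟩
    exact ⟨hw, by rw [restrict_target hw, h2]⟩

end restrict

theorem Coh.symm {S : Net α β} {p q : β} (h : S.Coh p q) : S.Coh q p := by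
  rcases h with h | h | ⟨o, h, h'⟩
  · exact Or.inr (Or.inl h)
  · exact Or.inl h
  · exact Or.inr (Or.inr ⟨o, h', h⟩)

/-- On its ports the data of `T` are dictated by `S`, and outside their domains the partial
functions are `none`. This literal equality allows components to be counted as sets of ports. -/
theorem IsSub.eq_restrict {S T : Net α β} {Q : Set β} (h : IsSub Q T S) :
    T = S.restrict Q T.ports := by
  obtain ⟨hd, -, hsub, hw, hl, ht, hleft, hty, hb, hc, hdr⟩ := h
  have hg := hd.1.ground
  obtain ⟨⟨wires, ports, label, target, left, ty⟩, bx, ct, dr⟩ := T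
  have hlabel : label = ((Net.mk (α := α) ⟨wires, ports, label, target, left, ty⟩ bx ct
    dr).ground.label) :=
    rfl
  have hlab : label = fun p => open Classical in if p ∈ ports then S.ground.label p else none := by
    funext p
    split_ifs with hp
    · exact hl p hp
    · by_contra hn
      exact hp ((hg.label_dom p).2 hn)
  have htyp : ty = fun p => open Classical in if p ∈ ports then S.ground.ty p else none := by
    funext p
    split_ifs with hp
    · exact hty p hp
    · by_contra hn
      exact hp ((hg.ty_dom p).2 hn)
  have hwires : wires = {w | w ∈ S.ground.wires ∧ w ∈ ports ∧ w ∉ Q ∧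
      ∃ q ∈ ports, S.ground.target w = some q} := hw
  have htar : target = fun w => open Classical in
      if w ∈ S.ground.wires ∧ w ∈ ports ∧ w ∉ Q ∧ ∃ q ∈ ports, S.ground.target w = some q then
          S.ground.target w else none := by
    funext w
    split_ifs with hwm
    · exact ht w (by rw [hw]; exact hwm)
    · by_contra hn
      have := (hg.target_dom w).2 hn
      rw [hw] at this
      exact hwm this
  have hlft : left = S.ground.left ∩
        {w | w ∈ S.ground.wires ∧ ∃ q, (q ∈ ports ∧ q ∈ S.ground.multPorts) ∧
          S.ground.target w = some q} := by
    refine Eq.trans hleft ?_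
    ext w
    refine and_congr_right fun _ => and_congr_right fun _ => exists_congr fun q =>
      and_congr_left fun hq => ?_
    have hiff : ∀ l, q ∈ ports → (label q = some l ↔ S.ground.label q = some l) := fun l hqp => by
      rw [show label q = S.ground.label q from hl q hqp]
    constructor
    · rintro (⟨h1, h2⟩ | ⟨h1, h2⟩)
      · exact ⟨h1, Or.inl ⟨hsub h1, (hiff _ h1).1 h2⟩⟩
      · exact ⟨h1, Or.inr ⟨hsub h1, (hiff _ h1).1 h2⟩⟩
    · rintro ⟨h1, ⟨h2, h3⟩ | ⟨h2, h3⟩⟩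
      · exact Or.inl ⟨h1, (hiff _ h1).2 h3⟩
      · exact Or.inr ⟨h1, (hiff _ h1).2 h3⟩
  have hbx : bx = S.boxes ∩ ports := hb
  subst hbx
  have hct : ct = fun o : ↥(S.boxes ∩ ports) => S.content ⟨o.1, o.2.1⟩ :=
    funext fun o => hc o ⟨o.1, o.2.1⟩ rfl
  have hdr' : dr = fun o : ↥(S.boxes ∩ ports) => S.door ⟨o.1, o.2.1⟩ :=
    funext fun o => hdr o ⟨o.1, o.2.1⟩ rfl
  subst hct
  clear hdr
  subst hdr'
  clear hl ht hty hc hd hg hw hlabel hleft hsub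
  change _ = Net.restrict S Q ports
  unfold restrict
  rw [← hlab, ← htyp, ← hwires, ← htar, ← hlft]

/-- `P` is the set of the ports of a component of `S` above `Q`, of any cosize. -/
structure IsComponent (S : Net α β) (Q P : Set β) : Prop where
  sub : P ⊆ S.ports
  closed : ∀ x ∈ P, x ∉ Q → ∀ y ∈ S.ports, S.Coh x y → y ∈ P
  conn : ∀ x ∈ P, x ∉ Q → ∀ y ∈ P, y ∉ Q →
    Relation.ReflTransGen (fun a b => S.Coh a b ∧ b ∈ P ∧ b ∉ Q) x y
  bound : ∀ q ∈ P, q ∈ Q → ∃ y ∈ P, y ∉ Q ∧ S.Coh q y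
  nonempty : ∃ x ∈ P, x ∉ Q
  wires : ∀ x ∈ P, x ∉ Q → x ∈ S.ground.wires
  mult : ∀ x ∈ P, x ∈ S.ground.multPorts → ∀ w ∈ S.ground.premises x, w ∉ Q

theorem exists_seq_of_reflTransGen {γ : Type*} {r : γ → γ → Prop} {x y : γ}
    (h : Relation.ReflTransGen r x y) :
    ∃ (n : ℕ) (s : ℕ → γ), s 0 = x ∧ s n = y ∧ ∀ j < n, r (s j) (s (j + 1)) := by
  induction h using Relation.ReflTransGen.head_induction_on with
  | refl => exact ⟨0, fun _ => y, rfl, rfl, fun j hj => by omega⟩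
  | @head a b hab _ ih =>
    obtain ⟨n, s, h0, hn, hs⟩ := ih
    refine ⟨n + 1, fun j => Nat.casesOn j a s, rfl, hn, ?_⟩
    rintro (_ | j) hj
    · show r a (s 0)
      rwa [h0]
    · exact hs j (by omega)

section IsComponent

variable {S : Net α β} {Q P : Set β}

theorem multPorts_not_expPorts {S : Net α β} {x : β} (h : x ∈ S.ground.multPorts) :
    x ∉ S.ground.expPorts := by
  rintro ((h' | h') | h') <;> rcases h with h | h <;> simpa using h.2.symm.trans h'.2

theorem IsComponent.premises_mult (hS : S.IsDiffPS) (hQ : Q ⊆ S.ground.expPorts)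
    (h : IsComponent S Q P) {x : β} (hx : x ∈ P) (hm : x ∈ S.ground.multPorts) :
    (S.restrict Q P).ground.premises x = S.ground.premises x := by
  ext w
  rw [mem_restrict_premises]
  refine ⟨fun h => h.1, fun hw => ⟨hw, ?_, h.mult x hx hm w hw, hx⟩⟩
  exact h.closed x hx (fun hq => multPorts_not_expPorts hm (hQ hq)) w
    (hS.1.ground.wires_sub w hw.1).1 (Or.inr (Or.inl hw))

/-- Only two conditions are not inherited at once. Multiplicative ports keep both premises by
closure and by the field `mult`; the doors of a box of `P` lie in `P` because the box is not in `Q`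
and is adjacent to them. -/
theorem IsComponent.isDiffPS (hS : S.IsDiffPS) (hQ : Q ⊆ S.ground.expPorts)
    (hQb : ∀ x ∈ Q, x ∉ S.boxes) (h : IsComponent S Q P) : (S.restrict Q P).IsDiffPS := by
  have hg := hS.1.ground
  have hwire : ∀ {w}, w ∈ (S.restrict Q P).ground.wires → w ∈ P := fun hw => hw.2.1
  have hprem : ∀ {w x}, w ∈ (S.restrict Q P).ground.premises x → w ∈ S.ground.premises x :=
    fun hw => (mem_restrict_premises.1 hw).1
  have hpremP : ∀ {w x}, w ∈ (S.restrict Q P).ground.premises x → w ∈ P :=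
    fun hw => (mem_restrict_premises.1 hw).2.1
  have hmleft : ∀ {x}, x ∈ P → x ∈ S.ground.multPorts → ∀ w ∈ S.ground.premises x,
      (w ∈ (S.restrict Q P).ground.left ↔ w ∈ S.ground.left) := fun {x} hx hm w hw =>
    ⟨fun hl => hl.1, fun hl => ⟨hl, hw.1, x, ⟨hx, hm⟩, hw.2⟩⟩
  refine ⟨{ ground := { finite_ports := hg.finite_ports.subset h.sub
                        label_dom := ?_, ty_dom := ?_, wires_sub := ?_, target_dom := ?_
                        target_mem := ?_, binary := ?_, left_sub := ?_, left_unique := ?_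
                        ty_one := ?_, ty_bot := ?_, ty_tensor := ?_, ty_par := ?_, ty_bang := ?_
                        ty_whynot := ?_ }
            boxes_sub := ?_, door_dom := fun o p => hS.1.door_dom ⟨o, o.2.1⟩ p
            door_mem := ?_, door_injOn := fun o => hS.1.door_injOn ⟨o, o.2.1⟩
            door_main := fun o => hS.1.door_main ⟨o, o.2.1⟩
            door_circ := ?_, ty_circ := ?_, ty_notCirc := ?_ },
    fun o => hS.2 ⟨o, o.2.1⟩⟩
  · intro p
    by_cases hp : p ∈ P
    · rw [restrict_label hp]
      exact ⟨fun _ => (hg.label_dom p).1 (h.sub hp), fun _ => hp⟩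
    · exact ⟨fun h => (hp h).elim, fun h => (h (if_neg hp)).elim⟩
  · intro p
    by_cases hp : p ∈ P
    · rw [restrict_ty hp]
      exact ⟨fun _ => (hg.ty_dom p).1 (h.sub hp), fun _ => hp⟩
    · exact ⟨fun h => (hp h).elim, fun h => (h (if_neg hp)).elim⟩
  · intro w hw
    refine ⟨hwire hw, ?_⟩
    rw [restrict_label (hwire hw)]
    exact (hg.wires_sub w hw.1).2
  · intro w
    constructor
    · intro hw
      rw [restrict_target hw]
      exact (hg.target_dom w).1 hw.1
    · intro hw
      obtain ⟨q, hq⟩ := Option.ne_none_iff_exists'.1 hw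
      exact (restrict_target_some hq).1
  · intro w q hq
    obtain ⟨-, h1, h2⟩ := restrict_target_some hq
    rw [restrict_label h2]
    exact ⟨h2, (hg.target_mem w q h1).2⟩
  · intro p hp
    obtain ⟨h1, h2⟩ := (mem_restrict_multPorts h.sub).1 hp
    rw [h.premises_mult hS hQ h1 h2]
    exact hg.binary p h2
  · rintro w ⟨hl, hw, q, ⟨hq1, hq2⟩, hq3⟩
    have : w ∈ (S.restrict Q P).ground.premises q := by
      rw [h.premises_mult hS hQ hq1 hq2]
      exact ⟨hw, hq3⟩
    exact ⟨this.1, q, (mem_restrict_multPorts h.sub).2 ⟨hq1, hq2⟩, this.2⟩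
  · intro p hp
    obtain ⟨h1, h2⟩ := (mem_restrict_multPorts h.sub).1 hp
    rw [h.premises_mult hS hQ h1 h2, ← hg.left_unique p h2]
    congr 1
    ext w
    exact and_congr_left fun hw => hmleft h1 h2 w hw
  · intro p hp
    obtain ⟨h1, h2⟩ := (mem_restrict_portsOf h.sub).1 hp
    rw [restrict_ty h1]
    exact hg.ty_one p h2
  · intro p hp
    obtain ⟨h1, h2⟩ := (mem_restrict_portsOf h.sub).1 hp
    rw [restrict_ty h1]
    exact hg.ty_bot p h2
  · intro p hp w₁ hw₁ w₂ hw₂ hl₁ hl₂ A B hA hB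
    obtain ⟨h1, h2⟩ := (mem_restrict_portsOf h.sub).1 hp
    rw [restrict_ty h1]
    rw [restrict_ty (hpremP hw₁)] at hA
    rw [restrict_ty (hpremP hw₂)] at hB
    rw [hmleft h1 (Or.inl h2) w₁ (hprem hw₁)] at hl₁
    rw [hmleft h1 (Or.inl h2) w₂ (hprem hw₂)] at hl₂
    exact hg.ty_tensor p h2 w₁ (hprem hw₁) w₂ (hprem hw₂) hl₁ hl₂ A B hA hB
  · intro p hp w₁ hw₁ w₂ hw₂ hl₁ hl₂ A B hA hB
    obtain ⟨h1, h2⟩ := (mem_restrict_portsOf h.sub).1 hp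
    rw [restrict_ty h1]
    rw [restrict_ty (hpremP hw₁)] at hA
    rw [restrict_ty (hpremP hw₂)] at hB
    rw [hmleft h1 (Or.inr h2) w₁ (hprem hw₁)] at hl₁
    rw [hmleft h1 (Or.inr h2) w₂ (hprem hw₂)] at hl₂
    exact hg.ty_par p h2 w₁ (hprem hw₁) w₂ (hprem hw₂) hl₁ hl₂ A B hA hB
  · intro p hp
    obtain ⟨h1, h2⟩ := (mem_restrict_portsOf h.sub).1 hp
    obtain ⟨C, hC, hw⟩ := hg.ty_bang p h2
    rw [restrict_ty h1]
    exact ⟨C, hC, fun w hw' => by rw [restrict_ty (hpremP hw')]; exact hw w (hprem hw')⟩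
  · intro p hp
    have h12 : p ∈ P ∧ p ∈ S.ground.portsOf .whynot ∪ S.ground.portsOf .circ := by
      rcases hp with hp | hp
      · obtain ⟨h1, h2⟩ := (mem_restrict_portsOf h.sub).1 hp
        exact ⟨h1, Or.inl h2⟩
      · obtain ⟨h1, h2⟩ := (mem_restrict_portsOf h.sub).1 hp
        exact ⟨h1, Or.inr h2⟩
    obtain ⟨C, hC, hw⟩ := hg.ty_whynot p h12.2
    rw [restrict_ty h12.1]
    exact ⟨C, hC, fun w hw' => by rw [restrict_ty (hpremP hw')]; exact hw w (hprem hw')⟩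
  · rintro o ⟨ho1, ho2⟩
    obtain ⟨h1, h2⟩ := hS.1.boxes_sub o ho1
    refine ⟨(mem_restrict_portsOf h.sub).2 ⟨ho2, h1⟩, Set.eq_empty_of_forall_notMem fun w hw => ?_⟩
    have := hprem hw
    rw [h2] at this
    exact this
  · rintro ⟨o, ho1, ho2⟩ p q hq
    have hq : S.door ⟨o, ho1⟩ p = some q := hq
    have hqP : q ∈ P := by
      refine h.closed o ho2 (fun hc => hQb o hc ho1) q (hS.1.door_ports hq) ?_
      exact Or.inr (Or.inr ⟨⟨o, ho1⟩, hS.1.door_main _, p, hq⟩)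
    rcases hS.1.door_mem _ p q hq with h1 | h1 | h1
    · exact Or.inl h1
    · exact Or.inr (Or.inl ((mem_restrict_portsOf h.sub).2 ⟨hqP, h1⟩))
    · exact Or.inr (Or.inr ((mem_restrict_portsOf h.sub).2 ⟨hqP, h1⟩))
  · rintro ⟨o, ho1, ho2⟩ p hp q hq hb
    exact hS.1.door_circ ⟨o, ho1⟩ p hp q hq ((mem_restrict_portsOf h.sub).1 hb).2
  · rintro ⟨o, ho1, ho2⟩ p hp q hq
    have hq : S.door ⟨o, ho1⟩ p = some q := hq
    have hqP : q ∈ P := by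
      refine h.closed o ho2 (fun hc => hQb o hc ho1) q (hS.1.door_ports hq) ?_
      exact Or.inr (Or.inr ⟨⟨o, ho1⟩, hS.1.door_main _, p, hq⟩)
    rw [restrict_ty hqP]
    exact hS.1.ty_circ ⟨o, ho1⟩ p hp q hq
  · rintro ⟨o, ho1, ho2⟩ p hp q hq
    have hq : S.door ⟨o, ho1⟩ p = some q := hq
    have hqP : q ∈ P := by
      refine h.closed o ho2 (fun hc => hQb o hc ho1) q (hS.1.door_ports hq) ?_
      exact Or.inr (Or.inr ⟨⟨o, ho1⟩, hS.1.door_main _, p, hq⟩)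
    rw [restrict_ty hqP]
    exact hS.1.ty_notCirc ⟨o, ho1⟩ p hp q hq

theorem IsComponent.mem_wires (hS : S.IsDiffPS) (h : IsComponent S Q P) {x : β} :
    x ∈ (S.restrict Q P).ground.wires ↔ x ∈ P ∧ x ∉ Q := by
  refine ⟨fun hx => ⟨hx.2.1, hx.2.2.1⟩, fun ⟨h1, h2⟩ => ?_⟩
  have hw := h.wires x h1 h2
  obtain ⟨q, hq⟩ := Option.ne_none_iff_exists'.1 ((hS.1.ground.target_dom x).1 hw)
  exact ⟨hw, h1, h2, q, h.closed x h1 h2 q (hS.1.ground.target_mem x q hq).1 (Or.inl ⟨hw, hq⟩), hq⟩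

theorem IsComponent.mem_conclusions (hS : S.IsDiffPS) (h : IsComponent S Q P) {x : β} :
    x ∈ (S.restrict Q P).conclusions ↔ x ∈ P ∧ x ∈ Q := by
  have : x ∈ (S.restrict Q P).conclusions ↔ x ∈ P ∧ x ∉ (S.restrict Q P).ground.wires := Iff.rfl
  rw [this, h.mem_wires hS]
  tauto

/-- A connecting sequence can meet `Q` only at its two ends. Connectedness therefore amounts to
connectedness outside `Q` together with a neighbour outside `Q` for each port of `Q`. -/
theorem mem_components_iff (hS : S.IsDiffPS) (hQ : Q ⊆ S.ground.expPorts)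
    (hQb : ∀ x ∈ Q, x ∉ S.boxes) {k : ℕ} {T : Net α β} :
    T ∈ S.components Q ∅ k ↔ ∃ P, IsComponent S Q P ∧ T = S.restrict Q P ∧
      (S.restrict Q P).cosize < k := by
  constructor
  · rintro ⟨⟨hsub, hconn⟩, hcs, hc, ⟨x₀, hx₀, hx₀'⟩, hcl⟩
    have hT := hsub.eq_restrict
    refine ⟨T.ports, ?_, hT, by rwa [← hT]⟩
    refine ⟨hsub.ports, ?_, ?_, ?_, ⟨x₀, hx₀, hx₀'⟩, ?_, ?_⟩
    · intro x hx hxQ y hy hxy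
      by_contra hyT
      exact hxQ (hcl x hx y hy hxy hyT)
    · intro x hx hxQ y hy hyQ
      obtain ⟨n, s, h0, hn, hs, hs'⟩ := hconn x hx y hy
      have hsQ : ∀ j ≤ n, s j ∉ Q := by
        intro j hj hjQ
        rcases hj.lt_or_eq with hj | rfl
        · obtain rfl := (hs' j hj).2 hjQ
          exact hxQ (h0 ▸ hjQ)
        · exact hyQ (hn ▸ hjQ)
      have : ∀ j ≤ n, Relation.ReflTransGen (fun a b => S.Coh a b ∧ b ∈ T.ports ∧ b ∉ Q) x
        (s j) := by
        intro j
        induction j with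
        | zero => intro _; rw [h0]
        | succ j ih =>
          intro hj
          exact (ih (by omega)).tail ⟨(hs' j (by omega)).1, hs _ hj, hsQ _ hj⟩
      rw [← hn]
      exact this n le_rfl
    · intro q hq hqQ
      obtain ⟨n, s, h0, hn, hs, hs'⟩ := hconn q hq x₀ hx₀
      have hn0 : n ≠ 0 := by
        rintro rfl
        exact hx₀' (by rw [← hn, h0]; exact hqQ)
      refine ⟨s 1, hs 1 (by omega), ?_, by rw [← h0]; exact (hs' 0 (by omega)).1⟩
      intro h1
      rcases (show 1 ≤ n by omega).lt_or_eq with h | rfl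
      · exact absurd ((hs' 1 h).2 h1) one_ne_zero
      · exact hx₀' (hn ▸ h1)
    · intro x hx hxQ
      by_contra hw
      have : x ∈ T.conclusions := ⟨hx, fun hw' => by
        rw [hsub.wires] at hw'
        exact hw hw'.1⟩
      rcases hc this with h | h
      · exact hxQ h
      · exact h
    · intro x hx hm w hw hwQ
      have hm' : x ∈ T.ground.multPorts := by
        rw [hT]
        exact (mem_restrict_multPorts hsub.ports).2 ⟨hx, hm⟩
      have hsubset : T.ground.premises x ⊆ S.ground.premises x := by
        intro v hv
        rw [hT] at hv
        exact (mem_restrict_premises.1 hv).1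
      -- Both `T` and `S` give exactly two premises to `x`, so no premise has been cut off by
      -- belonging to `Q`.
      have heq := Set.eq_of_subset_of_ncard_le hsubset (by
        rw [hsub.diff.1.ground.binary x hm', hS.1.ground.binary x hm])
        (hS.1.ground.finite_ports.subset fun v hv => (hS.1.ground.wires_sub v hv.1).1)
      rw [← heq, hT] at hw
      exact (mem_restrict_premises.1 hw).2.2.1 hwQ
  · rintro ⟨P, hP, rfl, hcs⟩
    refine ⟨⟨?_, ?_⟩, hcs, ?_, ?_, ?_⟩
    · refine ⟨hP.isDiffPS hS hQ hQb, hQ, hP.sub, rfl, fun p hp => restrict_label hp,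
        fun w hw => restrict_target hw, ?_, fun p hp => restrict_ty hp, rfl, ?_, ?_⟩
      · ext w
        refine and_congr_right fun _ => and_congr_right fun _ => exists_congr fun q =>
          and_congr_left fun hq => ?_
        rw [mem_restrict_multPorts hP.sub]
      · rintro o ⟨o', ho'⟩ rfl
        rfl
      · rintro o ⟨o', ho'⟩ rfl
        rfl
    · intro p hp p' hp'
      have hp : p ∈ P := hp
      have hp' : p' ∈ P := hp'
      have key : ∀ x ∈ P, x ∉ Q → Relation.ReflTransGen
          (fun a b => S.Coh a b ∧ a ∉ Q ∧ b ∈ P) x p' := by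
        have key' : ∀ x ∈ P, x ∉ Q → ∀ y ∈ P, y ∉ Q → Relation.ReflTransGen
            (fun a b => S.Coh a b ∧ a ∉ Q ∧ b ∈ P) x y := by
          intro x hx hxQ y hy hyQ
          have := hP.conn x hx hxQ y hy hyQ
          clear hy hyQ
          suffices H : Relation.ReflTransGen (fun a b => S.Coh a b ∧ a ∉ Q ∧ b ∈ P) x y
            ∧ y ∉ Q from H.1
          induction this with
          | refl => exact ⟨.refl, hxQ⟩
          | tail _ h ih => exact ⟨ih.1.tail ⟨h.1, ih.2, h.2.1⟩, h.2.2⟩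
        intro x hx hxQ
        by_cases hQ' : p' ∈ Q
        · obtain ⟨y, hy, hyQ, hc⟩ := hP.bound p' hp' hQ'
          exact (key' x hx hxQ y hy hyQ).tail ⟨hc.symm, hyQ, hp'⟩
        · exact key' x hx hxQ p' hp' hQ'
      by_cases hpQ : p ∈ Q
      · obtain ⟨y, hy, hyQ, hc⟩ := hP.bound p hp hpQ
        obtain ⟨n, s, h0, hn, hs⟩ := exists_seq_of_reflTransGen (key y hy hyQ)
        -- A start in `Q` is put in front of the sequence, at the index `0` where `Q` is allowed.
        refine ⟨n + 1, fun j => Nat.casesOn j p s, rfl, hn, ?_, ?_⟩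
        · rintro (_ | _ | j) hj
          · exact hp
          · show s 0 ∈ P
            rwa [h0]
          · exact (hs j (by omega)).2.2
        · rintro (_ | j) hj
          · refine ⟨?_, fun _ => rfl⟩
            show S.Coh p (s 0)
            rwa [h0]
          · exact ⟨(hs j (by omega)).1, fun h => ((hs j (by omega)).2.1 h).elim⟩
      · obtain ⟨n, s, h0, hn, hs⟩ := exists_seq_of_reflTransGen (key p hp hpQ)
        refine ⟨n, s, h0, hn, ?_, ?_⟩
        · rintro (_ | j) hj
          · rw [h0]; exact hp
          · exact (hs j (by omega)).2.2
        · intro j hj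
          exact ⟨(hs j hj).1, fun h => ((hs j hj).2.1 h).elim⟩
    · intro x hx
      exact Or.inl ((hP.mem_conclusions hS).1 hx).2
    · obtain ⟨x, hx, hxQ⟩ := hP.nonempty
      exact ⟨x, hx, hxQ⟩
    · intro p hp q hq hpq hqP
      by_contra hpQ
      exact hqP (hP.closed p hp hpQ q hq hpq)

/-- Two components sharing a port outside `Q` are equal. -/
theorem IsComponent.eq_of_mem (h : IsComponent S Q P) {P' : Set β} (h' : IsComponent S Q P') {x : β}
    (hx : x ∈ P) (hx' : x ∈ P') (hQ : x ∉ Q) : P = P' := by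
  have key : ∀ {P P' : Set β}, IsComponent S Q P → IsComponent S Q P' → x ∈ P → x ∈ P' →
      P ⊆ P' := by
    intro P P' h h' hx hx' y hy
    have key' : ∀ y ∈ P, y ∉ Q → y ∈ P' := by
      intro y hy hyQ
      have := h.conn x hx hQ y hy hyQ
      clear hy hyQ
      suffices H : y ∈ P' ∧ y ∉ Q from H.1
      induction this with
      | refl => exact ⟨hx', hQ⟩
      | tail _ hc ih => exact ⟨h'.closed _ ih.1 ih.2 _ (h.sub hc.2.1) hc.1, hc.2.2⟩
    by_cases hyQ : y ∈ Q
    · obtain ⟨z, hz, hzQ, hc⟩ := h.bound y hy hyQ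
      exact h'.closed z (key' z hz hzQ) hzQ y (h.sub hy) hc.symm
    · exact key' y hy hyQ
  exact (key h h' hx hx').antisymm (key h' h hx' hx)

end IsComponent

end Net
end MELL

/-! ### Components of small cosize lie in a single level. -/

namespace MELL
namespace Net

variable {α β : Type u}

/-- `p` and `p'` are adjacent in `B`, when the boxes with content of depth `≥ i` are ignored. -/
def KeptCoh (i : ℕ) (B : Net α β) (p p' : β) : Prop :=
  (p ∈ B.ground.wires ∧ B.ground.target p = some p') ∨
  (p' ∈ B.ground.wires ∧ B.ground.target p' = some p) ∨
  ∃ o : B.boxes, (B.content o).depth < i ∧ (∃ q, B.door o q = some p) ∧ ∃ q', B.door o q' = some p'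

namespace LevelData

variable {R : Net α α} {k i : ℕ} {e : R.PseudoExp} {D : LevelData R} {S : Net α R.Name}
  {Q P : Set R.Name}

theorem levelArity_restrict (S : Net α R.Name) (Q P : Set R.Name) (x : R.Name) (L : D.Lv) :
    D.levelArity (S.restrict Q P) x L =
      {w | (w ∈ S.ground.premises x ∧ w ∈ P ∧ w ∉ Q ∧ x ∈ P) ∧ D.lv w = L}.ncard +
      ∑ᶠ b ∈ {b : S.boxes | ↑b ∈ P ∧ D.lv b = L}, contentArity (S.content b) (S.door b) x := by
  rw [levelArity]
  congr 1
  · simp only [mem_restrict_premises]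
  · have h : {b : S.boxes | ↑b ∈ P ∧ D.lv b = L} =
        (fun b : (S.restrict Q P).boxes => (⟨b.1, b.2.1⟩ : S.boxes)) '' {b | D.lv b = L} := by
      ext b
      constructor
      · rintro ⟨h1, h2⟩
        exact ⟨⟨b.1, b.2, h1⟩, h2, rfl⟩
      · rintro ⟨b', h1, rfl⟩
        exact ⟨b'.2.2, h1⟩
    rw [h, finsum_mem_image]
    · rfl
    · intro b _ b' _ h
      exact Subtype.ext (congrArg (fun b : S.boxes => (b : R.Name)) h)

theorem levelArity_restrict_le (hS : S.IsPreDifferential) (x : R.Name) (L : D.Lv) :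
    D.levelArity (S.restrict Q P) x L ≤ D.levelArity S x L := by
  have := hS.finite_boxes
  rw [levelArity_restrict]
  refine Nat.add_le_add (Set.ncard_le_ncard ?_ ?_) ?_
  · exact fun w hw => ⟨hw.1.1, hw.2⟩
  · exact hS.ground.finite_ports.subset fun w hw => (hS.ground.wires_sub w hw.1.1).1
  · exact finsum_mem_le_of_subset (fun b hb => hb.2) (Set.toFinite _) _

/-- Outside `Q` a component contains all the neighbours of its ports. Only premises lying in `Q` can
be lost, since they are conclusions of the component. -/
theorem levelArity_restrict_eq (h : IsComponent S Q P) (hS : S.IsPreDifferential) {x : R.Name}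
    (hx : x ∈ P) (hxQ : x ∉ Q) {L : D.Lv} (hL : ∀ w ∈ S.ground.premises x, D.lv w = L → w ∉ Q) :
    D.levelArity (S.restrict Q P) x L = D.levelArity S x L := by
  rw [levelArity_restrict, levelArity]
  congr 1
  · congr 1
    ext w
    constructor
    · exact fun hw => ⟨hw.1.1, hw.2⟩
    · rintro ⟨h1, h2⟩
      exact ⟨⟨h1, h.closed x hx hxQ w (hS.ground.wires_sub w h1.1).1 (Or.inr (Or.inl h1)),
        hL w h1 h2, hx⟩, h2⟩
  · refine finsum_mem_inter_support_eq _ _ _ (Set.ext fun b => and_congr_left fun hb =>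
      ⟨fun h => h.2, fun h2 => ⟨?_, h2⟩⟩)
    obtain ⟨q, hq⟩ := exists_of_contentArity_ne_zero hb
    exact h.closed x hx hxQ b (hS.boxes_sub_ports b.2)
      (Or.inr (Or.inr ⟨b, ⟨q, hq⟩, hS.door_main b⟩))

namespace Describes

theorem own_of_mem_doors (hT : D.Describes i S) (hG : D.Good k e) {L : D.Lv} (hr : L ≠ D.root)
    (hL : D.Active i L) {M : D.Lv} {p : α} (hp : D.Own M p) (h : D.emb M p ∈ D.doors L) :
    D.Attached i M p ∧ D.Anc M (D.par L) := by
  obtain ⟨-, M', p', -, hp', he, ha, -, -, hatt, -⟩ := hT.exp_of_door hG hr hL h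
  obtain ⟨rfl, rfl⟩ := hG.emb_inj _ _ _ _ hp' hp he
  exact ⟨hatt, ha⟩

theorem doors_sub (hT : D.Describes i S) (hG : D.Good k e) {L : D.Lv} (hr : L ≠ D.root)
    (hL : D.Active i L) : D.doors L ⊆ S.ground.expPorts := fun _ hx =>
      (hT.exp_of_door hG hr hL hx).1

theorem doors_not_box (hT : D.Describes i S) (hG : D.Good k e) {L : D.Lv} (hr : L ≠ D.root)
    (hL : D.Active i L) : ∀ x ∈ D.doors L, x ∉ S.boxes := by
  intro x hx hb
  obtain ⟨M, o, hM, ho, rfl⟩ := (hT.boxes x).1 hb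
  exact hG.not_attached_kept ho (hT.own_of_mem_doors hG hr hL (hG.own_box o) hx).1

/-- In a component of small cosize, the ports that are not doors are not attached. -/
theorem not_attached (hT : D.Describes i S) (hG : D.Good k e) (hk : 1 < k) {L : D.Lv}
    (hr : L ≠ D.root) (hL : D.Active i L) (h : IsComponent S (D.doors L) P)
    (hc : (S.restrict (D.doors L) P).cosize < k) {M : D.Lv} {p : α} (hp : D.Own M p)
    (hx : D.emb M p ∈ P) (hxQ : D.emb M p ∉ D.doors L) : ¬ D.Attached i M p := by
  intro ha
  have := hG.finite
  have hS := hT.isDiffPS hG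
  -- Among the attached ports of `P` outside `Q`, one whose owner has maximal rank still receives in
  -- the component all that higher levels give it, that is, at least `k`. A premise in `Q` would be
  -- an attached port of a higher level, and one of its siblings would contradict maximality.
  obtain ⟨M, ⟨p, hp, hx, hxQ, ha⟩, hmax⟩ := Set.exists_max_image
    {N : D.Lv | ∃ p, D.Own N p ∧ D.emb N p ∈ P ∧ D.emb N p ∉ D.doors L ∧ D.Attached i N p} D.rank
    (Set.toFinite _) ⟨M, p, hp, hx, hxQ, ha⟩
  have hpre := (h.isDiffPS hS (hT.doors_sub hG hr hL) (hT.doors_not_box hG hr hL)).1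
  have har := arity_lt_of_cosize hpre (by omega) hc (show D.emb M p ∈ P from hx)
  rw [finsum_levelArity hG hpre] at har
  refine absurd (lt_of_le_of_lt (finsum_mem_le_finsum {L' | L' ≠ M} _) har) (not_lt.2 ?_)
  refine (hT.le_finsum_levelArity hG hk hp ha).trans (le_of_eq ?_)
  refine finsum_mem_congr rfl fun N hN => (levelArity_restrict_eq h hS.1 hx hxQ ?_).symm
  rintro w ⟨hw, hw'⟩ hlv hwQ
  obtain ⟨N', q, p', hN', hq, rfl, ⟨h1, h2, h3, h4⟩ | ⟨h1, h2, o, h3, h4, h5, h6⟩⟩ :=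
    hT.target_cases hG hw'
  · obtain ⟨rfl, rfl⟩ := hG.emb_inj _ _ _ _ hp h3 h4
    exact hN ((hG.lv_emb hq).symm.trans hlv).symm
  obtain ⟨hqa, hqA⟩ := hT.own_of_mem_doors hG hr hL hq hwQ
  -- The class of `N'` has `k ^ D.exp N' > 1` elements.
  obtain ⟨N'', hN1, hN2⟩ : ∃ N'', D.exp N'' = D.exp N' ∧ N'' ≠ N' := by
    refine (Set.exists_ne_of_one_lt_ncard (s := {N'' | D.exp N'' = D.exp N'}) ?_ N')
    rw [hG.exp_card]
    exact Nat.one_lt_pow (hG.exp_pos _ h1).ne' hk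
  obtain ⟨s1, s2, s3, s4, s5⟩ := hG.sib h1 hN1.symm
  have hq'' : D.Own N'' q := ⟨by rw [← s4]; exact hq.1,
    fun hc => (h2.2 (by rw [s4]; exact hc)).elim⟩
  have hA'' := hG.active_sib hN1.symm hN'
  -- The owners of doors of the box of `L` are ancestors of one level, and such an ancestor is
  -- determined by its rank; so two siblings cannot both own one.
  have hwQ'' : D.emb N'' q ∉ D.doors L := fun hc =>
    hN2 ((hT.own_of_mem_doors hG hr hL hq'' hc).2.eq_of_rank hqA s5.symm)
  have hwire : D.emb N'' q ∈ S.ground.wires := (hT.wires N'' q hA'' hq'').2 (Or.inl s1)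
  have htar : S.ground.target (D.emb N'' q) = some (D.emb M p) := by
    rw [hT.target_door N'' q hA'' s1 (by rw [← s4]; exact h2) (D.par N') s2.symm o
      (by rw [← s3, h3]), h5, h6]
    rfl
  have hwP : D.emb N'' q ∈ P := h.closed _ hx hxQ _ (hT.wires_sub hwire)
    (Or.inr (Or.inl ⟨hwire, htar⟩))
  have hatt : D.Attached i N'' q := by
    unfold Attached
    rw [← s4]
    exact hqa
  have h7 := hmax N'' ⟨q, hq'', hwP, hwQ'', hatt⟩
  have h8 := (hG.own_emb (hG.active_par h1 hN') ((hG.circ _).pre.door_ports h5) hp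
    h6.symm).2.2.rank_le
  have := hG.rank_par _ h1
  omega

/-- An unattached port has no neighbour coming from a level above. What remains is adjacency in its
own content through wires and kept boxes, or the wire from a conclusion down to a door in the
parent. -/
theorem coh_emb_iff (hT : D.Describes i S) (hG : D.Good k e) {L : D.Lv} (hL : D.Active i L) {p : α}
    (hp : D.Own L p) (ha : ¬ D.Attached i L p) (y : R.Name) : S.Coh (D.emb L p) y ↔
      (∃ p' ∈ (D.cont L).ports, KeptCoh i (D.cont L) p p' ∧ y = D.emb L p') ∨
      (L ≠ D.root ∧ p ∈ (D.cont L).notCircs ∧ ∃ (o : (D.cont (D.par L)).boxes) (p' : α),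
        D.box L = some ↑o ∧ (D.cont (D.par L)).door o p = some p' ∧ y = D.emb (D.par L) p') := by
  have hpre := (hG.circ L).pre
  constructor
  · rintro (⟨-, hw'⟩ | ⟨-, hw'⟩ | ⟨b, ⟨q, hq⟩, q', hq'⟩)
    · obtain ⟨N, q, p', hN, hq, he, ⟨h1, h2, h3, h4⟩ | ⟨h1, h2, o, h3, h4, h5, h6⟩⟩ :=
        hT.target_cases hG hw'
      · obtain ⟨rfl, rfl⟩ := hG.emb_inj _ _ _ _ hq hp he
        exact Or.inl ⟨p', h3.1, Or.inl ⟨h1, h2⟩, h4⟩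
      · obtain ⟨rfl, rfl⟩ := hG.emb_inj _ _ _ _ hq hp he
        exact Or.inr ⟨h1, h2, o, p', h3, h5, h6⟩
    · obtain ⟨N, q, p', hN, hq, rfl, ⟨h1, h2, h3, h4⟩ | ⟨h1, h2, o, h3, h4, h5, h6⟩⟩ :=
        hT.target_cases hG hw'
      · obtain ⟨rfl, rfl⟩ := hG.emb_inj _ _ _ _ hp h3 h4
        exact Or.inl ⟨q, hq.1, Or.inr (Or.inl ⟨h1, h2⟩), rfl⟩
      · exact (ha (hG.attached_of_door hN h1 h3 h5 hp h6.symm).2).elim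
    · obtain ⟨N, o, p', hN, ho, he, -, h1, h2⟩ := hT.door_cases hq
      obtain ⟨N', o', p'', -, -, he', -, h1', rfl⟩ := hT.door_cases hq'
      obtain ⟨rfl, ho'⟩ := hG.emb_inj _ _ _ _ (hG.own_box o) (hG.own_box o') (he.trans he'.symm)
      obtain rfl : o = o' := Subtype.ext ho'
      obtain ⟨rfl, rfl | ⟨h3, h4, -⟩, -⟩ := hG.own_emb hN ((hG.circ N).pre.door_ports h1) hp h2.symm
      · exact Or.inl ⟨p'', (hG.circ N).pre.door_ports h1', Or.inr (Or.inr ⟨o, ho,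
          ⟨q, h1⟩, q', h1'⟩),
          rfl⟩
      · exact (ha (hG.attached_of_circ hN h3 h4 hp h2.symm).2).elim
  · rintro (⟨p', hp', ⟨h1, h2⟩ | ⟨h1, h2⟩ | ⟨o, h1, ⟨q, h2⟩, q', h3⟩, rfl⟩ |
      ⟨hr, hc, o, p', h1, h2, rfl⟩)
    · refine Or.inl ⟨(hT.wires L p hL hp).2 (Or.inr h1), ?_⟩
      rw [hT.target_wire L p hL h1, h2, Option.map_some]
    · refine Or.inr (Or.inl ⟨(hT.wires L p' hL (hG.own_wire h1)).2 (Or.inr h1), ?_⟩)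
      rw [hT.target_wire L p' hL h1, h2, Option.map_some]
    · refine Or.inr (Or.inr ⟨⟨D.emb L o, (hT.boxes _).2 ⟨L, o, hL, h1, rfl⟩⟩, ⟨q, ?_⟩, q', ?_⟩)
      · rw [hT.door L hL o _ rfl, h2, Option.map_some]
      · rw [hT.door L hL o _ rfl, h3, Option.map_some]
    · refine Or.inl ⟨(hT.wires L p hL hp).2 (Or.inl hr), ?_⟩
      rw [hT.target_door L p hL hr hc _ rfl o h1, h2, Option.map_some]

/-- The step from one level to another always ends in a door of an expanded box, which is attached.
-/
theorem level_eq_of_coh (hT : D.Describes i S) (hG : D.Good k e) {L M : D.Lv} (hL : D.Active i L)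
    {p p' : α} (hp : D.Own L p) (ha : ¬ D.Attached i L p) (hp' : D.Own M p')
    (ha' : ¬ D.Attached i M p') (h : S.Coh (D.emb L p) (D.emb M p')) : L = M := by
  rcases (hT.coh_emb_iff hG hL hp ha _).1 h with ⟨p'', h1, -, h2⟩ | ⟨h1, -, o, p'', h2, h3, h4⟩
  · obtain ⟨rfl, h3 | ⟨h3, h4, -⟩, -⟩ := hG.own_emb hL h1 hp' h2.symm
    · exact h3
    · exact (ha' (hG.attached_of_circ hL h3 h4 hp' h2.symm).2).elim
  · exact (ha' (hG.attached_of_door hL h1 h2 h3 hp' h4.symm).2).elim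

theorem rank_of_coh (hT : D.Describes i S) (hG : D.Good k e) {L M : D.Lv} (hL : D.Active i L)
    {p p' : α} (hp : D.Own L p) (ha : ¬ D.Attached i L p) (hp' : D.Own M p')
    (h : S.Coh (D.emb L p) (D.emb M p')) : M = L ∨ D.rank M < D.rank L := by
  rcases (hT.coh_emb_iff hG hL hp ha _).1 h with ⟨p'', h1, -, h2⟩ | ⟨h1, -, o, p'', h2, h3, h4⟩
  · obtain ⟨-, h3 | ⟨h3, -, h5⟩, -⟩ := hG.own_emb hL h1 hp' h2.symm
    · exact Or.inl h3.symm
    · have := h5.rank_le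
      have := hG.rank_par L h3
      exact Or.inr (by omega)
  · have := (hG.own_emb (hG.active_par h1 hL) ((hG.circ _).pre.door_ports h3) hp'
      h4.symm).2.2.rank_le
    have := hG.rank_par L h1
    exact Or.inr (by omega)

end Describes

/-- The component `P` lies in the level `L`, except for its ports in `Q`. -/
structure IsLevelComponent (D : LevelData R) (i : ℕ) (S : Net α R.Name) (Q : Set R.Name) (L : D.Lv)
    (P : Set R.Name) : Prop where
  isComponent : IsComponent S Q P
  active : D.Active i L
  level : ∀ x ∈ P, x ∉ Q → ∃ p, D.Own L p ∧ ¬ D.Attached i L p ∧ D.emb L p = x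

namespace Describes

theorem exists_isLevelComponent (hT : D.Describes i S) (hG : D.Good k e) (hk : 1 < k) {L : D.Lv}
    (hr : L ≠ D.root) (hL : D.Active i L) (h : IsComponent S (D.doors L) P)
    (hc : (S.restrict (D.doors L) P).cosize < k) :
    ∃ M, D.IsLevelComponent i S (D.doors L) M P := by
  obtain ⟨x, hx, hxQ⟩ := h.nonempty
  obtain ⟨M, p, hM, hp, rfl⟩ := (hT.ports x).1 (h.sub hx)
  refine ⟨M, h, hM, fun y hy hyQ => ?_⟩
  have hpath := h.conn _ hx hxQ y hy hyQ
  clear hy hyQ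
  induction hpath with
  | refl => exact ⟨p, hp, hT.not_attached hG hk hr hL h hc hp hx hxQ, rfl⟩
  | @tail y z _ hyz ih =>
    obtain ⟨q, hq, hqa, rfl⟩ := ih
    obtain ⟨hcoh, hz, hzQ⟩ := hyz
    obtain ⟨N, q', hN, hq', rfl⟩ := (hT.ports z).1 (h.sub hz)
    have hqa' := hT.not_attached hG hk hr hL h hc hq' hz hzQ
    obtain rfl := hT.level_eq_of_coh hG hM hq hqa hq' hqa' hcoh
    exact ⟨q', hq', hqa', rfl⟩

end Describes

namespace IsLevelComponent

variable {L : D.Lv}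

theorem lv_eq (hG : D.Good k e) (h : D.IsLevelComponent i S Q L P) {x : R.Name} (hx : x ∈ P)
    (hxQ : x ∉ Q) : D.lv x = L := by
  obtain ⟨p, hp, -, rfl⟩ := h.level x hx hxQ
  exact hG.lv_emb hp

theorem level_unique (hG : D.Good k e) (h : D.IsLevelComponent i S Q L P) {L' : D.Lv}
    (h' : D.IsLevelComponent i S Q L' P) : L = L' := by
  obtain ⟨x, hx, hxQ⟩ := h.isComponent.nonempty
  rw [← h.lv_eq hG hx hxQ, h'.lv_eq hG hx hxQ]

theorem lv_of_mem (hT : D.Describes i S) (hG : D.Good k e) (h : D.IsLevelComponent i S Q L P)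
    {x : R.Name} (hx : x ∈ P) : D.lv x = L ∨ D.rank (D.lv x) < D.rank L := by
  by_cases hxQ : x ∈ Q
  · obtain ⟨y, hy, hyQ, hc⟩ := h.isComponent.bound x hx hxQ
    obtain ⟨p, hp, ha, rfl⟩ := h.level y hy hyQ
    obtain ⟨M, p', hM, hp', rfl⟩ := (hT.ports x).1 (h.isComponent.sub hx)
    rw [hG.lv_emb hp']
    exact hT.rank_of_coh hG h.active hp ha hp' hc.symm
  · exact Or.inl (h.lv_eq hG hx hxQ)

/-- All the wires and boxes of the component belong to the level `L`, so every arity in it reduces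
to the contribution of `L`. -/
theorem cosize_lt (hT : D.Describes i S) (hG : D.Good k e) (hk : 0 < k)
    (h : D.IsLevelComponent i S Q L P) (hQ : Q ⊆ S.ground.expPorts) (hQb : ∀ x ∈ Q, x ∉ S.boxes) :
    (S.restrict Q P).cosize < k := by
  have hS := hT.isDiffPS hG
  have hpre := (h.isComponent.isDiffPS hS hQ hQb).1
  rw [cosize_lt_iff hpre hk]
  constructor
  · intro x hx
    have hx : x ∈ P := hx
    obtain ⟨M, p, hM, hp, rfl⟩ := (hT.ports x).1 (h.isComponent.sub hx)
    rw [finsum_levelArity hG hpre, finsum_eq_single _ L]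
    · exact (levelArity_restrict_le hS.1 _ L).trans_lt (hT.levelArity_lt hG hk hp)
    · intro L' hne
      rw [levelArity_restrict]
      have h1 : {w | (w ∈ S.ground.premises (D.emb M p) ∧ w ∈ P ∧ w ∉ Q ∧ D.emb M p ∈ P) ∧
          D.lv w = L'} = ∅ := by
        refine Set.eq_empty_of_forall_notMem ?_
        rintro w ⟨⟨-, h1, h2, -⟩, rfl⟩
        exact hne (h.lv_eq hG h1 h2)
      have h2 : {b : S.boxes | ↑b ∈ P ∧ D.lv b = L'} = ∅ := by
        refine Set.eq_empty_of_forall_notMem ?_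
        rintro b ⟨h3, rfl⟩
        exact hne (h.lv_eq hG h3 fun hb => hQb b hb b.2)
      rw [h1, h2, Set.ncard_empty, finsum_mem_empty, add_zero]
  · rintro ⟨b, hb, hbP⟩
    obtain ⟨M, o, hM, ho, rfl⟩ := (hT.boxes b).1 hb
    show (S.content ⟨D.emb M o, hb⟩).cosize < k
    rw [hT.content M hM o _ rfl]
    exact ((cosize_lt_iff (hG.circ M).pre hk).1 (hG.cosize_lt M)).2 o

end IsLevelComponent

namespace Describes

/-- The component of a port of a copy of the content of the box of `L`. -/
theorem exists_component (hT : D.Describes i S) (hG : D.Good k e) {L : D.Lv} (hr : L ≠ D.root)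
    (hi : (D.cont L).depth = i) {p : α} (hp : D.Own L p) :
    ∃ P, D.emb L p ∈ P ∧ D.IsLevelComponent i S (D.doors L) L P := by
  have hL : D.Active i L := Or.inr hi.ge
  have hS := hT.isDiffPS hG
  have hna : ∀ q, ¬ D.Attached i L q := by
    rintro q ⟨o, ho, -⟩
    have := depth_content_lt (hG.circ L).pre o
    omega
  have hnQ : ∀ q, D.Own L q → D.emb L q ∉ D.doors L := fun q hq h =>
    hna q (hT.own_of_mem_doors hG hr hL hq h).1
  have hcohport : ∀ {x y}, S.Coh x y → y ∈ S.ports := by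
    rintro x y (⟨-, h⟩ | ⟨h, -⟩ | ⟨o, -, q, h⟩)
    · exact (hS.1.ground.target_mem _ _ h).1
    · exact hT.wires_sub h
    · exact hS.1.door_ports h
  have hstep : ∀ q, D.Own L q → ∀ y, S.Coh (D.emb L q) y → y ∉ D.doors L →
      ∃ q', D.Own L q' ∧ y = D.emb L q' := by
    intro q hq y hy hyQ
    rcases (hT.coh_emb_iff hG hL hq (hna q) y).1 hy with ⟨p', h1, -, rfl⟩ |
      ⟨-, -, o, p', h2, h3, rfl⟩
    · refine ⟨p', ⟨h1, fun hc => ?_⟩, rfl⟩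
      by_contra
      obtain ⟨o, ho, -⟩ := hG.cont_eq L hr
      exact hyQ ⟨o, ho, p', p', (hG.door_circ hr hc ho).2.1, (hG.emb_circ L p' hr hc).symm⟩
    · exact (hyQ ⟨o, h2, q, p', h3, rfl⟩).elim
  set r : R.Name → R.Name → Prop := fun a b => S.Coh a b ∧ b ∉ D.doors L with hrdef
  have hreach : ∀ y, Relation.ReflTransGen r (D.emb L p) y → ∃ q, D.Own L q ∧ y = D.emb L q := by
    intro y hy
    induction hy with
    | refl => exact ⟨p, hp, rfl⟩
    | tail _ h ih =>
      obtain ⟨q, hq, rfl⟩ := ih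
      exact hstep q hq _ h.1 h.2
  have hnQ' : ∀ y, Relation.ReflTransGen r (D.emb L p) y → y ∉ D.doors L := by
    intro y hy
    obtain ⟨q, hq, rfl⟩ := hreach y hy
    exact hnQ q hq
  -- The relation `r` constrains only its second argument, but on what is reached from the starting
  -- port nothing lies in `D.doors L`, so paths can be reversed.
  have hsymm : ∀ x y, Relation.ReflTransGen r (D.emb L p) x → Relation.ReflTransGen r x y →
      Relation.ReflTransGen r y x := by
    intro x y hx hxy
    induction hxy with
    | refl => exact .refl
    | @tail b c hb h ih => exact (Relation.ReflTransGen.single ⟨h.1.symm, hnQ' _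
      (hx.trans hb)⟩).trans ih
  -- The component is what is reached without entering a door, together with the doors adjacent to
  -- it. Since the depth of the content is `i`, no port of `L` is attached, and the first part never
  -- leaves `L`.
  set P : Set R.Name := {y | Relation.ReflTransGen r (D.emb L p) y ∨
    y ∈ D.doors L ∧ ∃ z, Relation.ReflTransGen r (D.emb L p) z ∧ S.Coh z y} with hP
  have hK : ∀ y ∈ P, y ∉ D.doors L → Relation.ReflTransGen r (D.emb L p) y := by
    rintro y (h | ⟨h, -⟩) hy
    · exact h
    · exact (hy h).elim
  refine ⟨P, Or.inl .refl, ⟨?_, ?_, ?_, ?_, ⟨_, Or.inl .refl, hnQ p hp⟩, ?_, ?_⟩, hL, ?_⟩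
  · rintro y (h | ⟨h, z, hz, hc⟩)
    · obtain ⟨q, hq, rfl⟩ := hreach y h
      exact hT.emb_port hG hL hq.1
    · exact hcohport hc
  · intro x hx hxQ y hy hxy
    have hx := hK x hx hxQ
    by_cases hyQ : y ∈ D.doors L
    · exact Or.inr ⟨hyQ, x, hx, hxy⟩
    · exact Or.inl (hx.tail ⟨hxy, hyQ⟩)
  · intro x hx hxQ y hy hyQ
    have hx := hK x hx hxQ
    have hxy := (hsymm _ _ .refl hx).trans (hK y hy hyQ)
    clear hy hyQ
    induction hxy with
    | refl => exact .refl
    | tail hb h ih => exact ih.tail ⟨h.1, Or.inl ((hx.trans hb).tail h), h.2⟩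
  · rintro q (h | ⟨-, z, hz, hc⟩) hq
    · exact (hnQ' q h hq).elim
    · exact ⟨z, Or.inl hz, hnQ' z hz, hc.symm⟩
  · intro x hx hxQ
    obtain ⟨q, hq, rfl⟩ := hreach x (hK x hx hxQ)
    exact (hT.wires L q hL hq).2 (Or.inl hr)
  · intro x hx hm w hw
    obtain ⟨q, hq, rfl⟩ := hreach x (hK x hx fun h =>
      multPorts_not_expPorts hm (hT.doors_sub hG hr hL h))
    rw [hT.premises_unattached hG hL hq (hna q)] at hw
    obtain ⟨q', hq', rfl⟩ := hw
    exact hnQ q' (hG.own_wire hq'.1)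
  · intro x hx hxQ
    obtain ⟨q, hq, rfl⟩ := hreach x (hK x hx hxQ)
    exact ⟨q, hq, hna q, rfl⟩

end Describes
end LevelData
end Net
end MELL

/-! ### Growth of types along wires; composition and inversion of isomorphisms. -/

namespace MELL

/-- The type of a premise is an immediate subformula of the type of its target. For a multiplicative
target, both a left and a non-left premise must be exhibited in order to read off its type. -/
theorem Ground.IsDifferential.target_size {β : Type u} {G : Ground β} (hG : G.IsDifferential)
    {w q : β} (h : G.target w = some q) {A B : Ty} (hA : G.ty w = some A) (hB : G.ty q = some B) :
    sizeOf A < sizeOf B := by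
  obtain ⟨hq, h1, h2⟩ := hG.target_mem w q h
  have hw : w ∈ G.premises q := ⟨(hG.target_dom w).2 (by simp [h]), h⟩
  have hfin : (G.premises q).Finite :=
    hG.finite_ports.subset fun v hv => (hG.wires_sub v hv.1).1
  have hmult : ∀ hm : q ∈ G.multPorts, ∃ w₁ ∈ G.premises q, ∃ w₂ ∈ G.premises q, w₁ ∈ G.left ∧
      w₂ ∉ G.left ∧ (w = w₁ ∨ w = w₂) := by
    intro hm
    have hb := hG.binary q hm
    have hl := hG.left_unique q hm
    by_cases hwl : w ∈ G.left
    · obtain ⟨w₂, h3, h4⟩ : ∃ w₂ ∈ G.premises q, w₂ ∉ G.left := by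
        by_contra hn
        push Not at hn
        rw [Set.inter_eq_right.2 hn] at hl
        omega
      exact ⟨w, hw, w₂, h3, hwl, h4, Or.inl rfl⟩
    · obtain ⟨w₁, h3⟩ := Set.nonempty_of_ncard_ne_zero (s := G.left ∩ G.premises q) (by omega)
      exact ⟨w₁, h3.2, w, hw, h3.1, hwl, Or.inr rfl⟩
  have hty : ∀ v ∈ G.premises q, ∃ C, G.ty v = some C := fun v hv =>
    Option.ne_none_iff_exists'.1 ((hG.ty_dom v).1 (hG.wires_sub v hv.1).1)
  obtain ⟨l, hl⟩ := Option.ne_none_iff_exists'.1 ((hG.label_dom q).1 hq)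
  cases l with
  | one => exact (h1 hl).elim
  | bot => exact (h2 hl).elim
  | tensor =>
    obtain ⟨w₁, hw₁, w₂, hw₂, hl₁, hl₂, hor⟩ := hmult (Or.inl ⟨hq, hl⟩)
    obtain ⟨A₁, hA₁⟩ := hty w₁ hw₁
    obtain ⟨A₂, hA₂⟩ := hty w₂ hw₂
    have := hG.ty_tensor q ⟨hq, hl⟩ w₁ hw₁ w₂ hw₂ hl₁ hl₂ A₁ A₂ hA₁ hA₂
    rw [hB, Option.some.injEq] at this
    subst this
    rw [Ty.tensor.sizeOf_spec]
    rcases hor with rfl | rfl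
    · rw [hA₁, Option.some.injEq] at hA; subst hA; omega
    · rw [hA₂, Option.some.injEq] at hA; subst hA; omega
  | par =>
    obtain ⟨w₁, hw₁, w₂, hw₂, hl₁, hl₂, hor⟩ := hmult (Or.inr ⟨hq, hl⟩)
    obtain ⟨A₁, hA₁⟩ := hty w₁ hw₁
    obtain ⟨A₂, hA₂⟩ := hty w₂ hw₂
    have := hG.ty_par q ⟨hq, hl⟩ w₁ hw₁ w₂ hw₂ hl₁ hl₂ A₁ A₂ hA₁ hA₂
    rw [hB, Option.some.injEq] at this
    subst this
    rw [Ty.par.sizeOf_spec]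
    rcases hor with rfl | rfl
    · rw [hA₁, Option.some.injEq] at hA; subst hA; omega
    · rw [hA₂, Option.some.injEq] at hA; subst hA; omega
  | bang =>
    obtain ⟨C, hC, hp⟩ := hG.ty_bang q ⟨hq, hl⟩
    have := hp w hw
    rw [hA, Option.some.injEq] at this
    rw [hB, Option.some.injEq] at hC
    subst this hC
    rw [Ty.bang.sizeOf_spec]
    omega
  | whynot =>
    obtain ⟨C, hC, hp⟩ := hG.ty_whynot q (Or.inl ⟨hq, hl⟩)
    have := hp w hw
    rw [hA, Option.some.injEq] at this
    rw [hB, Option.some.injEq] at hC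
    subst this hC
    rw [Ty.whynot.sizeOf_spec]
    omega
  | circ =>
    obtain ⟨C, hC, hp⟩ := hG.ty_whynot q (Or.inr ⟨hq, hl⟩)
    have := hp w hw
    rw [hA, Option.some.injEq] at this
    rw [hB, Option.some.injEq] at hC
    subst this hC
    rw [Ty.whynot.sizeOf_spec]
    omega

namespace Ground

variable {β β' β'' : Type u}

theorem IsIso.refl (G : Ground β) : G.IsIso G id :=
  ⟨Set.bijOn_id _, fun _ _ => Iff.rfl, fun _ _ => rfl, fun _ _ => by simp, fun _ _ => Iff.rfl,
    fun _ _ => rfl⟩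

theorem IsIso.conclusions {G : Ground β} {G' : Ground β'} {φ : β → β'} (h : G.IsIso G' φ) {p : β}
    (hp : p ∈ G.conclusions) : φ p ∈ G'.conclusions :=
  ⟨h.bij.mapsTo hp.1, fun hw => hp.2 ((h.wires p hp.1).2 hw)⟩

theorem IsIso.exists_conclusion {G : Ground β} {G' : Ground β'} {φ : β → β'} (h : G.IsIso G' φ)
    {p' : β'} (hp : p' ∈ G'.conclusions) : ∃ p ∈ G.conclusions, φ p = p' := by
  obtain ⟨p, hp', rfl⟩ := h.bij.surjOn hp.1
  exact ⟨p, ⟨hp', fun hw => hp.2 ((h.wires p hp').1 hw)⟩, rfl⟩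

theorem IsIso.trans {G : Ground β} {G' : Ground β'} {G'' : Ground β''} {φ : β → β'} {φ' : β' → β''}
    (hG : G.wires ⊆ G.ports) (h : G.IsIso G' φ) (h' : G'.IsIso G'' φ') : G.IsIso G'' (φ' ∘ φ) where
  bij := h'.bij.comp h.bij
  wires p hp := (h.wires p hp).trans (h'.wires _ (h.bij.mapsTo hp))
  label p hp := (h'.label _ (h.bij.mapsTo hp)).trans (h.label p hp)
  target w hw := by
    rw [Function.comp_apply, h'.target _ ((h.wires w (hG hw)).1 hw), h.target w hw, Option.map_map]
  left p hp := (h.left p hp).trans (h'.left _ (h.bij.mapsTo hp))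
  ty p hp := (h'.ty _ (h.bij.mapsTo hp)).trans (h.ty p hp)

theorem IsIso.symm {G : Ground β} {G' : Ground β'} {φ : β → β'} {ψ : β' → β}
    (hG : G.IsDifferential) (hG' : G'.IsDifferential) (h : G.IsIso G' φ)
    (hψ : ∀ p ∈ G.ports, ψ (φ p) = p) : G'.IsIso G ψ where
  bij := by
    refine ⟨?_, ?_, ?_⟩
    · intro p' hp'
      obtain ⟨p, hp, rfl⟩ := h.bij.surjOn hp'
      rwa [hψ p hp]
    · intro p' hp' q' hq' he
      obtain ⟨p, hp, rfl⟩ := h.bij.surjOn hp'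
      obtain ⟨q, hq, rfl⟩ := h.bij.surjOn hq'
      rw [hψ p hp, hψ q hq] at he
      rw [he]
    · intro p hp
      exact ⟨φ p, h.bij.mapsTo hp, hψ p hp⟩
  wires p' hp' := by
    obtain ⟨p, hp, rfl⟩ := h.bij.surjOn hp'
    rw [hψ p hp]
    exact (h.wires p hp).symm
  label p' hp' := by
    obtain ⟨p, hp, rfl⟩ := h.bij.surjOn hp'
    rw [hψ p hp]
    exact (h.label p hp).symm
  target w' hw' := by
    obtain ⟨w, hw, rfl⟩ := h.bij.surjOn (hG'.wires_sub w' hw').1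
    have hww := (h.wires w hw).2 hw'
    rw [hψ w hw, h.target w hww]
    cases ht : G.target w with
    | none => rfl
    | some q => simp [hψ q (hG.target_mem w q ht).1]
  left p' hp' := by
    obtain ⟨p, hp, rfl⟩ := h.bij.surjOn hp'
    rw [hψ p hp]
    exact (h.left p hp).symm
  ty p' hp' := by
    obtain ⟨p, hp, rfl⟩ := h.bij.surjOn hp'
    rw [hψ p hp]
    exact (h.ty p hp).symm

end Ground

namespace Net

variable {α β : Type u}

theorem IsCircPS.isDiffPS {R : Net α α} (h : R.IsCircPS) : R.IsDiffPS := ⟨h.pre, h.contents⟩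

theorem IsIso.ground {β' : Type u} {S : Net α β} {S' : Net α β'} {φ : β → β'} (h : S.IsIso S' φ) :
    S.ground.IsIso S'.ground φ := ((isIso_iff _ _ _).1 h).1

theorem IsIso.refl {β : Type u} (S : Net α β) : S.IsIso S id := by
  induction S with
  | mk G bx ct dr ih =>
    rw [isIso_iff]
    refine ⟨Ground.IsIso.refl _, by simp, fun o o' h => ?_⟩
    obtain rfl : o' = o := Subtype.ext h
    exact ⟨id, ih _, fun _ _ => by simp⟩

theorem IsIso.trans {β β' β'' : Type u} {S : Net α β} {S' : Net α β'} {S'' : Net α β''} {φ : β → β'}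
    {φ' : β' → β''} (hS : S.IsDiffPS) (h : S.IsIso S' φ) (h' : S'.IsIso S'' φ') :
    S.IsIso S'' (φ' ∘ φ) := by
  induction S generalizing β' β'' with
  | mk G bx ct dr ih =>
    rw [isIso_iff] at h h' ⊢
    obtain ⟨h1, h2, h3⟩ := h
    obtain ⟨h1', h2', h3'⟩ := h'
    refine ⟨h1.trans (fun w hw => (hS.1.ground.wires_sub w hw).1) h1', ?_, fun o o'' ho => ?_⟩
    · rw [h2', h2, Set.image_comp]
    · have ho' : φ ↑o ∈ S'.boxes := by rw [h2]; exact ⟨o, o.2, rfl⟩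
      obtain ⟨ψ, hψ, hd⟩ := h3 o ⟨_, ho'⟩ rfl
      obtain ⟨ψ', hψ', hd'⟩ := h3' ⟨_, ho'⟩ o'' ho
      refine ⟨ψ' ∘ ψ, ih _ (hS.2 o).isDiffPS hψ hψ', fun q hq => ?_⟩
      rw [Function.comp_apply, hd' _ (hψ.ground.conclusions hq), hd q hq, Option.map_map]

theorem IsIso.symm {β : Type u} {S S' : Net α β} {φ : β → β} (hS : S.IsDiffPS)
    (hS' : S'.IsDiffPS) (h : S.IsIso S' φ) : ∃ ψ : β → β, S'.IsIso S ψ ∧ ∀ p ∈ S.ports, ψ (φ p)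
      = p := by
  induction S with
  | mk G bx ct dr ih =>
    rw [isIso_iff] at h
    obtain ⟨h1, h2, h3⟩ := h
    have hinj := h1.bij.injOn
    classical
    refine ⟨fun x => if hx : ∃ p ∈ G.ports, φ p = x then hx.choose else x, ?_, ?_⟩
    swap
    · intro p hp
      have hex : ∃ q ∈ G.ports, φ q = φ p := ⟨p, hp, rfl⟩
      simp only [hex, dif_pos]
      exact hinj hex.choose_spec.1 hp hex.choose_spec.2
    set ψ : _ → _ := fun x => if hx : ∃ p ∈ G.ports, φ p = x then hx.choose else x with hψ
    have key : ∀ p ∈ G.ports, ψ (φ p) = p := by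
      intro p hp
      have hex : ∃ q ∈ G.ports, φ q = φ p := ⟨p, hp, rfl⟩
      simp only [hψ, hex, dif_pos]
      exact hinj hex.choose_spec.1 hp hex.choose_spec.2
    rw [isIso_iff]
    refine ⟨h1.symm hS.1.ground hS'.1.ground key, ?_, ?_⟩
    · rw [h2, Set.image_image]
      refine (Eq.symm ?_)
      refine (Set.image_congr fun b hb => ?_).trans (Set.image_id _)
      exact key b (hS.1.boxes_sub_ports hb)
    · intro o' o ho
      obtain ⟨b, hb, hbo⟩ := h2.subset o'.2
      have hob : (o : _) = b := by
        rw [ho, ← hbo]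
        exact key b (hS.1.boxes_sub_ports hb)
      have hoo : (o' : _) = φ ↑o := by rw [← hbo, hob]
      obtain ⟨χ, hχ, hd⟩ := h3 o o' hoo
      have hS'o := (hS'.2 o').isDiffPS
      obtain ⟨χ', hχ', hinv⟩ := ih o (hS.2 o).isDiffPS hS'o hχ
      refine ⟨χ', hχ', fun q' hq' => ?_⟩
      obtain ⟨q, hq, rfl⟩ := hχ.ground.exists_conclusion hq'
      rw [hinv q hq.1, hd q hq]
      cases hdq : (Net.mk G bx ct dr).door o q with
      | none => rfl
      | some x =>
        have := key x (hS.1.door_ports hdq)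
        rw [Option.map_some, Option.map_some, this]

theorem Same.conclusions {S S' : Net α β} (h : S.Same S') : S.conclusions = S'.conclusions := by
  obtain ⟨φ, h1, h2⟩ := h
  ext p
  constructor
  · intro hp
    rw [← h2 p hp]
    exact h1.ground.conclusions hp
  · intro hp
    obtain ⟨p', hp', rfl⟩ := h1.ground.exists_conclusion hp
    rwa [h2 p' hp']

theorem Same.refl (S : Net α β) : S.Same S := ⟨id, .refl S, fun _ _ => rfl⟩

theorem Same.symm {S S' : Net α β} (hS : S.IsDiffPS) (hS' : S'.IsDiffPS) (h : S.Same S') :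
    S'.Same S := by
  have hc := h.conclusions
  obtain ⟨φ, h1, h2⟩ := h
  obtain ⟨ψ, h3, h4⟩ := h1.symm hS hS'
  refine ⟨ψ, h3, fun p hp => ?_⟩
  rw [← hc] at hp
  rw [← h2 p hp, h4 p hp.1, h2 p hp]

theorem Same.trans {S S' S'' : Net α β} (hS : S.IsDiffPS) (h : S.Same S') (h' : S'.Same S'') :
    S.Same S'' := by
  have hc := h.conclusions
  obtain ⟨φ, h1, h2⟩ := h
  obtain ⟨φ', h1', h2'⟩ := h'
  refine ⟨φ' ∘ φ, h1.trans hS h1', fun p hp => ?_⟩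
  rw [Function.comp_apply, h2 p hp, h2' p (hc ▸ hp)]

/-- All the ports outside `Q` are wires with a target in `P`, and types grow along wires. So a port
outside `Q` with a type of maximal size has its target in `Q`. -/
theorem IsComponent.exists_premise {S : Net α β} {Q P : Set β} (hS : S.IsDiffPS)
    (h : IsComponent S Q P) : ∃ q ∈ P, q ∈ Q ∧ ∃ w ∈ S.ground.premises q, w ∈ P ∧ w ∉ Q := by
  obtain ⟨w, ⟨hw, hwQ⟩, hmax⟩ := Set.exists_max_image {w | w ∈ P ∧ w ∉ Q}
    (fun w => sizeOf (S.ground.ty w)) (hS.1.ground.finite_ports.subset fun w hw => h.sub hw.1)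
    h.nonempty
  have hwire := h.wires w hw hwQ
  obtain ⟨q, hq⟩ := Option.ne_none_iff_exists'.1 ((hS.1.ground.target_dom w).1 hwire)
  have hqS := (hS.1.ground.target_mem w q hq).1
  have hqP := h.closed w hw hwQ q hqS (Or.inl ⟨hwire, hq⟩)
  refine ⟨q, hqP, ?_, w, ⟨hwire, hq⟩, hw, hwQ⟩
  by_contra hqQ
  obtain ⟨A, hA⟩ := Option.ne_none_iff_exists'.1 ((hS.1.ground.ty_dom w).1 (h.sub hw))
  obtain ⟨B, hB⟩ := Option.ne_none_iff_exists'.1 ((hS.1.ground.ty_dom q).1 hqS)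
  have h1 := hS.1.ground.target_size hq hA hB
  have h2 := hmax q ⟨hqP, hqQ⟩
  simp only [hA, hB, Option.some.sizeOf_spec] at h2
  omega

theorem IsComponent.mem_restrict_left {S : Net α β} {Q P : Set β} (hS : S.IsDiffPS)
    (h : IsComponent S Q P) {x : β} (hx : x ∈ P) (hxQ : x ∉ Q) :
    x ∈ (S.restrict Q P).ground.left ↔ x ∈ S.ground.left := by
  refine ⟨fun hl => hl.1, fun hl => ?_⟩
  obtain ⟨hw, q, hq, ht⟩ := hS.1.ground.left_sub x hl
  exact ⟨hl, hw, q, ⟨h.closed x hx hxQ q (hS.1.ground.target_mem x q ht).1 (Or.inl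
    ⟨hw, ht⟩), hq⟩, ht⟩

end Net
end MELL

/-! ### Moving components between sibling levels. -/

namespace MELL
namespace Net

variable {α β : Type u}

theorem exists_box_of_eq {B B' : Net α α} (h : B = B') (o : B.boxes) : ∃ o' : B'.boxes,
    (o' : α) = o ∧ B'.door o' = B.door o ∧ B'.content o' = B.content o := by
  subst h
  exact ⟨o, rfl, rfl, rfl⟩

namespace LevelData

variable {R : Net α α} {k i : ℕ} {e : R.PseudoExp} {D : LevelData R} {S : Net α R.Name}
  {Q P : Set R.Name}

open Classical in
/-- Rename the ports of the level `L` as those of the level `L'`. -/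
noncomputable def shift (D : LevelData R) (L L' : D.Lv) (x : R.Name) : R.Name :=
  if h : ∃ p, D.Own L p ∧ D.emb L p = x then D.emb L' h.choose else x

theorem Good.shift_own (hG : D.Good k e) {L : D.Lv} (L' : D.Lv) {p : α} (hp : D.Own L p) :
    D.shift L L' (D.emb L p) = D.emb L' p := by
  have h : ∃ q, D.Own L q ∧ D.emb L q = D.emb L p := ⟨p, hp, rfl⟩
  rw [shift, dif_pos h]
  rw [(hG.emb_inj _ _ _ _ h.choose_spec.1 hp h.choose_spec.2).2]

theorem Good.shift_of_ne (hG : D.Good k e) {L M : D.Lv} (L' : D.Lv) {p : α} (hp : D.Own M p)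
    (hM : M ≠ L) : D.shift L L' (D.emb M p) = D.emb M p := by
  rw [shift, dif_neg]
  rintro ⟨q, hq, h⟩
  exact hM (hG.emb_inj _ _ _ _ hq hp h).1.symm

theorem Good.shift_par (hG : D.Good k e) {L : D.Lv} (hr : L ≠ D.root) (hL : D.Active i L)
    (L' : D.Lv) {p : α} (hp : p ∈ (D.cont (D.par L)).ports) :
    D.shift L L' (D.emb (D.par L) p) = D.emb (D.par L) p := by
  obtain ⟨M, h1, h2, h3, h4, -⟩ := hG.exists_own (hG.active_par hr hL) hp
  rw [← h3]
  refine hG.shift_of_ne L' h2 ?_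
  rintro rfl
  have := h4.rank_le
  have := hG.rank_par M hr
  omega

/-- The `∘`-conclusions are named by the common parent, hence fixed by the renaming, and they are
also the `∘`-conclusions of the sibling; the other ports are owned and are renamed. -/
theorem Good.shift_emb (hG : D.Good k e) {L L' : D.Lv} (hr : L ≠ D.root) (hL : D.Active i L)
    (he : D.exp L = D.exp L') {p : α} (hp : p ∈ (D.cont L).ports) :
    D.shift L L' (D.emb L p) = D.emb L' p := by
  obtain ⟨s1, s2, s3, s4, s5⟩ := hG.sib hr he
  by_cases hc : p ∈ (D.cont L).circs
  · obtain ⟨o, ho, -⟩ := hG.cont_eq L hr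
    rw [hG.emb_circ L p hr hc, hG.shift_par hr hL L' (hG.door_circ hr hc ho).2.2.1,
      hG.emb_circ L' p s1 (by rwa [← s4]), s2]
  · exact hG.shift_own L' ⟨hp, fun h => (hc h).elim⟩

theorem Good.own_sib (hG : D.Good k e) {L L' : D.Lv} (hr : L ≠ D.root) (he : D.exp L = D.exp L')
    {p : α} (hp : D.Own L p) : D.Own L' p := by
  obtain ⟨s1, s2, s3, s4, s5⟩ := hG.sib hr he
  exact ⟨by rw [← s4]; exact hp.1, fun hc => (hr (hp.2 (by rw [s4]; exact hc))).elim⟩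

theorem Good.not_attached_sib (hG : D.Good k e) {L L' : D.Lv} (hr : L ≠ D.root)
    (he : D.exp L = D.exp L') {p : α} (hp : ¬ D.Attached i L p) : ¬ D.Attached i L' p := by
  obtain ⟨s1, s2, s3, s4, s5⟩ := hG.sib hr he
  unfold Attached at hp ⊢
  rwa [← s4]

namespace Describes

theorem coh_shift (hT : D.Describes i S) (hG : D.Good k e) {L L' : D.Lv} (hr : L ≠ D.root)
    (hL : D.Active i L) (he : D.exp L = D.exp L') {p : α} (hp : D.Own L p)
    (ha : ¬ D.Attached i L p) (y' : R.Name) :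
    S.Coh (D.emb L' p) y' ↔ ∃ y, S.Coh (D.emb L p) y ∧ D.shift L L' y = y' := by
  obtain ⟨s1, s2, s3, s4, s5⟩ := hG.sib hr he
  simp only [hT.coh_emb_iff hG hL hp ha]
  rw [hT.coh_emb_iff hG (hG.active_sib he hL) (hG.own_sib hr he hp) (hG.not_attached_sib hr he ha),
    ← s2, ← s3, ← s4]
  constructor
  · rintro (⟨p', h1, h2, rfl⟩ | ⟨-, h2, o, p', h3, h4, rfl⟩)
    · exact ⟨_, Or.inl ⟨p', h1, h2, rfl⟩, hG.shift_emb hr hL he h1⟩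
    · exact ⟨_, Or.inr ⟨hr, h2, o, p', h3, h4, rfl⟩,
        hG.shift_par hr hL L' ((hG.circ _).pre.door_ports h4)⟩
  · rintro ⟨y, ⟨p', h1, h2, rfl⟩ | ⟨-, h2, o, p', h3, h4, rfl⟩, rfl⟩
    · exact Or.inl ⟨p', h1, h2, hG.shift_emb hr hL he h1⟩
    · exact Or.inr ⟨s1, h2, o, p', h3, h4, hG.shift_par hr hL L' ((hG.circ _).pre.door_ports h4)⟩

theorem target_shift (hT : D.Describes i S) (hG : D.Good k e) {L L' : D.Lv} (hr : L ≠ D.root)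
    (hL : D.Active i L) (he : D.exp L = D.exp L') {p : α} (hp : D.Own L p) :
    S.ground.target (D.emb L' p) = (S.ground.target (D.emb L p)).map (D.shift L L') := by
  obtain ⟨s1, s2, s3, s4, s5⟩ := hG.sib hr he
  have hL' := hG.active_sib he hL
  by_cases hw : p ∈ (D.cont L).ground.wires
  · rw [hT.target_wire L p hL hw, hT.target_wire L' p hL' (by rwa [← s4]), ← s4, Option.map_map]
    refine Option.map_congr fun q hq => ?_
    exact (hG.shift_emb hr hL he ((hG.circ L).pre.ground.target_mem _ _ hq).1).symm
  · have hc : p ∈ (D.cont L).notCircs := ⟨⟨hp.1, hw⟩, fun h => hr (hp.2 h)⟩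
    obtain ⟨o, ho, -⟩ := hG.cont_eq L hr
    rw [hT.target_door L p hL hr hc _ rfl o ho, hT.target_door L' p hL' s1 (by rwa
      [← s4]) _ s2.symm o
      (by rw [← s3, ho]), Option.map_map]
    refine Option.map_congr fun q hq => ?_
    exact (hG.shift_par hr hL L' ((hG.circ _).pre.door_ports hq)).symm

end Describes

namespace IsLevelComponent

variable {L L' : D.Lv}

theorem shift_bound (hT : D.Describes i S) (hG : D.Good k e) (h : D.IsLevelComponent i S Q L P)
    (hPL : ∀ q ∈ P, q ∈ Q → D.lv q ≠ L) {x : R.Name} (hx : x ∈ P) (hxQ : x ∈ Q) : D.shift L L' x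
      = x := by
  obtain ⟨M, p, hM, hp, rfl⟩ := (hT.ports x).1 (h.isComponent.sub hx)
  refine hG.shift_of_ne L' hp fun hML => hPL _ hx hxQ ?_
  rw [hG.lv_emb hp, hML]

theorem shift_mem_iff (hT : D.Describes i S) (hG : D.Good k e) (h : D.IsLevelComponent i S Q L P)
    (hr : L ≠ D.root) (he : D.exp L = D.exp L')
    (hQa : ∀ M p, D.Own M p → D.emb M p ∈ Q → D.Attached i M p)
    (hPL : ∀ q ∈ P, q ∈ Q → D.lv q ≠ L) {x : R.Name} (hx : x ∈ P) : D.shift L L' x ∈ Q ↔ x ∈ Q := by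
  by_cases hxQ : x ∈ Q
  · rw [h.shift_bound hT hG hPL hx hxQ]
  · refine iff_of_false (fun hs => ?_) hxQ
    obtain ⟨p, hp, ha, rfl⟩ := h.level x hx hxQ
    rw [hG.shift_own L' hp] at hs
    exact hG.not_attached_sib hr he ha (hQa _ _ (hG.own_sib hr he hp) hs)

/-- For distinct siblings, the renamed ports are owned by `L'`, which has the rank of `L`. The ports
of `P` in `Q` are owned by `L` or by lower ranks, so there is no collision. -/
theorem injOn_shift (hT : D.Describes i S) (hG : D.Good k e) (h : D.IsLevelComponent i S Q L P)
    (hr : L ≠ D.root) (he : D.exp L = D.exp L') (hPL : ∀ q ∈ P, q ∈ Q → D.lv q ≠ L) : Set.InjOn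
      (D.shift L L') P := by
  by_cases hLL : L = L'
  · subst hLL
    intro x hx y hy hxy
    have key : ∀ x ∈ P, D.shift L L x = x := by
      intro x hx
      by_cases hxQ : x ∈ Q
      · exact h.shift_bound hT hG hPL hx hxQ
      · obtain ⟨p, hp, -, rfl⟩ := h.level x hx hxQ
        exact hG.shift_own L hp
    rwa [key x hx, key y hy] at hxy
  have hrank := (hG.sib hr he).2.2.2.2
  have key : ∀ x ∈ P, x ∉ Q → ∀ y ∈ P, y ∈ Q → D.shift L L' x ≠ D.shift L L' y := by
    intro x hx hxQ y hy hyQ hxy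
    obtain ⟨p, hp, -, rfl⟩ := h.level x hx hxQ
    rw [h.shift_bound hT hG hPL hy hyQ, hG.shift_own L' hp] at hxy
    have h1 := h.lv_of_mem hT hG hy
    rw [← hxy, hG.lv_emb (hG.own_sib hr he hp)] at h1
    rcases h1 with h1 | h1
    · exact hLL h1.symm
    · omega
  intro x hx y hy hxy
  by_cases hxQ : x ∈ Q <;> by_cases hyQ : y ∈ Q
  · rwa [h.shift_bound hT hG hPL hx hxQ, h.shift_bound hT hG hPL hy hyQ] at hxy
  · exact (key y hy hyQ x hx hxQ hxy.symm).elim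
  · exact (key x hx hxQ y hy hyQ hxy).elim
  · obtain ⟨p, hp, -, rfl⟩ := h.level x hx hxQ
    obtain ⟨q, hq, -, rfl⟩ := h.level y hy hyQ
    rw [hG.shift_own L' hp, hG.shift_own L' hq] at hxy
    rw [(hG.emb_inj _ _ _ _ (hG.own_sib hr he hp) (hG.own_sib hr he hq) hxy).2]

/-- Adjacency of unattached ports commutes with the renaming. By `hQa` no unattached port is in `Q`,
and by `hPL` no conclusion of the component is moved, so the image meets `Q` in the same ports. -/
theorem image_shift (hT : D.Describes i S) (hG : D.Good k e) (h : D.IsLevelComponent i S Q L P)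
    (hr : L ≠ D.root) (he : D.exp L = D.exp L') (hQ : Q ⊆ S.ground.expPorts)
    (hQa : ∀ M p, D.Own M p → D.emb M p ∈ Q → D.Attached i M p)
    (hPL : ∀ q ∈ P, q ∈ Q → D.lv q ≠ L) : D.IsLevelComponent i S Q L' (D.shift L L' '' P) := by
  obtain ⟨s1, s2, s3, s4, s5⟩ := hG.sib hr he
  have hL := h.active
  have hL' := hG.active_sib he hL
  have hS := hT.isDiffPS hG
  have hmem : ∀ {x}, x ∈ P → (D.shift L L' x ∈ Q ↔ x ∈ Q) := fun hx =>
    h.shift_mem_iff hT hG hr he hQa hPL hx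
  have hfix : ∀ {x}, x ∈ P → x ∈ Q → D.shift L L' x = x := fun hx hxQ =>
    h.shift_bound hT hG hPL hx hxQ
  have hcohport : ∀ {x y}, S.Coh x y → y ∈ S.ports := by
    rintro x y (⟨-, h⟩ | ⟨h, -⟩ | ⟨o, -, q, h⟩)
    · exact (hS.1.ground.target_mem _ _ h).1
    · exact hT.wires_sub h
    · exact hS.1.door_ports h
  have hcoh : ∀ {x y}, x ∈ P → x ∉ Q → S.Coh x y → S.Coh (D.shift L L' x) (D.shift L L' y) := by
    intro x y hx hxQ hxy
    obtain ⟨p, hp, ha, rfl⟩ := h.level x hx hxQ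
    rw [hG.shift_own L' hp]
    exact (hT.coh_shift hG hr hL he hp ha _).2 ⟨y, hxy, rfl⟩
  refine ⟨⟨?_, ?_, ?_, ?_, ?_, ?_, ?_⟩, hL', ?_⟩
  · rintro _ ⟨x, hx, rfl⟩
    by_cases hxQ : x ∈ Q
    · rw [hfix hx hxQ]
      exact h.isComponent.sub hx
    · obtain ⟨p, hp, ha, rfl⟩ := h.level x hx hxQ
      rw [hG.shift_own L' hp]
      exact hT.emb_port hG hL' (hG.own_sib hr he hp).1
  · rintro _ ⟨x, hx, rfl⟩ hxQ y' - hc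
    rw [hmem hx] at hxQ
    obtain ⟨p, hp, ha, rfl⟩ := h.level x hx hxQ
    rw [hG.shift_own L' hp] at hc
    obtain ⟨y, hy, rfl⟩ := (hT.coh_shift hG hr hL he hp ha _).1 hc
    exact ⟨y, h.isComponent.closed _ hx hxQ y (hcohport hy) hy, rfl⟩
  · rintro _ ⟨x, hx, rfl⟩ hxQ _ ⟨y, hy, rfl⟩ hyQ
    rw [hmem hx] at hxQ
    rw [hmem hy] at hyQ
    have hpath := h.isComponent.conn x hx hxQ y hy hyQ
    clear hy hyQ
    suffices H : (y ∈ P ∧ y ∉ Q) ∧ Relation.ReflTransGen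
        (fun a b => S.Coh a b ∧ b ∈ D.shift L L' '' P ∧ b ∉ Q) (D.shift L L' x)
          (D.shift L L' y) from H.2
    induction hpath with
    | refl => exact ⟨⟨hx, hxQ⟩, .refl⟩
    | tail _ hbc ih =>
      refine ⟨hbc.2, ih.2.tail ⟨hcoh ih.1.1 ih.1.2 hbc.1, ⟨_, hbc.2.1, rfl⟩, ?_⟩⟩
      rw [hmem hbc.2.1]
      exact hbc.2.2
  · rintro _ ⟨q, hq, rfl⟩ hqQ
    rw [hmem hq] at hqQ
    obtain ⟨y, hy, hyQ, hc⟩ := h.isComponent.bound q hq hqQ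
    refine ⟨D.shift L L' y, ⟨y, hy, rfl⟩, fun hs => hyQ ((hmem hy).1 hs), ?_⟩
    exact (hcoh hy hyQ hc.symm).symm
  · obtain ⟨x, hx, hxQ⟩ := h.isComponent.nonempty
    exact ⟨_, ⟨x, hx, rfl⟩, fun hs => hxQ ((hmem hx).1 hs)⟩
  · rintro _ ⟨x, hx, rfl⟩ hxQ
    rw [hmem hx] at hxQ
    obtain ⟨p, hp, ha, rfl⟩ := h.level x hx hxQ
    rw [hG.shift_own L' hp]
    exact (hT.wires L' p hL' (hG.own_sib hr he hp)).2 (Or.inl s1)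
  · rintro _ ⟨x, hx, rfl⟩ hm w hw
    have hxQ : x ∉ Q := fun hxQ => multPorts_not_expPorts hm (hQ ((hmem hx).2 hxQ))
    obtain ⟨p, hp, ha, rfl⟩ := h.level x hx hxQ
    rw [hG.shift_own L' hp, hT.premises_unattached hG hL' (hG.own_sib hr he hp)
      (hG.not_attached_sib hr he ha), ← s4] at hw
    obtain ⟨q, hq, rfl⟩ := hw
    have hown := hG.own_wire hq.1
    have hqm : D.emb L q ∈ S.ground.premises (D.emb L p) := by
      rw [hT.premises_unattached hG hL hp ha]
      exact ⟨q, hq, rfl⟩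
    have hqP := h.isComponent.closed _ hx hxQ _ (hT.wires_sub hqm.1) (Or.inr (Or.inl hqm))
    rw [← hG.shift_own L' hown, hmem hqP]
    intro hqQ
    have hmx : D.emb L p ∈ S.ground.multPorts := by
      have hl : S.ground.label (D.emb L p) = S.ground.label (D.shift L L' (D.emb L p)) := by
        rw [hG.shift_own L' hp, hT.label L p hL hp, hT.label L' p hL' (hG.own_sib hr he hp), s4]
      rcases hm with hm | hm
      · exact Or.inl ⟨h.isComponent.sub hx, hl.trans hm.2⟩
      · exact Or.inr ⟨h.isComponent.sub hx, hl.trans hm.2⟩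
    exact h.isComponent.mult _ hx hmx _ hqm hqQ
  · rintro _ ⟨x, hx, rfl⟩ hxQ
    rw [hmem hx] at hxQ
    obtain ⟨p, hp, ha, rfl⟩ := h.level x hx hxQ
    exact ⟨p, hG.own_sib hr he hp, hG.not_attached_sib hr he ha, (hG.shift_own L' hp).symm⟩

/-- The renaming is itself the isomorphism; siblings have equal contents, so the identity works
inside the boxes. -/
theorem same_shift (hT : D.Describes i S) (hG : D.Good k e) (h : D.IsLevelComponent i S Q L P)
    (hr : L ≠ D.root) (he : D.exp L = D.exp L') (hQ : Q ⊆ S.ground.expPorts)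
    (hQa : ∀ M p, D.Own M p → D.emb M p ∈ Q → D.Attached i M p)
    (hPL : ∀ q ∈ P, q ∈ Q → D.lv q ≠ L) (hQb : ∀ x ∈ Q, x ∉ S.boxes) :
    (S.restrict Q P).Same (S.restrict Q (D.shift L L' '' P)) := by
  obtain ⟨s1, s2, s3, s4, s5⟩ := hG.sib hr he
  have hL := h.active
  have hL' := hG.active_sib he hL
  have hS := hT.isDiffPS hG
  have hmem : ∀ {x}, x ∈ P → (D.shift L L' x ∈ Q ↔ x ∈ Q) := fun hx =>
    h.shift_mem_iff hT hG hr he hQa hPL hx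
  have hfix : ∀ {x}, x ∈ P → x ∈ Q → D.shift L L' x = x := fun hx hxQ =>
    h.shift_bound hT hG hPL hx hxQ
  have h' := h.image_shift hT hG hr he hQ hQa hPL
  have himg : ∀ {x}, x ∈ P → D.shift L L' x ∈ D.shift L L' '' P := fun hx => ⟨_, hx, rfl⟩
  have hwires : ∀ x ∈ P, (x ∈ (S.restrict Q P).ground.wires ↔
      D.shift L L' x ∈ (S.restrict Q (D.shift L L' '' P)).ground.wires) := by
    intro x hx
    rw [h.isComponent.mem_wires hS, h'.isComponent.mem_wires hS, hmem hx]
    exact and_congr_left fun _ => iff_of_true hx (himg hx)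
  have hbox : ∀ b ∈ P, b ∈ S.boxes → ∃ o : (D.cont L).boxes, ((D.cont L).content o).depth < i ∧
      D.emb L o = b := by
    intro b hb hbS
    obtain ⟨p, hp, -, rfl⟩ := h.level b hb fun hQ => hQb b hQ hbS
    obtain ⟨M, o, hM, ho, heq⟩ := (hT.boxes _).1 hbS
    obtain ⟨rfl, rfl⟩ := hG.emb_inj _ _ _ _ (hG.own_box o) hp heq
    exact ⟨o, ho, rfl⟩
  refine ⟨D.shift L L', ?_, ?_⟩
  · rw [isIso_iff]
    refine ⟨⟨⟨fun x hx => himg hx, h.injOn_shift hT hG hr he hPL, fun x hx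
      => hx⟩, hwires, ?_, ?_, ?_, ?_⟩,
      ?_, ?_⟩
    · intro x hx
      have hx : x ∈ P := hx
      rw [restrict_label (himg hx), restrict_label hx]
      by_cases hxQ : x ∈ Q
      · rw [hfix hx hxQ]
      · obtain ⟨p, hp, ha, rfl⟩ := h.level x hx hxQ
        rw [hG.shift_own L' hp, hT.label L p hL hp, hT.label L' p hL' (hG.own_sib hr he hp), s4]
    · intro w hw
      rw [restrict_target hw, restrict_target ((hwires w hw.2.1).1 hw)]
      obtain ⟨p, hp, ha, rfl⟩ := h.level w hw.2.1 hw.2.2.1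
      rw [hG.shift_own L' hp, hT.target_shift hG hr hL he hp]
    · intro x hx
      by_cases hxQ : x ∈ Q
      · refine iff_of_false (fun hl => ?_) fun hl => ?_
        · have := ((h.isComponent.isDiffPS hS hQ hQb).1.ground.left_sub _ hl).1
          exact ((h.isComponent.mem_wires hS).1 this).2 hxQ
        · have := ((h'.isComponent.isDiffPS hS hQ hQb).1.ground.left_sub _ hl).1
          exact ((h'.isComponent.mem_wires hS).1 this).2 ((hmem hx).2 hxQ)
      · rw [h.isComponent.mem_restrict_left hS hx hxQ,
          h'.isComponent.mem_restrict_left hS (himg hx) fun hs => hxQ ((hmem hx).1 hs)]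
        obtain ⟨p, hp, ha, rfl⟩ := h.level x hx hxQ
        rw [hG.shift_own L' hp, hT.left L p hL hp, hT.left L' p hL' (hG.own_sib hr he hp), s4]
    · intro x hx
      have hx : x ∈ P := hx
      rw [restrict_ty (himg hx), restrict_ty hx]
      by_cases hxQ : x ∈ Q
      · rw [hfix hx hxQ]
      · obtain ⟨p, hp, ha, rfl⟩ := h.level x hx hxQ
        rw [hG.shift_own L' hp, hT.ty L p hL hp, hT.ty L' p hL' (hG.own_sib hr he hp), s4]
    · ext b
      constructor
      · rintro ⟨hb, x, hx, rfl⟩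
        refine ⟨x, ⟨?_, hx⟩, rfl⟩
        have hxQ : x ∉ Q := fun hxQ => hQb _ ((hmem hx).2 hxQ) hb
        obtain ⟨p, hp, ha, rfl⟩ := h.level x hx hxQ
        rw [hG.shift_own L' hp] at hb
        obtain ⟨M, o, hM, ho, heq⟩ := (hT.boxes _).1 hb
        obtain ⟨rfl, rfl⟩ := hG.emb_inj _ _ _ _ (hG.own_box o) (hG.own_sib hr he hp) heq
        obtain ⟨o', h1, -, h3⟩ := exists_box_of_eq s4.symm o
        exact (hT.boxes _).2 ⟨L, o', hL, by rwa [h3], by rw [h1]⟩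
      · rintro ⟨x, ⟨hb, hx⟩, rfl⟩
        obtain ⟨o, ho, rfl⟩ := hbox x hx hb
        refine ⟨?_, himg hx⟩
        rw [hG.shift_own L' (hG.own_box o)]
        obtain ⟨o', h1, -, h3⟩ := exists_box_of_eq s4 o
        exact (hT.boxes _).2 ⟨L', o', hL', by rwa [h3], by rw [h1]⟩
    · rintro ⟨b, hb, hbP⟩ ⟨b', hb', hbP'⟩ heq
      have heq : b' = D.shift L L' b := heq
      obtain ⟨o, ho, rfl⟩ := hbox b hbP hb
      obtain ⟨o', h1, h2, h3⟩ := exists_box_of_eq s4 o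
      rw [hG.shift_own L' (hG.own_box o), ← h1] at heq
      refine ⟨id, ?_, fun q _ => ?_⟩
      · show (S.content ⟨D.emb L o, hb⟩).IsIso (S.content ⟨b', hb'⟩) id
        rw [hT.content L hL o ⟨D.emb L o, hb⟩ rfl, hT.content L' hL' o' _ heq, h3]
        exact .refl _
      · show S.door ⟨b', hb'⟩ q = (S.door ⟨D.emb L o, hb⟩ q).map _
        rw [hT.door L hL o ⟨D.emb L o, hb⟩ rfl, hT.door L' hL' o' _ heq, h2, Option.map_map]
        refine Option.map_congr fun x hx => ?_
        exact (hG.shift_emb hr hL he ((hG.circ L).pre.door_ports hx)).symm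
  · intro p hp
    obtain ⟨h1, h2⟩ := (h.isComponent.mem_conclusions hS).1 hp
    exact hfix h1 h2

end IsLevelComponent
end LevelData
end Net
end MELL

/-! ### Counting the components in an isomorphism class. -/

namespace MELL

theorem exists_bijOn_of_fibers {ι κ γ : Type*} [Nonempty κ] {A : Set ι} {B : Set κ} (hA : A.Finite)
    (hB : B.Finite) (f : ι → γ) (g : κ → γ)
    (h : ∀ c, {a | a ∈ A ∧ f a = c}.ncard = {b | b ∈ B ∧ g b = c}.ncard) :
    ∃ β : ι → κ, Set.BijOn β A B ∧ ∀ a ∈ A, g (β a) = f a := by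
  classical
  have hcard : ∀ c, Nonempty ({a : A // f a = c} ≃ {b : B // g b = c}) := by
    intro c
    have := hA.to_subtype
    have := hB.to_subtype
    have h1 : Nat.card {a : A // f a = c} = {a | a ∈ A ∧ f a = c}.ncard :=
      Nat.card_congr (Equiv.subtypeSubtypeEquivSubtypeInter (· ∈ A) (fun a => f a = c))
    have h2 : Nat.card {b : B // g b = c} = {b | b ∈ B ∧ g b = c}.ncard :=
      Nat.card_congr (Equiv.subtypeSubtypeEquivSubtypeInter (· ∈ B) (fun b => g b = c))
    exact Finite.card_eq.1 (by rw [h1, h2, h c])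
  let E : A ≃ B := Equiv.ofFiberEquiv (f := fun a : A => f a) (g := fun b : B => g b)
    fun c => (hcard c).some
  have hE : ∀ a : A, g (E a) = f a := fun a =>
    Equiv.ofFiberEquiv_map (f := fun a : A => f a) (g := fun b : B => g b) _ a
  refine ⟨fun a => if ha : a ∈ A then E ⟨a, ha⟩ else Classical.arbitrary κ, ⟨?_, ?_, ?_⟩, ?_⟩
  · intro a ha
    simp [ha]
  · intro a ha b hb hab
    simp only [ha, hb, dif_pos] at hab
    exact congrArg Subtype.val (E.injective (Subtype.ext hab))
  · intro b hb
    refine ⟨(E.symm ⟨b, hb⟩).1, (E.symm ⟨b, hb⟩).2, ?_⟩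
    simp
  · intro a ha
    simp only [ha, dif_pos]
    exact hE ⟨a, ha⟩

namespace Net

variable {α β : Type u}

namespace LevelData

variable {R : Net α α} {k i : ℕ} {e : R.PseudoExp} {D : LevelData R} {S : Net α R.Name}

namespace Describes

variable {L₁ : D.Lv}

/-- Less than `k` components of a level have a given isomorphism class. -/
theorem level_ncard_lt (hT : D.Describes i S) (hG : D.Good k e) (hk : 0 < k) {Q P₀ : Set R.Name}
    (h₀ : IsComponent S Q P₀) (L : D.Lv) :
    {P | D.IsLevelComponent i S Q L P ∧ (S.restrict Q P).Same (S.restrict Q P₀)}.ncard < k := by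
  have hS := hT.isDiffPS hG
  obtain ⟨q, hqP, hqQ, w₀, hw₀, hw₀P, hw₀Q⟩ := h₀.exists_premise hS
  have key : ∀ P, ∃ w, P ∈ {P | D.IsLevelComponent i S Q L P ∧
      (S.restrict Q P).Same (S.restrict Q P₀)} → w ∈ S.ground.premises q ∧ w ∈ P ∧ w ∉ Q := by
    intro P
    by_cases hP : P ∈ {P | D.IsLevelComponent i S Q L P ∧ (S.restrict Q P).Same (S.restrict Q P₀)}
    swap
    · exact ⟨q, fun h => (hP h).elim⟩
    obtain ⟨hPL, hsame⟩ := hP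
    have hc := hsame.conclusions
    obtain ⟨φ, hφ, hfix⟩ := hsame
    have hqc : q ∈ (S.restrict Q P).conclusions := by
      rw [hc]
      exact (h₀.mem_conclusions hS).2 ⟨hqP, hqQ⟩
    -- The isomorphism fixes the conclusion `q`, so the premise `w₀` of `q` pulls back to a premise
    -- of `q` in `P`. Distinct components yield distinct premises, and those from the level `L` are
    -- fewer than `k`.
    obtain ⟨hw1, hw2⟩ := (mem_restrict_premises (Q := Q) (P := P₀)).2 ⟨hw₀, hw₀P, hw₀Q, hqP⟩
    obtain ⟨w, hw, rfl⟩ := hφ.ground.bij.surjOn (show w₀ ∈ (S.restrict Q P₀).ground.ports from hw₀P)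
    have hww := (hφ.ground.wires w hw).2 hw1
    rw [hφ.ground.target w hww, Option.map_eq_some_iff] at hw2
    obtain ⟨y, hy, hyq⟩ := hw2
    obtain ⟨-, h2, h3⟩ := restrict_target_some hy
    obtain rfl : y = q := hφ.ground.bij.injOn h3 hqc.1 (by rw [hyq, hfix q hqc])
    exact ⟨w, fun _ => ⟨⟨hww.1, h2⟩, hww.2.1, hww.2.2.1⟩⟩
  choose f hf using key
  obtain ⟨M, p, hM, hp, hMp⟩ := (hT.ports q).1 (h₀.sub hqP)
  refine lt_of_le_of_lt ?_ (hT.levelArity_lt hG (L := L) hk hp)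
  refine le_trans ?_ (Nat.le_add_right _ _)
  rw [hMp]
  refine Set.ncard_le_ncard_of_injOn f ?_ ?_ ?_
  · intro P hP
    obtain ⟨h1, h2, h3⟩ := hf P hP
    exact ⟨h1, hP.1.lv_eq hG h2 h3⟩
  · intro P hP P' hP' hPP
    obtain ⟨h1, h2, h3⟩ := hf P hP
    obtain ⟨h1', h2', h3'⟩ := hf P' hP'
    exact hP.1.isComponent.eq_of_mem hP'.1.isComponent h2 (hPP ▸ h2') h3
  · exact hS.1.ground.finite_ports.subset fun w hw => (hS.1.ground.wires_sub w hw.1.1).1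

/-- The digit that is wanted counts the components of an isomorphism class in the level `L₁`. -/
theorem digit_ncard_class (hT : D.Describes i S) (hG : D.Good k e) (hk : 1 < k) (hr : L₁ ≠ D.root)
    (hL₁ : D.Active i L₁) {P₀ : Set R.Name} (h₀ : IsComponent S (D.doors L₁) P₀) :
    digit k {T | T ∈ S.components (D.doors L₁) ∅ k ∧
      T.Same (S.restrict (D.doors L₁) P₀)}.ncard (D.exp L₁) =
    {P | D.IsLevelComponent i S (D.doors L₁) L₁ P ∧
      (S.restrict (D.doors L₁) P).Same (S.restrict (D.doors L₁) P₀)}.ncard := by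
  have := hG.finite
  have hS := hT.isDiffPS hG
  have hQ := hT.doors_sub hG hr hL₁
  have hQb := hT.doors_not_box hG hr hL₁
  have hQa : ∀ M p, D.Own M p → D.emb M p ∈ D.doors L₁ → D.Attached i M p := fun M p hp h =>
    (hT.own_of_mem_doors hG hr hL₁ hp h).1
  have hrank₁ := hG.rank_par L₁ hr
  have hQrank : ∀ x ∈ S.ports, x ∈ D.doors L₁ → D.rank (D.lv x) < D.rank L₁ := by
    intro x hx hxQ
    obtain ⟨M, p, hM, hp, rfl⟩ := (hT.ports x).1 hx
    have := (hT.own_of_mem_doors hG hr hL₁ hp hxQ).2.rank_le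
    rw [hG.lv_emb hp]
    omega
  set Q := D.doors L₁ with hQdef
  set A : D.Lv → Set (Set R.Name) := fun L => {P | D.IsLevelComponent i S Q L P ∧
    (S.restrict Q P).Same (S.restrict Q P₀)} with hA
  have hAfin : ∀ L, (A L).Finite := fun L =>
    hS.1.ground.finite_ports.finite_subsets.subset fun P hP => hP.1.isComponent.sub
  have hclass : {T | T ∈ S.components Q ∅ k ∧ T.Same (S.restrict Q P₀)}
    = S.restrict Q '' ⋃ L, A L := by
    ext T
    constructor
    · rintro ⟨hT', hs⟩
      obtain ⟨P, hP, rfl, hc⟩ := (mem_components_iff hS hQ hQb).1 hT'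
      obtain ⟨L, hL⟩ := hT.exists_isLevelComponent hG hk hr hL₁ hP hc
      exact ⟨P, Set.mem_iUnion.2 ⟨L, hL, hs⟩, rfl⟩
    · rintro ⟨P, hP, rfl⟩
      obtain ⟨L, hL, hs⟩ := Set.mem_iUnion.1 hP
      exact ⟨(mem_components_iff hS hQ hQb).2 ⟨P, hL.isComponent, rfl,
        hL.cosize_lt hT hG (by omega) hQ hQb⟩, hs⟩
  have hsum : {T | T ∈ S.components Q ∅ k ∧ T.Same (S.restrict Q P₀)}.ncard = ∑ᶠ L,
    (A L).ncard := by
    rw [hclass, Set.InjOn.ncard_image, Set.ncard_iUnion_of_finite hAfin]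
    · intro L L' hne
      exact Set.disjoint_left.2 fun P hP hP' => hne (hP.1.level_unique hG hP'.1)
    · intro P _ P' _ h
      exact congrArg Net.ports h
  have hconc : ∀ {L P}, P ∈ A L → ∀ x, (x ∈ P ∧ x ∈ Q ↔ x ∈ P₀ ∧ x ∈ Q) := by
    intro L P hP x
    rw [← hP.1.isComponent.mem_conclusions hS, ← h₀.mem_conclusions hS, hP.2.conclusions]
  obtain ⟨q₀, hq₀P, hq₀Q, -⟩ := h₀.exists_premise hS
  -- All the members of the class contain `q`, so they lie in the level `ℓ` of `q` or in a level of
  -- larger rank. Maximality ensures that in the second case no conclusion is in the level of the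
  -- component, which is what the renaming needs.
  obtain ⟨q, ⟨hqP, hqQ⟩, hmax⟩ := Set.exists_max_image {q | q ∈ P₀ ∧ q ∈ Q}
    (fun q => D.rank (D.lv q)) (hS.1.ground.finite_ports.subset fun w hw => h₀.sub hw.1)
    ⟨q₀, hq₀P, hq₀Q⟩
  set ℓ := D.lv q with hℓ
  have hne : ∀ L, (A L).ncard ≠ 0 → L = ℓ ∨ D.rank ℓ < D.rank L := by
    intro L h
    obtain ⟨P, hP⟩ := Set.nonempty_of_ncard_ne_zero h
    exact (hP.1.lv_of_mem hT hG ((hconc hP q).2 ⟨hqP, hqQ⟩).1).imp_left Eq.symm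
  have hroot : ∀ L, D.exp L = D.exp D.root → L = D.root := by
    intro L h
    by_contra hL
    have := hG.exp_pos L hL
    rw [h, hG.exp_root] at this
    omega
  have hle : ∀ L L', L ≠ D.root → D.exp L = D.exp L' → D.exp L ≠ D.exp ℓ →
      (A L).ncard ≤ (A L').ncard := by
    intro L L' hL he hℓL
    by_cases h0 : (A L).ncard = 0
    · omega
    have hrk : D.rank ℓ < D.rank L := (hne L h0).resolve_left fun h => hℓL (by rw [h])
    have hPL : ∀ P ∈ A L, ∀ q ∈ P, q ∈ Q → D.lv q ≠ L := by
      intro P hP x hx hxQ hlv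
      have := hmax x ((hconc hP x).1 ⟨hx, hxQ⟩)
      simp only [hlv] at this
      omega
    refine Set.ncard_le_ncard_of_injOn (fun P => D.shift L L' '' P) ?_ ?_ (hAfin L')
    · intro P hP
      have h1 := hP.1.image_shift hT hG hL he hQ hQa (hPL P hP)
      refine ⟨h1, ?_⟩
      have h2 := hP.1.same_shift hT hG hL he hQ hQa (hPL P hP) hQb
      have h3 := h2.symm (hP.1.isComponent.isDiffPS hS hQ hQb) (h1.isComponent.isDiffPS hS hQ hQb)
      exact h3.trans (h1.isComponent.isDiffPS hS hQ hQb) hP.2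
    · intro P hP P' hP' hPP
      have hPP : D.shift L L' '' P = D.shift L L' '' P' := hPP
      obtain ⟨x, hx, hxQ⟩ := hP.1.isComponent.nonempty
      have hx' : D.shift L L' x ∈ D.shift L L' '' P' := hPP ▸ ⟨x, hx, rfl⟩
      obtain ⟨y, hy, hxy⟩ := hx'
      have hyQ : y ∉ Q := fun h => hxQ
        ((hP.1.shift_mem_iff hT hG hL he hQa (hPL P hP) hx).1
          (hxy ▸ (hP'.1.shift_mem_iff hT hG hL he hQa (hPL P' hP') hy).2 h))
      obtain ⟨p, hp, -, rfl⟩ := hP.1.level x hx hxQ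
      obtain ⟨p', hp', -, rfl⟩ := hP'.1.level y hy hyQ
      rw [hG.shift_own L' hp, hG.shift_own L' hp'] at hxy
      obtain ⟨-, rfl⟩ := hG.emb_inj _ _ _ _ (hG.own_sib hL he hp') (hG.own_sib hL he hp) hxy
      exact hP.1.isComponent.eq_of_mem hP'.1.isComponent hx hy hxQ
  rw [hsum]
  refine (hG.digit_finsum hk (fun L => (A L).ncard) (fun L => hT.level_ncard_lt hG (by omega) h₀ L)
    ℓ ?_ ?_ ?_).1 L₁ hr ?_
  · intro L he hLℓ
    by_contra h
    have h1 := (hne L h).resolve_left hLℓ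
    by_cases hL : L = D.root
    · exact hLℓ (by rw [hroot ℓ (by rw [← he, hL]), hL])
    · have := (hG.sib hL he).2.2.2.2
      omega
  · intro hℓr
    by_contra h
    have h1 := (hne _ h).resolve_left (Ne.symm hℓr)
    rw [hG.rank_root] at h1
    omega
  · intro L L' he hℓL
    by_cases hL : L = D.root
    · rw [hL, hroot L' (by rw [← he, hL])]
    · have hL' := (hG.sib hL he).1
      exact (hle L L' hL he hℓL).antisymm (hle L' L hL' he.symm (he ▸ hℓL))
  -- Siblings have the same rank, while the doors of the box of `L₁` are owned by lower ranks; so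
  -- `L₁` is outside the exceptional class.
  · intro he
    have h1 := (hG.sib hr he).2.2.2.2
    have h2 := hQrank q (h₀.sub hqP) hqQ
    rw [← hℓ] at h2
    omega

/-- The chosen components are isomorphic to those of the level `L₁`. -/
theorem exists_matching (hT : D.Describes i S) (hG : D.Good k e) (hk : 1 < k) (hr : L₁ ≠ D.root)
    (hL₁ : D.Active i L₁) {U : Set (Net α R.Name)} (hU : U ⊆ S.components (D.doors L₁) ∅ k)
    (hcard : ∀ T ∈ S.components (D.doors L₁) ∅ k, {T' | T' ∈ U ∧ T'.Same T}.ncard =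
      digit k {T' | T' ∈ S.components (D.doors L₁) ∅ k ∧ T'.Same T}.ncard (D.exp L₁)) :
    ∃ f : Set R.Name → Net α R.Name,
      Set.BijOn f {P | D.IsLevelComponent i S (D.doors L₁) L₁ P} U ∧
      ∀ P, D.IsLevelComponent i S (D.doors L₁) L₁ P → (S.restrict (D.doors L₁) P).Same (f P) := by
  have hS := hT.isDiffPS hG
  have hQ := hT.doors_sub hG hr hL₁
  have hQb := hT.doors_not_box hG hr hL₁
  have hmem : ∀ {P}, D.IsLevelComponent i S (D.doors L₁) L₁ P →
      S.restrict (D.doors L₁) P ∈ S.components (D.doors L₁) ∅ k := fun {P} hP =>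
    (mem_components_iff hS hQ hQb).2 ⟨P, hP.isComponent, rfl, hP.cosize_lt hT hG (by omega) hQ hQb⟩
  have hdiff : ∀ T ∈ S.components (D.doors L₁) ∅ k, T.IsDiffPS := fun T hT' => hT'.1.1.diff
  set 𝒯 := S.components (D.doors L₁) ∅ k with h𝒯
  have hfin : 𝒯.Finite := by
    refine (hS.1.ground.finite_ports.finite_subsets.image (S.restrict (D.doors L₁))).subset ?_
    intro T hT'
    obtain ⟨P, hP, rfl, -⟩ := (mem_components_iff hS hQ hQb).1 hT'
    exact ⟨P, hP.sub, rfl⟩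
  -- `g` sends a component to its equivalence class, so that the matching only requires equal
  -- cardinalities of the fibres of `g`.
  set g : Net α R.Name → Set (Net α R.Name) := fun T => {T' | T' ∈ 𝒯 ∧ T'.Same T} with hg
  have hgiff : ∀ T ∈ 𝒯, ∀ T' ∈ 𝒯, g T = g T' ↔ T.Same T' := by
    intro T h T' h'
    constructor
    · intro heq
      have : T ∈ g T' := heq ▸ ⟨h, .refl T⟩
      exact this.2
    · intro hs
      ext X
      constructor
      · rintro ⟨hX, hXT⟩
        exact ⟨hX, hXT.trans (hdiff X hX) hs⟩
      · rintro ⟨hX, hXT⟩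
        exact ⟨hX, hXT.trans (hdiff X hX) (hs.symm (hdiff T h) (hdiff T' h'))⟩
  have : Nonempty (Net α R.Name) := ⟨S⟩
  have hfib : ∀ c, {P | P ∈ {P | D.IsLevelComponent i S (D.doors L₁) L₁ P} ∧
      g (S.restrict (D.doors L₁) P) = c}.ncard = {b | b ∈ U ∧ g b = c}.ncard := by
    intro c
    by_cases hc : ∃ T₀ ∈ 𝒯, g T₀ = c
    · obtain ⟨T₀, hT₀, rfl⟩ := hc
      obtain ⟨P₀, hP₀, rfl, -⟩ := (mem_components_iff hS hQ hQb).1 hT₀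
      have h1 : {b | b ∈ U ∧ g b = g (S.restrict (D.doors L₁) P₀)} =
          {T' | T' ∈ U ∧ T'.Same (S.restrict (D.doors L₁) P₀)} :=
        Set.ext fun T => and_congr_right fun hTU => hgiff T (hU hTU) _ hT₀
      rw [h1, hcard _ hT₀, hT.digit_ncard_class hG hk hr hL₁ hP₀]
      congr 1
      exact Set.ext fun P => and_congr_right fun hP => hgiff _ (hmem hP) _ hT₀
    · have h1 : {P | P ∈ {P | D.IsLevelComponent i S (D.doors L₁) L₁ P} ∧
          g (S.restrict (D.doors L₁) P) = c} = ∅ :=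
        Set.eq_empty_of_forall_notMem fun P hP => hc ⟨_, hmem hP.1, hP.2⟩
      have h2 : {b | b ∈ U ∧ g b = c} = ∅ :=
        Set.eq_empty_of_forall_notMem fun T hT' => hc ⟨_, hU hT'.1, hT'.2⟩
      rw [h1, h2, Set.ncard_empty, Set.ncard_empty]
  obtain ⟨f, hf, hfg⟩ := exists_bijOn_of_fibers (hS.1.ground.finite_ports.finite_subsets.subset
    fun P hP => IsComponent.sub (IsLevelComponent.isComponent hP)) (hfin.subset hU)
    (fun P => g (S.restrict (D.doors L₁) P)) g hfib
  exact ⟨f, hf, fun P hP => (hgiff _ (hmem hP) _ (hU (hf.mapsTo hP))).1 (hfg P hP).symm⟩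

end Describes
end LevelData
end Net
end MELL

/-! ### Boxing, parts of a net and glueing. -/

namespace MELL
namespace Net

variable {α β γ : Type u}

/-- The conclusions of `S` that are doors of boxes of `S`. -/
def boxDoors (S : Net α β) : Set β :=
  {q | q ∈ S.conclusions ∧ ∃ (o : S.boxes) (p : α), S.door o p = some q}

/-- The wires of the boxed version of `S`. -/
def boxedWires (S : Net α β) : Set β :=
  {w | w ∈ S.ground.wires ∧ ∃ q ∈ S.ground.wires, S.ground.target w = some q}

section boxed

variable {S : Net α β} {x : β}

theorem boxed_boxes : S.boxed.boxes = S.boxes := rfl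

theorem boxed_left : S.boxed.ground.left = S.ground.left ∩ S.boxedWires := rfl

theorem boxed_label_wire (h : x ∈ S.ground.wires) : S.boxed.ground.label x = S.ground.label x :=
  if_pos h

theorem boxed_label_door (h : x ∈ S.boxDoors) : S.boxed.ground.label x = some .circ :=
  (if_neg h.1.2).trans (if_pos h)

theorem boxed_label_none (h : x ∉ S.boxed.ports) : S.boxed.ground.label x = none :=
  (if_neg fun h' => h (Or.inl h')).trans (if_neg fun h' => h (Or.inr h'))

theorem boxed_ty (h : x ∈ S.boxed.ports) : S.boxed.ground.ty x = S.ground.ty x := if_pos h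

theorem boxed_ty_none (h : x ∉ S.boxed.ports) : S.boxed.ground.ty x = none := if_neg h

theorem boxed_target (h : x ∈ S.boxedWires) : S.boxed.ground.target x
    = S.ground.target x := if_pos h

theorem boxed_target_none (h : x ∉ S.boxedWires) : S.boxed.ground.target x = none := if_neg h

end boxed

theorem IsIso.boxDoors {S : Net α β} {S' : Net α γ} {φ : β → γ} (hS : S.IsDiffPS)
    (hS' : S'.IsDiffPS) (h : S.IsIso S' φ) {x : β} (hx : x ∈ S.ports) :
    x ∈ S.boxDoors ↔ φ x ∈ S'.boxDoors := by
  have hg := h.ground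
  obtain ⟨-, hb, hc⟩ := (isIso_iff _ _ _).1 h
  constructor
  · rintro ⟨h1, o, p, hd⟩
    obtain ⟨ψ, h2, h3⟩ := hc o ⟨φ o, hb.symm.subset ⟨o, o.2, rfl⟩⟩ rfl
    refine ⟨hg.conclusions h1, ⟨φ o, hb.symm.subset ⟨o, o.2, rfl⟩⟩, ψ p, ?_⟩
    rw [h3 p ((hS.1.door_dom o p).2 (by simp [hd])), hd, Option.map_some]
  · rintro ⟨h1, o', p', hd⟩
    refine ⟨⟨hx, fun hw => h1.2 ((hg.wires x hx).1 hw)⟩, ?_⟩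
    obtain ⟨o, ho, hoo⟩ := hb.subset o'.2
    obtain ⟨ψ, h2, h3⟩ := hc ⟨o, ho⟩ o' hoo.symm
    obtain ⟨p, hp, rfl⟩ := h2.ground.exists_conclusion
      ((hS'.1.door_dom o' p').2 (by simp [hd]))
    rw [h3 p hp, Option.map_eq_some_iff] at hd
    obtain ⟨y, hy, hyx⟩ := hd
    obtain rfl := hg.bij.injOn (hS.1.door_ports hy) hx hyx
    exact ⟨_, p, hy⟩

theorem IsIso.boxed {S : Net α β} {S' : Net α γ} {φ : β → γ} (hS : S.IsDiffPS) (hS' : S'.IsDiffPS)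
    (h : S.IsIso S' φ) : S.boxed.IsIso S'.boxed φ := by
  have hg := h.ground
  have hsub : S.boxed.ports ⊆ S.ports := by
    rintro x (hx | hx)
    · exact (hS.1.ground.wires_sub x hx).1
    · exact hx.1.1
  have hport : ∀ {x}, x ∈ S.ports → (x ∈ S.boxed.ports ↔ φ x ∈ S'.boxed.ports) := fun hx =>
    or_congr (hg.wires _ hx) (h.boxDoors hS hS' hx)
  have hwires : ∀ x ∈ S.ports, (x ∈ S.boxedWires ↔ φ x ∈ S'.boxedWires) := by
    intro x hx
    constructor
    · rintro ⟨h1, q, hq, h2⟩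
      refine ⟨(hg.wires x hx).1 h1, φ q, (hg.wires q (hS.1.ground.wires_sub q hq).1).1 hq, ?_⟩
      rw [hg.target x h1, h2, Option.map_some]
    · rintro ⟨h1, q', hq', h2⟩
      have h3 := (hg.wires x hx).2 h1
      rw [hg.target x h3, Option.map_eq_some_iff] at h2
      obtain ⟨q, hq, rfl⟩ := h2
      exact ⟨h3, q, (hg.wires q (hS.1.ground.target_mem _ _ hq).1).2 hq', hq⟩
  obtain ⟨-, hb, hc⟩ := (isIso_iff _ _ _).1 h
  rw [isIso_iff]
  refine ⟨⟨⟨fun x hx => (hport (hsub hx)).1 hx, hg.bij.injOn.mono hsub, ?_⟩, ?_, ?_, ?_, ?_, ?_⟩,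
    hb, hc⟩
  · intro x' hx'
    have hx'' : x' ∈ S'.ports := by
      rcases hx' with hx' | hx'
      · exact (hS'.1.ground.wires_sub x' hx').1
      · exact hx'.1.1
    obtain ⟨x, hx, rfl⟩ := hg.bij.surjOn hx''
    exact ⟨x, (hport hx).2 hx', rfl⟩
  · exact fun x hx => hwires x (hsub hx)
  · intro x hx
    by_cases hw : x ∈ S.ground.wires
    · rw [boxed_label_wire hw, boxed_label_wire ((hg.wires x (hsub hx)).1 hw), hg.label x (hsub hx)]
    · have hd : x ∈ S.boxDoors := hx.resolve_left hw
      rw [boxed_label_door hd, boxed_label_door ((h.boxDoors hS hS' (hsub hx)).1 hd)]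
  · intro w hw
    have hwS : w ∈ S.ports := (hS.1.ground.wires_sub w hw.1).1
    rw [boxed_target hw, boxed_target ((hwires w hwS).1 hw), hg.target w hw.1]
  · exact fun x hx => and_congr (hg.left x (hsub hx)) (hwires x (hsub hx))
  · intro x hx
    rw [boxed_ty hx, boxed_ty ((hport (hsub hx)).1 hx), hg.ty x (hsub hx)]

/-- The ports `p` of `B` in `A`, renamed as `ρ p`, make up the net `V`. -/
structure IsPart (B : Net α α) (V : Net α β) (ρ : α → β) (A : Set α) : Prop where
  sub : A ⊆ B.ports
  bij : Set.BijOn ρ A V.ports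
  label : ∀ p ∈ A, V.ground.label (ρ p) = B.ground.label p
  ty : ∀ p ∈ A, V.ground.ty (ρ p) = B.ground.ty p
  wires : ∀ p ∈ A, (p ∈ B.ground.wires ↔ ρ p ∈ V.ground.wires)
  target : ∀ p ∈ A, ∀ q, B.ground.target p = some q → q ∈ A ∧ V.ground.target (ρ p) = some (ρ q)
  left : ∀ p ∈ A, (p ∈ B.ground.left ↔ ρ p ∈ V.ground.left)
  boxes : ∀ p ∈ A, (p ∈ B.boxes ↔ ρ p ∈ V.boxes)
  door_mem : ∀ (o : B.boxes) (p q : α), ↑o ∈ A → B.door o p = some q → q ∈ A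
  content : ∀ (o : B.boxes) (o' : V.boxes), ↑o ∈ A → (o' : β) = ρ ↑o →
    ∃ ψ : α → α, (B.content o).IsIso (V.content o') ψ ∧
      ∀ q ∈ (B.content o).conclusions, V.door o' (ψ q) = (B.door o q).map ρ

/-- This allows a piece to be replaced by an isomorphic one. The new map is constrained on `A` only,
so one global map can serve all the pieces. -/
theorem IsPart.comp {B : Net α α} (hB : B.IsDiffPS) {V : Net α β} {V' : Net α γ} {ρ : α → β}
    {A : Set α} (h : IsPart B V ρ A) {φ : β → γ} (hφ : V.IsIso V' φ) (hVb : V.boxes ⊆ V.ports)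
    {ρ' : α → γ} (hρ : ∀ p ∈ A, ρ' p = φ (ρ p)) : IsPart B V' ρ' A := by
  have hg := hφ.ground
  obtain ⟨-, hb, hc⟩ := (isIso_iff _ _ _).1 hφ
  have hm : ∀ p ∈ A, ρ p ∈ V.ports := fun p hp => h.bij.mapsTo hp
  refine ⟨h.sub, ?_, ?_, ?_, ?_, ?_, ?_, ?_, h.door_mem, ?_⟩
  · exact (Set.EqOn.bijOn_iff (fun p hp => hρ p hp)).2 (hg.bij.comp h.bij)
  · intro p hp
    rw [hρ p hp, hg.label _ (hm p hp), h.label p hp]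
  · intro p hp
    rw [hρ p hp, hg.ty _ (hm p hp), h.ty p hp]
  · intro p hp
    rw [hρ p hp, ← hg.wires _ (hm p hp), h.wires p hp]
  · intro p hp q hq
    obtain ⟨h1, h2⟩ := h.target p hp q hq
    refine ⟨h1, ?_⟩
    have hw : ρ p ∈ V.ground.wires :=
      (h.wires p hp).1 ((hB.1.ground.target_dom p).2 (by simp [hq]))
    rw [hρ p hp, hρ q h1, hg.target _ hw, h2, Option.map_some]
  · intro p hp
    rw [hρ p hp, ← hg.left _ (hm p hp), h.left p hp]
  · intro p hp
    rw [hρ p hp, h.boxes p hp, hb]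
    constructor
    · exact fun hpb => ⟨_, hpb, rfl⟩
    · rintro ⟨b, hbV, he⟩
      rwa [← hg.bij.injOn (hVb hbV) (hm p hp) he]
  · intro o o'' ho hoo
    have ho' := (h.boxes o ho).1 o.2
    obtain ⟨ψ, h1, h2⟩ := h.content o ⟨_, ho'⟩ ho rfl
    obtain ⟨ψ', h1', h2'⟩ := hc ⟨_, ho'⟩ o'' (by rw [hoo, hρ _ ho])
    refine ⟨ψ' ∘ ψ, h1.trans (hB.2 o).isDiffPS h1', fun q hq => ?_⟩
    rw [Function.comp_apply, h2' _ (h1.ground.conclusions hq), h2 q hq, Option.map_map]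
    exact Option.map_congr fun y hy => (hρ y (h.door_mem o q y ho hy)).symm

theorem unionMap_eq {ι γ : Type*} {U : Set ι} {f : ι → Option γ} {a : ι} (ha : a ∈ U) {c : γ}
    (hc : f a = some c) (h : ∀ b ∈ U, ∀ c', f b = some c' → c' = c) : unionMap U f = some c := by
  have hex : ∃ c, ∃ S ∈ U, f S = some c := ⟨c, a, ha, hc⟩
  obtain ⟨b, hb, hbc⟩ := hex.choose_spec
  rw [unionMap, dif_pos hex, h b hb _ hbc]

theorem glue_box (U : Set (Net α β)) (o : (glue U).boxes) : ∃ V ∈ U, ∃ h : (o : β) ∈ V.boxes,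
    (glue U).content o = V.content ⟨o, h⟩ ∧ (glue U).door o = V.door ⟨o, h⟩ :=
  ⟨o.2.choose, o.2.choose_spec.1, o.2.choose_spec.2, rfl, rfl⟩

/-- A net is isomorphic to the glueing of its parts. -/
theorem isIso_glue {B : Net α α} (hB : B.IsDiffPS) {U : Set (Net α β)} (hU : Gluable U) {ρ : α → β}
    (A : Net α β → Set α) (hA : ∀ V ∈ U, IsPart B V ρ (A V))
    (hcover : ∀ p ∈ B.ports, ∃ V ∈ U, p ∈ A V) (hcirc : Set.InjOn ρ B.circs)
    (hlabel : ∀ V ∈ U, ∀ x, V.ground.label x ≠ none → x ∈ V.ports)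
    (hty : ∀ V ∈ U, ∀ x, V.ground.ty x ≠ none → x ∈ V.ports)
    (htarget : ∀ V ∈ U, ∀ x, V.ground.target x ≠ none → x ∈ V.ports)
    (hwires : ∀ V ∈ U, V.ground.wires ⊆ V.ports) (hleft : ∀ V ∈ U, V.ground.left ⊆ V.ports)
    (hboxes : ∀ V ∈ U, V.boxes ⊆ V.ports) : B.IsIso (glue U) ρ := by
  have hinj : Set.InjOn ρ B.ports := by
    intro p hp q hq hpq
    obtain ⟨V, hV, hpV⟩ := hcover p hp
    obtain ⟨W, hW, hqW⟩ := hcover q hq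
    by_cases hVW : V = W
    · subst hVW
      exact (hA V hV).bij.injOn hpV hqW hpq
    -- A collision between two pieces happens at a port labelled `∘` in both, and the map is assumed
    -- injective there.
    · obtain ⟨h1, h2⟩ := hU V hV W hW hVW ⟨(hA V hV).bij.mapsTo hpV,
        hpq ▸ (hA W hW).bij.mapsTo hqW⟩
      refine hcirc ⟨hp, ?_⟩ ⟨hq, ?_⟩ hpq
      · rw [← (hA V hV).label p hpV]
        exact h1.2
      · rw [← (hA W hW).label q hqW, ← hpq]
        exact h2.2
  have hmem : ∀ V ∈ U, ∀ p ∈ B.ports, ρ p ∈ V.ports → p ∈ A V := by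
    intro V hV p hp h
    obtain ⟨q, hq, hqp⟩ := (hA V hV).bij.surjOn h
    rwa [← hinj ((hA V hV).sub hq) hp hqp]
  rw [isIso_iff]
  refine ⟨⟨⟨?_, hinj, ?_⟩, ?_, ?_, ?_, ?_, ?_⟩, ?_, ?_⟩
  · intro p hp
    obtain ⟨V, hV, hpV⟩ := hcover p hp
    exact ⟨V, hV, (hA V hV).bij.mapsTo hpV⟩
  · rintro x ⟨V, hV, hx⟩
    obtain ⟨p, hp, rfl⟩ := (hA V hV).bij.surjOn hx
    exact ⟨p, (hA V hV).sub hp, rfl⟩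
  · intro p hp
    constructor
    · intro hw
      obtain ⟨V, hV, hpV⟩ := hcover p hp
      exact ⟨V, hV, ((hA V hV).wires p hpV).1 hw⟩
    · rintro ⟨V, hV, hw⟩
      exact ((hA V hV).wires p (hmem V hV p hp (hwires V hV hw))).2 hw
  · intro p hp
    obtain ⟨V, hV, hpV⟩ := hcover p hp
    obtain ⟨l, hl⟩ := Option.ne_none_iff_exists'.1 ((hB.1.ground.label_dom p).1 hp)
    rw [hl]
    refine unionMap_eq hV (((hA V hV).label p hpV).trans hl) fun W hW c hc => ?_
    have := (hA W hW).label p (hmem W hW p hp (hlabel W hW _ (by simp [hc])))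
    rw [hc, hl, Option.some.injEq] at this
    exact this
  · intro p hp
    have hpp := (hB.1.ground.wires_sub p hp).1
    obtain ⟨V, hV, hpV⟩ := hcover p hpp
    obtain ⟨q, hq⟩ := Option.ne_none_iff_exists'.1 ((hB.1.ground.target_dom p).1 hp)
    rw [hq, Option.map_some]
    refine unionMap_eq hV ((hA V hV).target p hpV q hq).2 fun W hW c hc => ?_
    have := ((hA W hW).target p (hmem W hW p hpp (htarget W hW _ (by simp [hc]))) q hq).2
    rw [hc, Option.some.injEq] at this
    exact this
  · intro p hp
    constructor
    · intro hw
      obtain ⟨V, hV, hpV⟩ := hcover p hp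
      exact ⟨V, hV, ((hA V hV).left p hpV).1 hw⟩
    · rintro ⟨V, hV, hw⟩
      exact ((hA V hV).left p (hmem V hV p hp (hleft V hV hw))).2 hw
  · intro p hp
    obtain ⟨V, hV, hpV⟩ := hcover p hp
    obtain ⟨l, hl⟩ := Option.ne_none_iff_exists'.1 ((hB.1.ground.ty_dom p).1 hp)
    rw [hl]
    refine unionMap_eq hV (((hA V hV).ty p hpV).trans hl) fun W hW c hc => ?_
    have := (hA W hW).ty p (hmem W hW p hp (hty W hW _ (by simp [hc])))
    rw [hc, hl, Option.some.injEq] at this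
    exact this
  · ext x
    constructor
    · rintro ⟨V, hV, hx⟩
      obtain ⟨p, hp, rfl⟩ := (hA V hV).bij.surjOn (hboxes V hV hx)
      exact ⟨p, ((hA V hV).boxes p hp).2 hx, rfl⟩
    · rintro ⟨p, hp, rfl⟩
      obtain ⟨V, hV, hpV⟩ := hcover p (hB.1.boxes_sub_ports hp)
      exact ⟨V, hV, ((hA V hV).boxes p hpV).1 hp⟩
  · intro o o' ho
    obtain ⟨V, hV, hoV, h1, h2⟩ := glue_box U o'
    rw [h1, h2]
    refine (hA V hV).content o ⟨_, hoV⟩ ?_ ho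
    exact hmem V hV _ (hB.1.boxes_sub_ports o.2) (hboxes V hV (ho ▸ hoV))

end Net
end MELL

/-! ### Boxed components as parts of the content. -/

namespace MELL
namespace Net

variable {α β : Type u}

theorem boxed_ports_sub {S : Net α β} (hS : S.IsDiffPS) : S.boxed.ports ⊆ S.ports := by
  rintro x (hx | hx)
  · exact (hS.1.ground.wires_sub x hx).1
  · exact hx.1.1

namespace LevelData

variable {R : Net α α} {k i : ℕ} {e : R.PseudoExp} {D : LevelData R} {S : Net α R.Name}
  {Q P : Set R.Name} {L₁ L : D.Lv}

/-- A `!`-port outside `Q` is a box of the content of its level. As it is not attached, this box is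
not expanded, so it is kept as a box. -/
theorem IsLevelComponent.boxable (hT : D.Describes i S) (hG : D.Good k e)
    (h : D.IsLevelComponent i S Q L P) (hQ : Q ⊆ S.ground.expPorts) (hQb : ∀ x ∈ Q, x ∉ S.boxes) :
    (S.restrict Q P).Boxable := by
  have hS := hT.isDiffPS hG
  have hc := h.isComponent
  refine ⟨?_, ?_, ?_⟩
  · intro x hx
    obtain ⟨h1, h2⟩ := (hc.mem_conclusions hS).1 hx
    rcases hQ h2 with (h3 | h3) | h3
    · exact Or.inl (Or.inl ((mem_restrict_portsOf hc.sub).2 ⟨h1, h3⟩))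
    · exact Or.inl (Or.inr ((mem_restrict_portsOf hc.sub).2 ⟨h1, h3⟩))
    · exact Or.inr ((mem_restrict_portsOf hc.sub).2 ⟨h1, h3⟩)
  · refine Set.eq_empty_of_forall_notMem ?_
    rintro x ⟨h1, h2, -⟩
    exact hQb x ((hc.mem_conclusions hS).1 h1).2 h2
  · rintro x ⟨h1, h2⟩
    obtain ⟨h3, h4⟩ := (mem_restrict_portsOf hc.sub).1 h1
    refine (hc.mem_conclusions hS).2 ⟨h3, ?_⟩
    by_contra hxQ
    obtain ⟨p, hp, ha, rfl⟩ := h.level x h3 hxQ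
    have hb : p ∈ (D.cont L).boxes := by
      rw [(hG.circ L).boxes_eq]
      exact ⟨hp.1, by rw [← hT.label L p h.active hp]; exact h4.2⟩
    by_cases hi : ((D.cont L).content ⟨p, hb⟩).depth < i
    · exact h2 ⟨(hT.boxes _).2 ⟨L, ⟨p, hb⟩, h.active, hi, rfl⟩, h3⟩
    · exact ha ⟨⟨p, hb⟩, not_lt.1 hi, (hG.circ L).pre.door_main ⟨p, hb⟩⟩

/-- Distinct components share only ports of `Q`, and these survive boxing only as doors relabelled
`∘`. -/
theorem gluable_boxed (hS : S.IsDiffPS) {U : Set (Net α R.Name)}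
    (hU : ∀ T ∈ U, ∃ P, IsComponent S Q P ∧ T = S.restrict Q P) : Gluable (boxed '' U) := by
  rintro _ ⟨T, hT, rfl⟩ _ ⟨T', hT', rfl⟩ hne x ⟨hx, hx'⟩
  obtain ⟨P, hP, rfl⟩ := hU T hT
  obtain ⟨P', hP', rfl⟩ := hU T' hT'
  have hports : ∀ {P}, IsComponent S Q P → x ∈ (S.restrict Q P).boxed.ports → x ∈ P := by
    rintro P hP (h | h)
    · exact ((hP.mem_wires hS).1 h).1
    · exact ((hP.mem_conclusions hS).1 h.1).1
  have hxQ : x ∈ Q := by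
    by_contra hxQ
    exact hne (by rw [hP.eq_of_mem hP' (hports hP hx) (hports hP' hx') hxQ])
  have hcirc : ∀ {P}, IsComponent S Q P → x ∈ (S.restrict Q P).boxed.ports →
      x ∈ (S.restrict Q P).boxed.circs := by
    intro P hP h
    refine ⟨h, boxed_label_door (h.resolve_left fun hw => ((hP.mem_wires hS).1 hw).2 hxQ)⟩
  exact ⟨hcirc hP hx, hcirc hP' hx'⟩

/-- The boxed components of the level `L₁` are parts of the content of its box. -/
theorem isPart_boxed (hT : D.Describes i S) (hG : D.Good k e) (hr : L₁ ≠ D.root)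
    (hi : (D.cont L₁).depth = i) (h : D.IsLevelComponent i S (D.doors L₁) L₁ P) :
    IsPart (D.cont L₁) (S.restrict (D.doors L₁) P).boxed (D.emb L₁)
      {p | p ∈ (D.cont L₁).ports ∧ D.emb L₁ p ∈ (S.restrict (D.doors L₁) P).boxed.ports} := by
  have hL : D.Active i L₁ := Or.inr hi.ge
  have hS := hT.isDiffPS hG
  have hQ := hT.doors_sub hG hr hL
  have hQb := hT.doors_not_box hG hr hL
  have hc := h.isComponent
  have hpre := (hG.circ L₁).pre
  have hkept : ∀ o : (D.cont L₁).boxes, ((D.cont L₁).content o).depth < i := fun o => by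
    rw [← hi]; exact depth_content_lt hpre o
  have hna : ∀ q, ¬ D.Attached i L₁ q := by
    rintro q ⟨o, ho, -⟩
    have := hkept o
    omega
  have hnQ : ∀ {q}, D.Own L₁ q → D.emb L₁ q ∉ D.doors L₁ := fun hq h =>
    hna _ (hT.own_of_mem_doors hG hr hL hq h).1
  have hcQ : ∀ {q}, q ∈ (D.cont L₁).circs → D.emb L₁ q ∈ D.doors L₁ := by
    intro q hq
    obtain ⟨o, ho, -⟩ := hG.cont_eq L₁ hr
    exact ⟨o, ho, q, q, (hG.door_circ hr hq ho).2.1, (hG.emb_circ L₁ q hr hq).symm⟩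
  have hown : ∀ {q}, q ∈ (D.cont L₁).ports → q ∉ (D.cont L₁).circs → D.Own L₁ q := fun hq hn =>
    ⟨hq, fun h => (hn h).elim⟩
  have hwire : ∀ {q}, D.Own L₁ q →
      (D.emb L₁ q ∈ (S.restrict (D.doors L₁) P).ground.wires ↔ D.emb L₁ q ∈ P) := fun hq =>
    (hc.mem_wires hS).trans (and_iff_left (hnQ hq))
  have hdoor : ∀ {q}, q ∈ (D.cont L₁).circs →
      D.emb L₁ q ∈ (S.restrict (D.doors L₁) P).boxed.ports →
      D.emb L₁ q ∈ (S.restrict (D.doors L₁) P).boxDoors := fun hq h =>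
    h.resolve_left fun hw => ((hc.mem_wires hS).1 hw).2 (hcQ hq)
  have hportsP : ∀ {q}, D.emb L₁ q ∈ (S.restrict (D.doors L₁) P).boxed.ports → D.emb L₁ q ∈ P := by
    rintro q (h | h)
    · exact ((hc.mem_wires hS).1 h).1
    · exact ((hc.mem_conclusions hS).1 h.1).1
  have hboxes : ∀ o : (D.cont L₁).boxes, D.emb L₁ ↑o ∈ S.boxes := fun o =>
    (hT.boxes _).2 ⟨L₁, o, hL, hkept o, rfl⟩
  have htargetP : ∀ {p q}, D.emb L₁ p ∈ P → (D.cont L₁).ground.target p = some q →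
      D.Own L₁ p ∧ D.Own L₁ q ∧ D.emb L₁ q ∈ P ∧ S.ground.target (D.emb L₁ p) = some
        (D.emb L₁ q) := by
    intro p q hp hq
    have hw : p ∈ (D.cont L₁).ground.wires := (hpre.ground.target_dom p).2 (by simp [hq])
    have hpo := hG.own_wire hw
    have hqo := hown (hpre.ground.target_mem p q hq).1 fun hqc =>
      ((hG.circ L₁).no_premise p q hq).2 hqc
    have ht : S.ground.target (D.emb L₁ p) = some (D.emb L₁ q) := by
      rw [hT.target_wire L₁ p hL hw, hq, Option.map_some]
    exact ⟨hpo, hqo, hc.closed _ hp (hnQ hpo) _ (hT.emb_port hG hL hqo.1)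
      (Or.inl ⟨(hT.wires L₁ p hL hpo).2 (Or.inl hr), ht⟩), ht⟩
  -- Boxing removes exactly the wires into `Q`, and these come from the conclusions of the content;
  -- so the remaining wires are those of the content.
  have hbwires : ∀ {p}, p ∈ (D.cont L₁).ports → D.emb L₁ p ∈ P →
      (p ∈ (D.cont L₁).ground.wires ↔ D.emb L₁ p ∈ (S.restrict (D.doors L₁) P).boxedWires) := by
    intro p hp hpP
    constructor
    · intro hw
      obtain ⟨q, hq⟩ := Option.ne_none_iff_exists'.1 ((hpre.ground.target_dom p).1 hw)
      obtain ⟨h1, h2, h3, h4⟩ := htargetP hpP hq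
      have h5 := (hwire h1).2 hpP
      exact ⟨h5, _, (hwire h2).2 h3, by rw [restrict_target h5, h4]⟩
    · rintro ⟨h1, q, hq, h2⟩
      rw [restrict_target h1] at h2
      have hpo : D.Own L₁ p := hown hp fun hpc => h1.2.2.1 (hcQ hpc)
      by_contra hw
      obtain ⟨o, ho, -⟩ := hG.cont_eq L₁ hr
      rw [hT.target_door L₁ p hL hr ⟨⟨hp, hw⟩, fun hpc => h1.2.2.1 (hcQ hpc)⟩ _ rfl o ho,
        Option.map_eq_some_iff] at h2
      obtain ⟨p', h3, rfl⟩ := h2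
      exact hq.2.2.1 ⟨o, ho, p, p', h3, rfl⟩
  refine ⟨fun p hp => hp.1, ⟨fun p hp => hp.2, (Describes.injOn_emb hG hL).mono fun p hp
    => hp.1, ?_⟩, ?_, ?_,
    ?_, ?_, ?_, ?_, ?_, ?_⟩
  · intro x hx
    suffices H : ∃ p ∈ (D.cont L₁).ports, D.emb L₁ p = x by
      obtain ⟨p, hp, rfl⟩ := H
      exact ⟨p, ⟨hp, hx⟩, rfl⟩
    rcases hx with hx | ⟨-, ⟨b, hb, hbP⟩, q, hq⟩
    · obtain ⟨h1, h2⟩ := (hc.mem_wires hS).1 hx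
      obtain ⟨p, hp, -, rfl⟩ := h.level x h1 h2
      exact ⟨p, hp.1, rfl⟩
    · obtain ⟨p, hp, -, rfl⟩ := h.level b hbP fun hbQ => hQb b hbQ hb
      have hq : S.door ⟨_, hb⟩ q = some x := hq
      obtain ⟨M, o, p', hM, ho, heq, -, h1, rfl⟩ := hT.door_cases hq
      obtain ⟨rfl, -⟩ := hG.emb_inj _ _ _ _ (hG.own_box o) hp heq
      exact ⟨p', (hG.circ _).pre.door_ports h1, rfl⟩
  · rintro p ⟨hp, hpV⟩
    by_cases hpc : p ∈ (D.cont L₁).circs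
    · rw [boxed_label_door (hdoor hpc hpV), hpc.2]
    · have hpo := hown hp hpc
      rw [boxed_label_wire ((hwire hpo).2 (hportsP hpV)), restrict_label (hportsP hpV),
        hT.label L₁ p hL hpo]
  · rintro p ⟨hp, hpV⟩
    rw [boxed_ty hpV, restrict_ty (hportsP hpV), hT.emb_ty hG hL hp]
  · rintro p ⟨hp, hpV⟩
    exact hbwires hp (hportsP hpV)
  · rintro p ⟨hp, hpV⟩ q hq
    obtain ⟨h1, h2, h3, h4⟩ := htargetP (hportsP hpV) hq
    refine ⟨⟨h2.1, Or.inl ((hwire h2).2 h3)⟩, ?_⟩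
    rw [boxed_target, restrict_target ((hwire h1).2 (hportsP hpV)), h4]
    exact (hbwires hp (hportsP hpV)).1 ((hpre.ground.target_dom p).2 (by simp [hq]))
  · rintro p ⟨hp, hpV⟩
    rw [boxed_left, Set.mem_inter_iff, ← hbwires hp (hportsP hpV)]
    constructor
    · intro hl
      have hw := (hpre.ground.left_sub p hl).1
      have hpo := hG.own_wire hw
      refine ⟨?_, hw⟩
      rw [hc.mem_restrict_left hS (hportsP hpV) (hnQ hpo), hT.left L₁ p hL hpo]
      exact hl
    · rintro ⟨hl, hw⟩
      have hpo := hG.own_wire hw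
      rwa [hc.mem_restrict_left hS (hportsP hpV) (hnQ hpo), hT.left L₁ p hL hpo] at hl
  · rintro p ⟨hp, hpV⟩
    rw [boxed_boxes]
    constructor
    · intro hb
      exact ⟨hboxes ⟨p, hb⟩, hportsP hpV⟩
    · rintro ⟨hb, -⟩
      obtain ⟨M, o, hM, ho, heq⟩ := (hT.boxes _).1 hb
      have hpo := hown hp fun hpc => hQb _ (hcQ hpc) hb
      obtain ⟨rfl, rfl⟩ := hG.emb_inj _ _ _ _ (hG.own_box o) hpo heq
      exact o.2
  · rintro o p q ⟨hp, hpV⟩ hd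
    refine ⟨hpre.door_ports hd, ?_⟩
    have hoP := hportsP hpV
    have hd' : S.door ⟨_, hboxes o⟩ p = some (D.emb L₁ q) := by
      rw [hT.door L₁ hL o _ rfl, hd, Option.map_some]
    have hqP : D.emb L₁ q ∈ P := hc.closed _ hoP (hnQ (hG.own_box o)) _
      (hT.emb_port hG hL (hpre.door_ports hd))
      (Or.inr (Or.inr ⟨⟨_, hboxes o⟩, hS.1.door_main _, p, hd'⟩))
    by_cases hqc : q ∈ (D.cont L₁).circs
    · exact Or.inr ⟨(hc.mem_conclusions hS).2 ⟨hqP, hcQ hqc⟩, ⟨_, hboxes o, hoP⟩, p, hd'⟩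
    · exact Or.inl ((hwire (hown (hpre.door_ports hd) hqc)).2 hqP)
  · rintro o ⟨b, hb, hbP⟩ ho heq
    have heq : b = D.emb L₁ ↑o := heq
    refine ⟨id, ?_, fun q _ => ?_⟩
    · show ((D.cont L₁).content o).IsIso (S.content ⟨b, hb⟩) id
      rw [hT.content L₁ hL o ⟨b, hb⟩ heq]
      exact .refl _
    · exact hT.door L₁ hL o ⟨b, hb⟩ heq q

end LevelData
end Net
end MELL

/-! ### Glueing the chosen components. -/

namespace MELL
namespace Net

variable {α β : Type u}

theorem Boxable.boxes_sub {S : Net α β} (hS : S.IsDiffPS) (h : S.Boxable) :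
    S.boxed.boxes ⊆ S.boxed.ports := by
  intro x hx
  refine Or.inl ?_
  by_contra hw
  have : x ∈ S.conclusions ∩ S.boxes := ⟨⟨hS.1.boxes_sub_ports hx, hw⟩, hx⟩
  rw [h.2.1] at this
  exact this

namespace LevelData

variable {R : Net α α} {k i : ℕ} {e : R.PseudoExp} {D : LevelData R} {S : Net α R.Name} {L₁ : D.Lv}

theorem exists_isIso_glue (hT : D.Describes i S) (hG : D.Good k e) (hk : 1 < k) (hr : L₁ ≠ D.root)
    (hi : (D.cont L₁).depth = i) {U : Set (Net α R.Name)} (hU : U ⊆ S.components (D.doors L₁) ∅ k)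
    {f : Set R.Name → Net α R.Name}
    (hf : Set.BijOn f {P | D.IsLevelComponent i S (D.doors L₁) L₁ P} U)
    (hsame : ∀ P, D.IsLevelComponent i S (D.doors L₁) L₁ P →
      (S.restrict (D.doors L₁) P).Same (f P)) :
    ∃ ρ : α → R.Name, (D.cont L₁).IsIso (glue (boxed '' U)) ρ ∧
      (∀ q ∈ (D.cont L₁).circs, ρ q = D.emb L₁ q) ∧
      ∀ q ∈ (D.cont L₁).notCircs, S.ground.target (ρ q) = S.ground.target (D.emb L₁ q) := by
  have hL : D.Active i L₁ := Or.inr hi.ge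
  have hS := hT.isDiffPS hG
  have hQ := hT.doors_sub hG hr hL
  have hQb := hT.doors_not_box hG hr hL
  have hB := (hG.circ L₁).isDiffPS
  have hUP : ∀ T ∈ U, ∃ P L, D.IsLevelComponent i S (D.doors L₁) L P ∧
      T = S.restrict (D.doors L₁) P := by
    intro T hTU
    obtain ⟨P, hP, rfl, hc⟩ := (mem_components_iff hS hQ hQb).1 (hU hTU)
    obtain ⟨L, h⟩ := hT.exists_isLevelComponent hG hk hr hL hP hc
    exact ⟨P, L, h, rfl⟩
  have hUdiff : ∀ T ∈ U, T.IsDiffPS := fun T hTU => (hU hTU).1.1.diff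
  have hUbox : ∀ T ∈ U, T.Boxable := by
    intro T hTU
    obtain ⟨P, L, h, rfl⟩ := hUP T hTU
    exact h.boxable hT hG hQ hQb
  have hcQ : ∀ {q}, q ∈ (D.cont L₁).circs → D.emb L₁ q ∈ D.doors L₁ := by
    intro q hq
    obtain ⟨o, ho, -⟩ := hG.cont_eq L₁ hr
    exact ⟨o, ho, q, q, (hG.door_circ hr hq ho).2.1, (hG.emb_circ L₁ q hr hq).symm⟩
  have hnQ : ∀ {q}, D.Own L₁ q → D.emb L₁ q ∉ D.doors L₁ := by
    intro q hq h
    obtain ⟨o, ho, -⟩ := (hT.own_of_mem_doors hG hr hL hq h).1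
    have := depth_content_lt (hG.circ L₁).pre o
    omega
  have hdiff : ∀ {P}, D.IsLevelComponent i S (D.doors L₁) L₁ P →
      (S.restrict (D.doors L₁) P).IsDiffPS := fun h => h.isComponent.isDiffPS hS hQ hQb
  have key : ∀ P, ∃ φ : R.Name → R.Name, D.IsLevelComponent i S (D.doors L₁) L₁ P →
      (S.restrict (D.doors L₁) P).IsIso (f P) φ ∧ ∀ x ∈ P, x ∈ D.doors L₁ → φ x = x := by
    intro P
    by_cases hP : D.IsLevelComponent i S (D.doors L₁) L₁ P
    · obtain ⟨φ, h1, h2⟩ := hsame P hP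
      exact ⟨φ, fun _ => ⟨h1, fun x hx hxQ => h2 x ((hP.isComponent.mem_conclusions hS).2
        ⟨hx, hxQ⟩)⟩⟩
    · exact ⟨id, fun h => (hP h).elim⟩
  choose φ hφ using key
  classical
  -- The map is assembled from the isomorphisms `φ P`. The chosen component does not matter: outside
  -- the doors it is unique, and on the doors every `φ P` is the identity.
  set ρ : α → R.Name := fun p =>
    if h : ∃ P, D.IsLevelComponent i S (D.doors L₁) L₁ P ∧ D.emb L₁ p ∈ P then
      φ h.choose (D.emb L₁ p) else D.emb L₁ p with hρdef
  have hρ : ∀ P, D.IsLevelComponent i S (D.doors L₁) L₁ P → ∀ p, D.emb L₁ p ∈ P →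
      ρ p = φ P (D.emb L₁ p) := by
    intro P hP p hp
    have h : ∃ P, D.IsLevelComponent i S (D.doors L₁) L₁ P ∧ D.emb L₁ p ∈ P := ⟨P, hP, hp⟩
    have h1 : ρ p = φ h.choose (D.emb L₁ p) := dif_pos h
    rw [h1]
    by_cases hpQ : D.emb L₁ p ∈ D.doors L₁
    · rw [(hφ _ h.choose_spec.1).2 _ h.choose_spec.2 hpQ, (hφ P hP).2 _ hp hpQ]
    · rw [h.choose_spec.1.isComponent.eq_of_mem hP.isComponent h.choose_spec.2 hp hpQ]
  have hρcirc : ∀ q ∈ (D.cont L₁).circs, ρ q = D.emb L₁ q := by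
    intro q hq
    by_cases h : ∃ P, D.IsLevelComponent i S (D.doors L₁) L₁ P ∧ D.emb L₁ q ∈ P
    · obtain ⟨P, hP, hqP⟩ := h
      rw [hρ P hP q hqP, (hφ P hP).2 _ hqP (hcQ hq)]
    · exact dif_neg h
  -- Boxing does not merge components, since the ports outside `Q` survive and determine them. So
  -- each boxed net comes from one component of `L₁`, recovered by `Function.invFunOn`.
  have hinj : Set.InjOn (fun P => (f P).boxed) {P | D.IsLevelComponent i S (D.doors L₁) L₁ P} := by
    intro P hP P' hP' heq
    have heq : (f P).boxed = (f P').boxed := heq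
    refine hf.injOn hP hP' ?_
    obtain ⟨P₁, N₁, h₁, he₁⟩ := hUP _ (hf.mapsTo hP)
    obtain ⟨P₂, N₂, h₂, he₂⟩ := hUP _ (hf.mapsTo hP')
    rw [he₁, he₂] at heq ⊢
    obtain ⟨x, hx, hxQ⟩ := h₁.isComponent.nonempty
    have hx' : x ∈ (S.restrict (D.doors L₁) P₂).boxed.ports := by
      rw [← heq]
      exact Or.inl ((h₁.isComponent.mem_wires hS).2 ⟨hx, hxQ⟩)
    rw [h₁.isComponent.eq_of_mem h₂.isComponent hx
      (show x ∈ P₂ from boxed_ports_sub (h₂.isComponent.isDiffPS hS hQ hQb) hx') hxQ]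
  have hleftinv : ∀ P, D.IsLevelComponent i S (D.doors L₁) L₁ P →
      Function.invFunOn (fun P => (f P).boxed) {P | D.IsLevelComponent i S (D.doors L₁) L₁ P}
        (f P).boxed = P := fun P hP => hinj.leftInvOn_invFunOn hP
  refine ⟨ρ, ?_, hρcirc, ?_⟩
  · refine isIso_glue hB (gluable_boxed (Q := D.doors L₁) hS fun T hTU => ?_)
      (fun V => {p | p ∈ (D.cont L₁).ports ∧ D.emb L₁ p ∈ (S.restrict (D.doors L₁)
        (Function.invFunOn (fun P => (f P).boxed)
          {P | D.IsLevelComponent i S (D.doors L₁) L₁ P} V)).boxed.ports}) ?_ ?_ ?_ ?_ ?_ ?_ ?_ ?_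
            ?_
    · obtain ⟨P, L, h, rfl⟩ := hUP T hTU
      exact ⟨P, h.isComponent, rfl⟩
    · rintro _ ⟨T, hTU, rfl⟩
      obtain ⟨P, hP, rfl⟩ := hf.surjOn hTU
      have hP : D.IsLevelComponent i S (D.doors L₁) L₁ P := hP
      simp only [hleftinv P hP]
      refine (isPart_boxed hT hG hr hi hP).comp hB
        ((hφ P hP).1.boxed (hdiff hP) (hUdiff _ hTU))
        ((hP.boxable hT hG hQ hQb).boxes_sub (hdiff hP)) ?_
      rintro p ⟨-, hp⟩
      exact hρ P hP p (boxed_ports_sub (hdiff hP) hp)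
    · have hown : ∀ p, D.Own L₁ p → ∃ P, D.IsLevelComponent i S (D.doors L₁) L₁ P ∧
          D.emb L₁ p ∈ (S.restrict (D.doors L₁) P).boxed.ports := by
        intro p hp
        obtain ⟨P, hpP, hP⟩ := hT.exists_component hG hr hi hp
        exact ⟨P, hP, Or.inl ((hP.isComponent.mem_wires hS).2 ⟨hpP, hnQ hp⟩)⟩
      intro p hp
      suffices H : ∃ P, D.IsLevelComponent i S (D.doors L₁) L₁ P ∧
          D.emb L₁ p ∈ (S.restrict (D.doors L₁) P).boxed.ports by
        obtain ⟨P, hP, hpP⟩ := H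
        refine ⟨(f P).boxed, ⟨f P, hf.mapsTo hP, rfl⟩, ?_⟩
        simp only [hleftinv P hP]
        exact ⟨hp, hpP⟩
      by_cases hpc : p ∈ (D.cont L₁).circs
      -- A `∘`-conclusion is a door of a box of the content, and it survives in the component that
      -- contains this box.
      · obtain ⟨o, p', hd⟩ := (hG.circ L₁).circ_covered p hpc
        obtain ⟨P, hP, hoP⟩ := hown _ (hG.own_box o)
        exact ⟨P, hP, ((isPart_boxed hT hG hr hi hP).door_mem o p' p ⟨(hG.own_box o).1, hoP⟩ hd).2⟩
      · exact hown p ⟨hp, fun h => (hpc h).elim⟩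
    · intro p hp q hq hpq
      rw [hρcirc p hp, hρcirc q hq] at hpq
      exact Describes.injOn_emb hG hL hp.1 hq.1 hpq
    · rintro _ ⟨T, hTU, rfl⟩ x hx
      by_contra hn
      exact hx (boxed_label_none hn)
    · rintro _ ⟨T, hTU, rfl⟩ x hx
      by_contra hn
      exact hx (boxed_ty_none hn)
    · rintro _ ⟨T, hTU, rfl⟩ x hx
      by_contra hn
      exact hx (boxed_target_none fun hw => hn (Or.inl hw.1))
    · rintro _ ⟨T, hTU, rfl⟩ x hx
      exact Or.inl hx.1
    · rintro _ ⟨T, hTU, rfl⟩ x hx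
      exact Or.inl hx.2.1
    · rintro _ ⟨T, hTU, rfl⟩
      exact (hUbox T hTU).boxes_sub (hUdiff T hTU)
  · intro q hq
    have hqo := hG.own_notCirc hq
    obtain ⟨P, hqP, hP⟩ := hT.exists_component hG hr hi hqo
    rw [hρ P hP q hqP]
    have hw := (hP.isComponent.mem_wires hS).2 ⟨hqP, hnQ hqo⟩
    have hiso := (hφ P hP).1.ground
    have hw' := (hiso.wires _ hqP).1 hw
    have htar := hiso.target _ hw
    obtain ⟨P', L, hP', he⟩ := hUP _ (hf.mapsTo hP)
    rw [he] at htar hw'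
    rw [restrict_target hw', restrict_target hw] at htar
    rw [htar]
    obtain ⟨x, hx, hx'⟩ := hw.2.2.2
    rw [hx', Option.map_some]
    congr 1
    -- The target is a door, which the isomorphism fixes.
    refine (hφ P hP).2 x hx ?_
    obtain ⟨o, ho, -⟩ := hG.cont_eq L₁ hr
    rw [hT.target_door L₁ q hL hr hq _ rfl o ho, Option.map_eq_some_iff] at hx'
    obtain ⟨p', h1, rfl⟩ := hx'
    exact ⟨o, ho, q, p', h1, rfl⟩

end LevelData
end Net
end MELL

/-! ### Recovery of the box and its content. -/

theorem mainTheorem4 {α : Type u} (R : Net α α) (hR : R.IsCircPS) (k : ℕ) (hk : 1 < k)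
    (hkb : Nat.card R.Box < k) (hkc : R.cosize < k)
    (e : R.PseudoExp) (he : Net.KInjective k R e) (i j₀ : ℕ) (hj₀ : j₀ ∈ Net.expN k R e i)
    (U : Set (Net α R.Name))
    (hU : U ⊆ (Net.taylor i R e).components ((Net.taylor i R e).critical k j₀) ∅ k)
    (hUcard : ∀ T ∈ (Net.taylor i R e).components ((Net.taylor i R e).critical k j₀) ∅ k,
      {T' | T' ∈ U ∧ T'.Same T}.ncard =
        digit k {T' | T' ∈ (Net.taylor i R e).components ((Net.taylor i R e).critical k j₀) ∅ k ∧
          T'.Same T}.ncard j₀) :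
    (∀ T ∈ U, T.Boxable) ∧ Net.Gluable (Net.boxed '' U) ∧
    ∃ o : R.Name, (∀ o', (Net.taylor i R e).IsBang k j₀ o' ↔ o' = o) ∧
    ∃ ho : o ∈ (Net.taylor (i + 1) R e).boxes,
      (Net.taylor i R e).arity o =
        {q | (Net.taylor (i + 1) R e).door ⟨o, ho⟩ q = some o}.ncard * k ^ j₀ ∧
      ∃ ρ : α → R.Name,
        ((Net.taylor (i + 1) R e).content ⟨o, ho⟩).IsIso (Net.glue (Net.boxed '' U)) ρ ∧
        (∀ q ∈ ((Net.taylor (i + 1) R e).content ⟨o, ho⟩).circs,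
          (Net.taylor (i + 1) R e).door ⟨o, ho⟩ q = some (ρ q)) ∧
        (∀ q ∈ ((Net.taylor (i + 1) R e).content ⟨o, ho⟩).notCircs,
          ∃ p, (Net.taylor i R e).ground.target (ρ q) = some p ∧
            (Net.taylor (i + 1) R e).door ⟨o, ho⟩ q = some p) := by
  obtain ⟨D, hG, hD⟩ := hR.exists_levelData hk e hkb hkc he
  have hT := hD i
  have hT' := hD (i + 1)
  -- Both expansions are described by the same levels `D`; nothing else about them is needed.
  generalize Net.taylor (i + 1) R e = S' at hT' ⊢
  generalize Net.taylor i R e = S at hT hU hUcard ⊢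
  obtain ⟨L₁, hr, rfl, hle⟩ := (hG.mem_expM_iff hk i j₀).1 hj₀.1
  have hi : (D.cont L₁).depth = i := by
    by_contra hne
    exact hj₀.2 ((hG.mem_expM_iff hk (i + 1) _).2 ⟨L₁, hr, rfl, by omega⟩)
  have hL : D.Active i L₁ := Or.inr hi.ge
  have hS := hT.isDiffPS hG
  have hQ := hT.doors_sub hG hr hL
  have hQb := hT.doors_not_box hG hr hL
  rw [hT.critical_eq hG hk hr hi] at hU hUcard
  obtain ⟨f, hf, hsame⟩ := hT.exists_matching hG hk hr hL hU hUcard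
  obtain ⟨ρ, hρ, hρc, hρn⟩ := Net.LevelData.exists_isIso_glue hT hG hk hr hi hU hf hsame
  obtain ⟨o₀, ho₀, hc₀⟩ := hG.cont_eq L₁ hr
  have hdepth := hG.depth_lt hr
  have hM : D.Active i (D.par L₁) := hG.active_par hr hL
  -- The parent has depth greater than `i`, so it is present in the next expansion as well, while
  -- the box, with content of depth `i < i + 1`, is now kept.
  have hM' : D.Active (i + 1) (D.par L₁) := Or.inr (by omega)
  have ho : D.emb (D.par L₁) ↑o₀ ∈ S'.boxes :=
    (hT'.boxes _).2 ⟨D.par L₁, o₀, hM', by rw [hc₀]; omega, rfl⟩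
  have hcont : S'.content ⟨_, ho⟩ = D.cont L₁ := (hT'.content _ hM' o₀ ⟨_, ho⟩ rfl).trans hc₀
  have hdoor := hT'.door _ hM' o₀ ⟨_, ho⟩ rfl
  refine ⟨?_, ?_, D.emb (D.par L₁) ↑o₀, hT.isBang_iff hG hk hr hi o₀ ho₀, ho, ?_, ρ, ?_, ?_, ?_⟩
  · intro T hTU
    obtain ⟨P, hP, rfl, hc⟩ := (Net.mem_components_iff hS hQ hQb).1 (hU hTU)
    obtain ⟨L, h⟩ := hT.exists_isLevelComponent hG hk hr hL hP hc
    exact h.boxable hT hG hQ hQb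
  · refine Net.LevelData.gluable_boxed hS (Q := D.doors L₁) fun T hTU => ?_
    obtain ⟨P, hP, rfl, -⟩ := (Net.mem_components_iff hS hQ hQb).1 (hU hTU)
    exact ⟨P, hP, rfl⟩
  · rw [(hT.arity_box hG hr hL o₀ ho₀).1]
    congr 2
    ext q
    show _ ↔ S'.door ⟨_, ho⟩ q = _
    rw [hdoor q, hG.emb_door_iff hM (hG.own_box o₀)]
    exact (and_iff_left rfl).symm
  · rw [hcont]
    exact hρ
  · rw [hcont]
    intro q hq
    rw [hdoor q, (hG.door_circ hr hq ho₀).2.1, Option.map_some, hρc q hq, hG.emb_circ L₁ q hr hq]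
  · rw [hcont]
    intro q hq
    have hqc : q ∈ ((D.cont (D.par L₁)).content o₀).conclusions := by
      rw [hc₀]
      exact hq.1
    obtain ⟨p, hp⟩ := Option.ne_none_iff_exists'.1 (((hG.circ _).pre.door_dom o₀ q).1 hqc)
    refine ⟨D.emb (D.par L₁) p, ?_, ?_⟩
    · rw [hρn q hq, hT.target_door L₁ q hL hr hq _ rfl o₀ ho₀, hp, Option.map_some]
    · rw [hdoor q, hp, Option.map_some]
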